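/- A \emph{decomposition} of an abelian group $A$ is a family $\{A_i\}_{i\in I}$ of subgroups of $A$ such that the natural map $\bigoplus_{i\in I}A_i\to A$ is an isomorphism. For a map $f:I\to J$ of sets write $f_*\{A_i\}_{i\in I}=\{\sum_{i\in f^{-1}(j)}A_i\}_{j\in J}$, which is again a decomposition of $A$. A decomposition $\{A_i\}_{i\in I}$ of $A$ \emph{restricts} to a subgroup $B\subseteq A$ if $\{A_i\cap B\}_{i\in I}$ is a decomposition of $B$. \textbf{Theorem.} There is a deterministic algorithm that takes as input - integers $n,r,m\ge 0$ and $k_1,\dots,k_r\ge 0$; - a matrix $M_A\in\mathbb Z^{n\times n}$, representing the finitely generated abelian group $A=\mathbb Z^n/M_A\mathbb Z^n$; - matrices $G_i\in\mathbb Z^{n\times k_i}$ for $i\in I=\{1,\dots,r\}$, such that the subgroups $A_i\subseteq A$ generated by the images of the columns of $G_i$ form a decomposition $\mathcal A=\{A_i\}_{i\in I}$ of $A$; - a matrix $G_B\in\mathbb Z^{n\times m}$, representing the subgroup $B\subseteq A$ generated by the images of its columns, and that outputs a finite set $U$ and a map $u:I\to U$ (given by the number $\#U$ and its table of values) such that $u_*\mathcal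 A$ restricts to $B$ and such that $u$ is universal with this property: for every set $J$ and every map $f:I\to J$ such that $f_*\mathcal A$ restricts to $B$ there is a unique map $g:U\to J$ with $f=g\circ u$. The algorithm runs in time polynomial in the length of the input. Here integers are encoded in binary, matrices are given by the list of their entries, the length of the input is its total number of bits, and the running time is measured on a deterministic random access machine with logarithmic cost. -/

import Mathlib

/-! ### Decompositions of modules and their restrictions -/

namespace ModuleDecomposition

variable {R : Type*} [Ring R] {M : Type*} [AddCommGroup M] [Module R M]

open Classical in
/-- A family of submodules of `M` is a decomposition of `M` if the natural map from its direct sum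
to `M` is an isomorphism. -/
def IsDecomposition {I : Type*} (𝒜 : I → Submodule R M) : Prop :=
  DirectSum.IsInternal 𝒜

/-- The coarsening `f_* 𝒜 = (∑_{i ∈ f⁻¹ j} 𝒜 i)_j` of a family of submodules along `f`. -/
def pushforward {I J : Type*} (f : I → J) (𝒜 : I → Submodule R M) : J → Submodule R M :=
  fun j => ⨆ i ∈ f ⁻¹' {j}, 𝒜 i

/-- `𝒜` restricts to `B` if the intersections `𝒜 i ∩ B`, as submodules of `B`, are a
decomposition of `B`. -/
def RestrictsTo {I : Type*} (𝒜 : I → Submodule R M) (B : Submodule R M) : Prop :=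
  IsDecomposition (fun i => (𝒜 i).comap B.subtype)

/-- `u : I → U` is the universal map whose coarsening of `𝒜` restricts to `B`: every map
`f : I → J` such that `f_* 𝒜` restricts to `B` factors uniquely through `u`. -/
def IsUniversalRestricting.{v, w, x, y, z} {R : Type w} [Ring R] {M : Type x} [AddCommGroup M]
    [Module R M] {I : Type y} {U : Type z} (𝒜 : I → Submodule R M) (B : Submodule R M)
    (u : I → U) : Prop :=
  RestrictsTo (pushforward u 𝒜) B ∧
    ∀ (J : Type v) (f : I → J), RestrictsTo (pushforward f 𝒜) B → ∃! g : U → J, g ∘ u = f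

end ModuleDecomposition

/-! ### Random access machines with logarithmic cost

Programs are structured (`while`) programs. The memory consists of integer arrays, each indexed by
the integers; a program names only finitely many arrays. Every operation is charged the
bit length of its operands and of its result, addresses included. -/

namespace RandomAccess

/-- The number of bits of an integer: its binary digits and a sign. -/
def bitLength (z : ℤ) : ℕ := z.natAbs.size + 1

/-- The contents of the memory: `μ a i` is cell `i` of array `a`. -/
abbrev Memory : Type := ℕ → ℤ → ℤ

/-- Write the value `z` to cell `i` of array `a`. -/
def Memory.write (μ : Memory) (a : ℕ) (i z : ℤ) : Memory :=
  fun b j => if b = a ∧ j = i then z else μ b j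

/-- Integer expressions; `read a e` is the cell of array `a` whose index is the value of `e`. -/
inductive Expr : Type
  | const (z : ℤ)
  | read (a : ℕ) (e : Expr)
  | add (e f : Expr)
  | sub (e f : Expr)
  | mul (e f : Expr)
  | div (e f : Expr)
  | mod (e f : Expr)
  | le (e f : Expr)

/-- The value of an expression. Division is Euclidean division of integers, with `z / 0 = 0` and
`z % 0 = z`; a comparison has value `1` or `0`. -/
def Expr.value (μ : Memory) : Expr → ℤ
  | .const z => z
  | .read a e => μ a (e.value μ)
  | .add e f => e.value μ + f.value μ
  | .sub e f => e.value μ - f.value μ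
  | .mul e f => e.value μ * f.value μ
  | .div e f => e.value μ / f.value μ
  | .mod e f => e.value μ % f.value μ
  | .le e f => if e.value μ ≤ f.value μ then 1 else 0

/-- The logarithmic cost of evaluating an expression: the total bit length of the values of all
its subexpressions. -/
def Expr.cost (μ : Memory) : Expr → ℕ
  | .const z => bitLength z
  | .read a e => e.cost μ + bitLength ((Expr.read a e).value μ)
  | .add e f => e.cost μ + f.cost μ + bitLength ((Expr.add e f).value μ)
  | .sub e f => e.cost μ + f.cost μ + bitLength ((Expr.sub e f).value μ)
  | .mul e f => e.cost μ + f.cost μ + bitLength ((Expr.mul e f).value μ)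
  | .div e f => e.cost μ + f.cost μ + bitLength ((Expr.div e f).value μ)
  | .mod e f => e.cost μ + f.cost μ + bitLength ((Expr.mod e f).value μ)
  | .le e f => e.cost μ + f.cost μ + bitLength ((Expr.le e f).value μ)

/-- Programs: do nothing; assign the value of `e` to the cell of array `a` with index the value
of `i`; composition; branching on `c ≠ 0`; looping while `c ≠ 0`. -/
inductive Program : Type
  | skip
  | assign (a : ℕ) (i e : Expr)
  | seq (P Q : Program)
  | branch (c : Expr) (P Q : Program)
  | loop (c : Expr) (P : Program)

/-- `Runs P μ ν t`: started on the memory `μ`, the program `P` halts with memory `ν` after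
running for time exactly `t`. -/
inductive Runs : Program → Memory → Memory → ℕ → Prop
  | skip (μ : Memory) : Runs .skip μ μ 1
  | assign (a : ℕ) (i e : Expr) (μ : Memory) :
      Runs (.assign a i e) μ (μ.write a (i.value μ) (e.value μ)) (i.cost μ + e.cost μ + 1)
  | seq {P Q : Program} {μ ν ρ : Memory} {s t : ℕ} :
      Runs P μ ν s → Runs Q ν ρ t → Runs (.seq P Q) μ ρ (s + t)
  | branch_true {c : Expr} {P Q : Program} {μ ν : Memory} {t : ℕ} :
      c.value μ ≠ 0 → Runs P μ ν t → Runs (.branch c P Q) μ ν (c.cost μ + t + 1)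
  | branch_false {c : Expr} {P Q : Program} {μ ν : Memory} {t : ℕ} :
      c.value μ = 0 → Runs Q μ ν t → Runs (.branch c P Q) μ ν (c.cost μ + t + 1)
  | loop_true {c : Expr} {P : Program} {μ ν ρ : Memory} {s t : ℕ} :
      c.value μ ≠ 0 → Runs P μ ν s → Runs (.loop c P) ν ρ t →
        Runs (.loop c P) μ ρ (c.cost μ + s + t + 1)
  | loop_false {c : Expr} {P : Program} {μ : Memory} :
      c.value μ = 0 → Runs (.loop c P) μ μ (c.cost μ + 1)

/-- Programs are deterministic: the final memory and the running time are determined by the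
program and the initial memory. -/
theorem Runs.deterministic {P : Program} {μ ν ν' : Memory} {t t' : ℕ}
    (h : Runs P μ ν t) (h' : Runs P μ ν' t') : ν = ν' ∧ t = t' := by
  induction h generalizing ν' t' with
  | skip => cases h'; exact ⟨rfl, rfl⟩
  | assign => cases h'; exact ⟨rfl, rfl⟩
  | seq _ _ ih₁ ih₂ =>
    cases h' with
    | seq h₁ h₂ =>
      obtain ⟨rfl, rfl⟩ := ih₁ h₁
      obtain ⟨rfl, rfl⟩ := ih₂ h₂
      exact ⟨rfl, rfl⟩
  | branch_true hc _ ih =>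
    cases h' with
    | branch_true _ h₁ => obtain ⟨rfl, rfl⟩ := ih h₁; exact ⟨rfl, rfl⟩
    | branch_false hc' _ => exact absurd hc' hc
  | branch_false hc _ ih =>
    cases h' with
    | branch_true hc' _ => exact absurd hc hc'
    | branch_false _ h₁ => obtain ⟨rfl, rfl⟩ := ih h₁; exact ⟨rfl, rfl⟩
  | loop_true hc _ _ ih₁ ih₂ =>
    cases h' with
    | loop_true _ h₁ h₂ =>
      obtain ⟨rfl, rfl⟩ := ih₁ h₁
      obtain ⟨rfl, rfl⟩ := ih₂ h₂
      exact ⟨rfl, rfl⟩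
    | loop_false hc' => exact absurd hc' hc
  | loop_false hc =>
    cases h' with
    | loop_true hc' _ _ => exact absurd hc hc'
    | loop_false _ => exact ⟨rfl, rfl⟩

/-- The initial memory on an input word: the word is in the cells `0, 1, 2, …` of array `0`, and
all other cells are `0`. -/
def initial (w : List ℤ) : Memory :=
  fun a i => if a = 0 ∧ 0 ≤ i then w.getD i.toNat 0 else 0

/-- The memory holds the output word `w` in the cells `0, 1, 2, …` of array `1`. -/
def HoldsOutput (μ : Memory) (w : List ℤ) : Prop :=
  ∀ i : Fin w.length, μ 1 (i : ℕ) = w.get i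

/-- The length of a word: the total number of bits of its entries. -/
def wordLength (w : List ℤ) : ℕ := (w.map bitLength).sum

end RandomAccess

/-! ### Matrix representations of groups, subgroups and decompositions -/

/-- The input of the algorithm: a matrix `relations` representing the group
`ℤⁿ / relations ℤⁿ`, a generator matrix for each member of a finite family of subgroups, and a
generator matrix for one more subgroup. -/
structure DecompositionInput where
  /-- the number of generators of the group -/
  n : ℕ
  /-- the matrix representation of the group -/
  relations : Matrix (Fin n) (Fin n) ℤ
  /-- the number of members of the family -/
  r : ℕ
  /-- the numbers of generators of the members of the family -/
  k : Fin r → ℕ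
  /-- the generator matrices of the members of the family -/
  generators : (i : Fin r) → Matrix (Fin n) (Fin (k i)) ℤ
  /-- the number of generators of the other subgroup -/
  m : ℕ
  /-- the generator matrix of the other subgroup -/
  subgroupGenerators : Matrix (Fin n) (Fin m) ℤ

namespace DecompositionInput

variable (X : DecompositionInput)

/-- The finitely generated abelian group `A = ℤⁿ / M_A ℤⁿ`. -/
abbrev Group : Type :=
  (Fin X.n → ℤ) ⧸ LinearMap.range X.relations.mulVecLin

/-- The subgroup of `A` generated by the columns of a matrix. -/
def generated {l : ℕ} (G : Matrix (Fin X.n) (Fin l) ℤ) : Submodule ℤ X.Group :=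
  (LinearMap.range G.mulVecLin).map (LinearMap.range X.relations.mulVecLin).mkQ

/-- The family `(A_i)_{i ∈ I}` of subgroups of `A`. -/
def family (i : Fin X.r) : Submodule ℤ X.Group := X.generated (X.generators i)

/-- The subgroup `B` of `A`. -/
def subgroup : Submodule ℤ X.Group := X.generated X.subgroupGenerators

/-- The entries of a matrix, row by row. -/
def matrixWord {a b : ℕ} (G : Matrix (Fin a) (Fin b) ℤ) : List ℤ :=
  (List.ofFn fun i => List.ofFn fun j => G i j).flatten

/-- The input as a word of integers: the dimensions of each matrix that are not yet known,
followed by its entries. -/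
def encode : List ℤ :=
  (X.n : ℤ) :: matrixWord X.relations ++
  (X.r : ℤ) :: (List.ofFn fun i => (X.k i : ℤ) :: matrixWord (X.generators i)).flatten ++
  (X.m : ℤ) :: matrixWord X.subgroupGenerators

/-- A map `u : {0, …, r - 1} → {0, …, s - 1}` as a word of integers: the number `s` followed by
the table of values of `u`. -/
def encodeMap {r s : ℕ} (u : Fin r → Fin s) : List ℤ :=
  (s : ℤ) :: List.ofFn fun i => ((u i : ℕ) : ℤ)

end DecompositionInput

universe v

/-! For a set T of indices let A_T be the sum of the A_i with i in T, and say that B splits along T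
if B is the sum of its intersections with A_T and with the sum over the complement. If f_*𝒜
restricts to B, then B splits along every fibre of f; the converse holds for finite J. Hence a
surjection u to a finite set is universal as soon as B splits exactly along the unions of fibres of
u (`isUniversalRestricting_of_splits`), and the task is to compute this partition of I.

In the free group on the given generators of all A_i, the elements that map into B form a lattice. B
splits along T if and only if this lattice is stable under the projection to the coordinates that
belong to T. For a basis in Hermite normal form this means that every row has its support on one
side of T (`indicator_mem_iff`): otherwise a row minus its projection would be a lattice vector
whose leading entry lies strictly between 0 and the pivot of its column. So the wanted partition
consists of the connected components of the graph in which each non-zero entry of the normal form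
links two indices. The lattice appears as the part with vanishing first n coordinates of a lattice
spanned by vectors (column, unit vector), so the rows of the normal form beyond n describe it.

The obstacle is coefficient growth. Adding all multiples of an integer N to the lattice allows
reduction modulo N throughout, but replaces B by B + NA, and A may be infinite. The key lemma
`splits_of_splits_modSubgroup` shows that a suitable N with polynomially many bits does no harm. Let
the columns of H be the relations and the generators of B. The Faddeev–LeVerrier algorithm for HHᵀ,
stopped at the last non-zero coefficient t of the characteristic polynomial, gives integer matrices
with t·1 = Φ + HZ and ΦH = 0 (`exists_generalized_inverse`), so Φ detects the preimage of B up to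
the factor t. The same construction for the relations and the generators of the family represents a
non-zero multiple t'p of the component p of a generator of B by a small vector f. If p lies in B +
NA, then Φf is divisible by a number that exceeds its entries. Hence Φf = 0, and p lies in B.

The program is verified with Hoare triples that count steps and bound all assigned values.
`Exec.runs` converts steps into logarithmic cost, with a factor that is polynomial in the bit length
of the bound. -/

/-! ### Counting steps of bounded runs -/

namespace RandomAccess

/-- All cells of the memory are at most `V` in absolute value. -/
def Bounded (V : ℕ) (μ : Memory) : Prop := ∀ a i, (μ a i).natAbs ≤ V

/-- A bound for the size of an expression, constants included. -/
def Expr.weight : Expr → ℕ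
  | .const z => z.natAbs + 1
  | .read _ e => e.weight + 1
  | .add e f => e.weight + f.weight + 1
  | .sub e f => e.weight + f.weight + 1
  | .mul e f => e.weight + f.weight + 1
  | .div e f => e.weight + f.weight + 1
  | .mod e f => e.weight + f.weight + 1
  | .le e f => e.weight + f.weight + 1

theorem Expr.weight_pos (e : Expr) : 1 ≤ e.weight := by
  cases e <;> simp [Expr.weight]

theorem natAbs_ediv_le (a b : ℤ) : (a / b).natAbs ≤ a.natAbs := Int.natAbs_ediv_le_natAbs a b

theorem natAbs_emod_le (a b : ℤ) : (a % b).natAbs ≤ a.natAbs + b.natAbs := by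
  rcases eq_or_ne b 0 with rfl | hb
  · simp
  · have h1 := Int.emod_nonneg a hb
    have h2 := Int.emod_lt_abs a hb
    rw [Int.abs_eq_natAbs] at h2
    omega

theorem add_pow_le_pow_add {V a b : ℕ} (hV : 2 ≤ V) (ha : 1 ≤ a) (hb : 1 ≤ b) :
    V ^ a + V ^ b ≤ V ^ (a + b + 1) := by
  have h1 : V ^ a ≤ V ^ (a + b) := Nat.pow_le_pow_right (by omega) (by omega)
  have h2 : V ^ b ≤ V ^ (a + b) := Nat.pow_le_pow_right (by omega) (by omega)
  calc V ^ a + V ^ b ≤ V ^ (a + b) * 2 := by omega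
    _ ≤ V ^ (a + b) * V := Nat.mul_le_mul_left _ hV
    _ = V ^ (a + b + 1) := (pow_succ _ _).symm

/-- Exponents add under multiplication, and the extra 1 in the weight absorbs a sum of two powers
because 2 ≤ V. A constant is weighted by its absolute value, so that it too is below the power of V.
-/
theorem Expr.natAbs_value_le {V : ℕ} (hV : 2 ≤ V) {μ : Memory} (hμ : Bounded V μ) (e : Expr) :
    (e.value μ).natAbs ≤ V ^ e.weight := by
  induction e with
  | const z =>
    calc z.natAbs ≤ V ^ z.natAbs := (Nat.lt_pow_self (by omega)).le
      _ ≤ V ^ (z.natAbs + 1) := Nat.pow_le_pow_right (by omega) (by omega)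
  | read a e ih => exact (hμ _ _).trans (Nat.le_self_pow (by simp [weight]) V)
  | add e f he hf =>
    refine le_trans ?_ (add_pow_le_pow_add hV e.weight_pos f.weight_pos)
    exact (Int.natAbs_add_le _ _).trans (add_le_add he hf)
  | sub e f he hf =>
    refine le_trans ?_ (add_pow_le_pow_add hV e.weight_pos f.weight_pos)
    exact (Int.natAbs_sub_le _ _).trans (add_le_add he hf)
  | mul e f he hf =>
    simp only [value, weight, Int.natAbs_mul]
    calc _ ≤ V ^ e.weight * V ^ f.weight := Nat.mul_le_mul he hf
      _ = V ^ (e.weight + f.weight) := (pow_add _ _ _).symm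
      _ ≤ _ := Nat.pow_le_pow_right (by omega) (by omega)
  | div e f he hf =>
    exact (natAbs_ediv_le _ _).trans (he.trans (Nat.pow_le_pow_right (by omega)
      (by simp only [weight]; omega)))
  | mod e f he hf =>
    refine le_trans ?_ (add_pow_le_pow_add hV e.weight_pos f.weight_pos)
    exact (natAbs_emod_le _ _).trans (add_le_add he hf)
  | le e f he hf =>
    have : 1 ≤ V ^ (Expr.le e f).weight := Nat.one_le_pow _ _ (by omega)
    simp only [value]
    split <;> simp_all

/-- The time that a subexpression of weight at most `w` needs on a memory with cells of at most
`σ` bits. -/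
def unitCost (w σ : ℕ) : ℕ := w * (w * σ + 1)

theorem unitCost_mono {w w' : ℕ} (σ : ℕ) (h : w ≤ w') : unitCost w σ ≤ unitCost w' σ := by
  unfold unitCost; gcongr

/-- Superadditivity with room for the node itself: the last summand on the left pays for the bit
length of the value at the root of a compound expression. -/
theorem unitCost_add (a b σ : ℕ) :
    unitCost a σ + unitCost b σ + ((a + b + 1) * σ + 1) ≤ unitCost (a + b + 1) σ := by
  unfold unitCost; nlinarith [Nat.zero_le (a * b * σ), Nat.zero_le (a * σ), Nat.zero_le (b * σ)]

theorem unitCost_add_one (a b σ : ℕ) :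
    unitCost a σ + unitCost b σ + 1 ≤ unitCost (a + b + 1) σ := by
  have := unitCost_add a b σ; omega

theorem Expr.bitLength_value_le {V : ℕ} (hV : 2 ≤ V) {μ : Memory} (hμ : Bounded V μ) (e : Expr) :
    bitLength (e.value μ) ≤ e.weight * V.size + 1 := by
  unfold bitLength
  gcongr
  rw [Nat.size_le]
  calc (e.value μ).natAbs ≤ V ^ e.weight := e.natAbs_value_le hV hμ
    _ < (2 ^ V.size) ^ e.weight :=
      Nat.pow_lt_pow_left (Nat.lt_size_self V) (by have := e.weight_pos; omega)
    _ = _ := by rw [← pow_mul, mul_comm]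

theorem Expr.cost_le {V : ℕ} (hV : 2 ≤ V) {μ : Memory} (hμ : Bounded V μ) (e : Expr) :
    e.cost μ ≤ unitCost e.weight V.size := by
  have hb := fun e : Expr => e.bitLength_value_le hV hμ
  induction e with
  | const z =>
    have := hb (.const z)
    simp only [value, weight] at this
    simp only [cost, weight]
    refine this.trans ?_
    exact Nat.le_mul_of_pos_left _ (by omega)
  | read a e ih =>
    have := hb (.read a e)
    have h2 := unitCost_add e.weight 0 V.size
    simp only [weight] at this
    simp only [cost, weight]
    simp only [add_zero] at h2
    omega
  | add e f he hf =>
    have := hb (.add e f); have h2 := unitCost_add e.weight f.weight V.size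
    simp only [weight] at this; simp only [cost, weight]; omega
  | sub e f he hf =>
    have := hb (.sub e f); have h2 := unitCost_add e.weight f.weight V.size
    simp only [weight] at this; simp only [cost, weight]; omega
  | mul e f he hf =>
    have := hb (.mul e f); have h2 := unitCost_add e.weight f.weight V.size
    simp only [weight] at this; simp only [cost, weight]; omega
  | div e f he hf =>
    have := hb (.div e f); have h2 := unitCost_add e.weight f.weight V.size
    simp only [weight] at this; simp only [cost, weight]; omega
  | mod e f he hf =>
    have := hb (.mod e f); have h2 := unitCost_add e.weight f.weight V.size
    simp only [weight] at this; simp only [cost, weight]; omega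
  | le e f he hf =>
    have := hb (.le e f); have h2 := unitCost_add e.weight f.weight V.size
    simp only [weight] at this; simp only [cost, weight]; omega

/-- `Exec V P μ ν s`: the program `P` takes the memory `μ` to `ν` in `s` steps, and all values
that it assigns are at most `V` in absolute value. -/
inductive Exec (V : ℕ) : Program → Memory → Memory → ℕ → Prop
  | skip (μ : Memory) : Exec V .skip μ μ 1
  | assign (a : ℕ) (i e : Expr) (μ : Memory) : (e.value μ).natAbs ≤ V →
      Exec V (.assign a i e) μ (μ.write a (i.value μ) (e.value μ)) 1
  | seq {P Q : Program} {μ ν ρ : Memory} {s t : ℕ} :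
      Exec V P μ ν s → Exec V Q ν ρ t → Exec V (.seq P Q) μ ρ (s + t)
  | branch_true {c : Expr} {P Q : Program} {μ ν : Memory} {t : ℕ} :
      c.value μ ≠ 0 → Exec V P μ ν t → Exec V (.branch c P Q) μ ν (t + 1)
  | branch_false {c : Expr} {P Q : Program} {μ ν : Memory} {t : ℕ} :
      c.value μ = 0 → Exec V Q μ ν t → Exec V (.branch c P Q) μ ν (t + 1)
  | loop_true {c : Expr} {P : Program} {μ ν ρ : Memory} {s t : ℕ} :
      c.value μ ≠ 0 → Exec V P μ ν s → Exec V (.loop c P) ν ρ t →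
        Exec V (.loop c P) μ ρ (s + t + 1)
  | loop_false {c : Expr} {P : Program} {μ : Memory} :
      c.value μ = 0 → Exec V (.loop c P) μ μ 1

/-- A bound for the size of a program. -/
def Program.weight : Program → ℕ
  | .skip => 1
  | .assign _ i e => i.weight + e.weight + 1
  | .seq P Q => P.weight + Q.weight
  | .branch c P Q => c.weight + P.weight + Q.weight + 1
  | .loop c P => c.weight + P.weight + 1

theorem Bounded.write {V : ℕ} {μ : Memory} (h : Bounded V μ) {a : ℕ} {i z : ℤ}
    (hz : z.natAbs ≤ V) : Bounded V (μ.write a i z) := by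
  intro b j
  unfold Memory.write
  split
  · exact hz
  · exact h b j

/-- `Exec` bounds only the assigned values. The values of subexpressions are powers of V with
exponent at most the weight of the program, so every step costs at most one `unitCost`, and the
number of steps can be counted separately from the sizes. -/
theorem Exec.runs {V : ℕ} (hV : 2 ≤ V) {P : Program} {μ ν : Memory} {s : ℕ}
    (h : Exec V P μ ν s) (hμ : Bounded V μ) {w : ℕ} (hw : P.weight ≤ w) :
    Bounded V ν ∧ ∃ t, Runs P μ ν t ∧ t ≤ s * unitCost w V.size := by
  have hc : ∀ (c : Expr) (μ : Memory), Bounded V μ → c.weight + 1 ≤ w →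
      c.cost μ + 1 ≤ unitCost w V.size := by
    intro c μ hμ hw
    have h1 := c.cost_le hV hμ
    have h2 := unitCost_add_one c.weight 0 V.size
    have h3 := unitCost_mono V.size hw
    simp only [add_zero] at h2
    omega
  induction h with
  | skip μ =>
    refine ⟨hμ, 1, .skip μ, ?_⟩
    simp only [Program.weight] at hw
    unfold unitCost
    nlinarith [Nat.zero_le (w * (w * V.size))]
  | assign a i e μ hz =>
    refine ⟨hμ.write hz, _, .assign a i e μ, ?_⟩
    have h1 := i.cost_le hV hμ
    have h2 := e.cost_le hV hμ
    have h3 := unitCost_add_one i.weight e.weight V.size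
    have h4 := unitCost_mono V.size hw
    simp only [Program.weight] at h4
    omega
  | seq _ _ ih₁ ih₂ =>
    simp only [Program.weight] at hw
    obtain ⟨b₁, t₁, r₁, l₁⟩ := ih₁ hμ (by omega)
    obtain ⟨b₂, t₂, r₂, l₂⟩ := ih₂ b₁ (by omega)
    exact ⟨b₂, _, .seq r₁ r₂, by rw [add_mul]; omega⟩
  | @branch_true c _ _ _ _ _ h _ ih =>
    simp only [Program.weight] at hw
    obtain ⟨b₁, t₁, r₁, l₁⟩ := ih hμ (by omega)
    have := hc c _ hμ (by omega)
    exact ⟨b₁, _, .branch_true h r₁, by rw [add_mul]; omega⟩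
  | @branch_false c _ _ _ _ _ h _ ih =>
    simp only [Program.weight] at hw
    obtain ⟨b₁, t₁, r₁, l₁⟩ := ih hμ (by omega)
    have := hc c _ hμ (by omega)
    exact ⟨b₁, _, .branch_false h r₁, by rw [add_mul]; omega⟩
  | @loop_true c _ _ _ _ _ _ h _ _ ih₁ ih₂ =>
    have hw' := hw
    simp only [Program.weight] at hw
    obtain ⟨b₁, t₁, r₁, l₁⟩ := ih₁ hμ (by omega)
    obtain ⟨b₂, t₂, r₂, l₂⟩ := ih₂ b₁ hw'
    have := hc c _ hμ (by omega)
    exact ⟨b₂, _, .loop_true h r₁ r₂, by rw [add_mul, add_mul]; omega⟩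
  | @loop_false c _ _ h =>
    simp only [Program.weight] at hw
    have := hc c _ hμ (by omega)
    exact ⟨hμ, _, .loop_false h, by omega⟩

/-! ### Hoare triples with step counts and frame conditions -/

/-- The arrays to which a program writes. -/
def Program.writes : Program → List ℕ
  | .skip => []
  | .assign a _ _ => [a]
  | .seq P Q => P.writes ++ Q.writes
  | .branch _ P Q => P.writes ++ Q.writes
  | .loop _ P => P.writes

/-- `μ` and `ν` have the same arrays except possibly those in the list `l`. -/
def AgreeOff (l : List ℕ) (μ ν : Memory) : Prop := ∀ a ∉ l, ν a = μ a

theorem AgreeOff.refl (l : List ℕ) (μ : Memory) : AgreeOff l μ μ := fun _ _ => rfl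

theorem AgreeOff.trans {l : List ℕ} {μ ν ρ : Memory} (h : AgreeOff l μ ν) (h' : AgreeOff l ν ρ) :
    AgreeOff l μ ρ := fun a ha => (h' a ha).trans (h a ha)

theorem AgreeOff.mono {l l' : List ℕ} {μ ν : Memory} (h : AgreeOff l μ ν) (hl : l ⊆ l') :
    AgreeOff l' μ ν := fun a ha => h a fun h' => ha (hl h')

theorem agreeOff_write (μ : Memory) (a : ℕ) (i z : ℤ) : AgreeOff [a] μ (μ.write a i z) := by
  intro b hb
  funext j
  simp only [List.mem_singleton] at hb
  simp [Memory.write, hb]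

theorem Exec.agreeOff {V : ℕ} {P : Program} {μ ν : Memory} {s : ℕ} (h : Exec V P μ ν s) :
    AgreeOff P.writes μ ν := by
  induction h with
  | skip μ => exact .refl _ _
  | assign a i e μ hz => exact agreeOff_write _ _ _ _
  | seq _ _ ih₁ ih₂ =>
    exact (ih₁.mono (List.subset_append_left _ _)).trans (ih₂.mono (List.subset_append_right _ _))
  | branch_true h _ ih => exact ih.mono (List.subset_append_left _ _)
  | branch_false h _ ih => exact ih.mono (List.subset_append_right _ _)
  | loop_true h _ _ ih₁ ih₂ => exact ih₁.trans ih₂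
  | loop_false h => exact .refl _ _

/-- Started on `μ`, the program `P` halts after at most `s` steps with a memory in `Q`; all
values that it assigns are at most `V` in absolute value. -/
def Total (V : ℕ) (P : Program) (μ : Memory) (Q : Memory → Prop) (s : ℕ) : Prop :=
  ∃ ν k, Exec V P μ ν k ∧ k ≤ s ∧ AgreeOff P.writes μ ν ∧ Q ν

variable {V : ℕ} {P P' : Program} {μ : Memory} {Q Q' : Memory → Prop} {s s' : ℕ}

theorem Total.mono (h : Total V P μ Q s) (hs : s ≤ s')
    (hQ : ∀ ν, AgreeOff P.writes μ ν → Q ν → Q' ν) : Total V P μ Q' s' := by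
  obtain ⟨ν, k, h1, h2, h3, h4⟩ := h
  exact ⟨ν, k, h1, h2.trans hs, h3, hQ ν h3 h4⟩

theorem Total.skip (h : Q μ) : Total V .skip μ Q 1 :=
  ⟨μ, 1, .skip μ, le_rfl, .refl _ _, h⟩

theorem Total.assign {a : ℕ} {i e : Expr} (h : (e.value μ).natAbs ≤ V)
    (hQ : Q (μ.write a (i.value μ) (e.value μ))) : Total V (.assign a i e) μ Q 1 :=
  ⟨_, 1, .assign a i e μ h, le_rfl, agreeOff_write _ _ _ _, hQ⟩

/-- The postcondition of the first program is the correctness of the second one, so a chain of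
statements is verified in continuation style, with the frame condition of each statement at hand for
the next. -/
theorem Total.seq (h : Total V P μ (fun ν => AgreeOff P.writes μ ν → Total V P' ν Q s') s) :
    Total V (.seq P P') μ Q (s + s') := by
  obtain ⟨ν, k, h1, h2, h3, h4⟩ := h
  obtain ⟨ρ, l, h1', h2', h3', h4'⟩ := h4 h3
  have e := h1.seq h1'
  exact ⟨ρ, k + l, e, by omega, e.agreeOff, h4'⟩

theorem Total.branch {c : Expr} (h : c.value μ ≠ 0 → Total V P μ Q s)
    (h' : c.value μ = 0 → Total V P' μ Q s) : Total V (.branch c P P') μ Q (s + 1) := by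
  by_cases hc : c.value μ = 0
  · obtain ⟨ν, k, h1, h2, h3, h4⟩ := h' hc
    exact ⟨ν, k + 1, .branch_false hc h1, by omega, (Exec.branch_false hc h1).agreeOff, h4⟩
  · obtain ⟨ν, k, h1, h2, h3, h4⟩ := h hc
    exact ⟨ν, k + 1, .branch_true hc h1, by omega, (Exec.branch_true hc h1).agreeOff, h4⟩

/-- A loop terminates if each round decreases the measure `m`. -/
theorem Total.loop {c : Expr} (I : ℕ → Memory → Prop) (m : ℕ) (h0 : I m μ)
    (step : ∀ (m : ℕ) (ν : Memory), AgreeOff P.writes μ ν → I m ν → c.value ν ≠ 0 →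
      0 < m ∧ Total V P ν (I (m - 1)) s)
    (hQ : ∀ m ν, I m ν → c.value ν = 0 → Q ν) : Total V (.loop c P) μ Q (m * (s + 1) + 1) := by
  have key : ∀ (m : ℕ) (ν : Memory), AgreeOff P.writes μ ν → I m ν →
      ∃ ρ k, Exec V (.loop c P) ν ρ k ∧ k ≤ m * (s + 1) + 1 ∧ Q ρ := by
    intro m
    induction m with
    | zero =>
      intro ν hν hI
      by_cases hc : c.value ν = 0
      · exact ⟨ν, 1, .loop_false hc, by omega, hQ _ _ hI hc⟩
      · exact absurd (step 0 ν hν hI hc).1 (lt_irrefl 0)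
    | succ m ih =>
      intro ν hν hI
      by_cases hc : c.value ν = 0
      · exact ⟨ν, 1, .loop_false hc, by omega, hQ _ _ hI hc⟩
      · obtain ⟨-, ρ, k, h1, h2, h3, h4⟩ := step _ ν hν hI hc
        obtain ⟨ρ', k', h1', h2', h3'⟩ := ih ρ (hν.trans h3) h4
        exact ⟨ρ', _, .loop_true hc h1 h1', by rw [add_mul]; omega, h3'⟩
  obtain ⟨ρ, k, h1, h2, h3⟩ := key m μ (.refl _ _) h0
  exact ⟨ρ, k, h1, h2, h1.agreeOff, h3⟩

/-! ### Notation for programs -/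

instance : Add Expr := ⟨.add⟩
instance : Sub Expr := ⟨.sub⟩
instance : Mul Expr := ⟨.mul⟩
instance : Div Expr := ⟨.div⟩
instance : Mod Expr := ⟨.mod⟩
instance (k : ℕ) : OfNat Expr k := ⟨.const k⟩

/-- The value of the variable `a`, which is cell `0` of array `a`. -/
def Expr.var (a : ℕ) : Expr := .read a (.const 0)

/-- The indicator of the equality of two expressions. -/
def Expr.eq (e f : Expr) : Expr := .mul (.le e f) (.le f e)

@[simp] theorem Expr.value_add (e f : Expr) : (e + f).value μ = e.value μ + f.value μ := rfl
@[simp] theorem Expr.value_sub (e f : Expr) : (e - f).value μ = e.value μ - f.value μ := rfl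
@[simp] theorem Expr.value_mul (e f : Expr) : (e * f).value μ = e.value μ * f.value μ := rfl
@[simp] theorem Expr.value_div (e f : Expr) : (e / f).value μ = e.value μ / f.value μ := rfl
@[simp] theorem Expr.value_mod (e f : Expr) : (e % f).value μ = e.value μ % f.value μ := rfl
@[simp] theorem Expr.value_var (a : ℕ) : (Expr.var a).value μ = μ a 0 := rfl
@[simp] theorem Expr.value_read (a : ℕ) (e : Expr) :
    (Expr.read a e).value μ = μ a (e.value μ) := rfl
@[simp] theorem Expr.value_zero : (0 : Expr).value μ = 0 := rfl
@[simp] theorem Expr.value_one : (1 : Expr).value μ = 1 := rfl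
@[simp] theorem Expr.value_two : (2 : Expr).value μ = 2 := rfl
@[simp] theorem Expr.value_twenty : (20 : Expr).value μ = 20 := rfl
@[simp] theorem Expr.value_le (e f : Expr) :
    (Expr.le e f).value μ = if e.value μ ≤ f.value μ then 1 else 0 := rfl
@[simp] theorem Expr.value_eq (e f : Expr) :
    (Expr.eq e f).value μ = if e.value μ = f.value μ then 1 else 0 := by
  simp only [Expr.eq, Expr.value]
  split_ifs <;> simp <;> omega

@[simp] theorem write_same (a : ℕ) (i z : ℤ) : μ.write a i z a i = z := by simp [Memory.write]

@[simp] theorem write_of_array_ne {a b : ℕ} (h : b ≠ a) (i z j : ℤ) :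
    μ.write a i z b j = μ b j := by simp [Memory.write, h]

theorem write_of_index_ne {a : ℕ} {i j : ℤ} (h : j ≠ i) (z : ℤ) :
    μ.write a i z a j = μ a j := by simp [Memory.write, h]

/-- Assignment to a variable. -/
def Program.set (a : ℕ) (e : Expr) : Program := .assign a 0 e

theorem Total.set {a : ℕ} {e : Expr} (h : (e.value μ).natAbs ≤ V)
    (hQ : Q (μ.write a 0 (e.value μ))) : Total V (.set a e) μ Q 1 := Total.assign h hQ

/-- Run `P` for the values `lo, …, hi - 1` of the variable `i`. -/
def Program.forLoop (i : ℕ) (lo hi : Expr) (P : Program) : Program :=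
  .seq (.set i lo) (.loop (.le (Expr.var i + 1) hi) (.seq P (.set i (Expr.var i + 1))))

/-- A round costs the body, the increment and the test; the outer 2 is the initialisation and the
final test. The upper limit is evaluated anew in each round, so it must not depend on what the body
writes. The step count uses a common bound Z instead of the true number of rounds. -/
theorem Total.forLoop {i : ℕ} {lo hi : Expr} {l h Z : ℕ} (I : ℕ → Memory → Prop)
    (hlo : lo.value μ = l) (hlh : l ≤ h) (hV : h ≤ V) (hZ : h - l ≤ Z)
    (hhi : ∀ ν, AgreeOff (i :: P.writes) μ ν → hi.value ν = h)
    (hi' : i ∉ P.writes)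
    (h0 : I l (μ.write i 0 l))
    (step : ∀ (k : ℕ) (ν : Memory), l ≤ k → k < h → AgreeOff (i :: P.writes) μ ν → ν i 0 = k →
      I k ν → Total V P ν (fun ρ => I (k + 1) (ρ.write i 0 (k + 1 : ℕ))) s)
    (hQ : ∀ ν, AgreeOff (i :: P.writes) μ ν → ν i 0 = h → I h ν → Q ν) :
    Total V (.forLoop i lo hi P) μ Q (Z * (s + 2) + 2) := by
  have hs : 1 + ((h - l) * (s + 1 + 1) + 1) ≤ Z * (s + 2) + 2 := by
    have := Nat.mul_le_mul_right (s + 2) hZ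
    rw [show s + 1 + 1 = s + 2 from rfl]
    omega
  refine Total.mono (Q := fun ν => AgreeOff (i :: P.writes) μ ν ∧ ν i 0 = h ∧ I h ν) ?_ hs
    (fun ν _ hν => hQ ν hν.1 hν.2.1 hν.2.2)
  refine Total.seq (Total.set (by rw [hlo]; omega) ?_)
  intro hag
  rw [hlo] at hag ⊢
  refine Total.loop (fun m ν => AgreeOff (i :: P.writes) μ ν ∧ ∃ k, l ≤ k ∧ k ≤ h ∧ m = h - k ∧
    ν i 0 = k ∧ I k ν) _ ⟨hag.mono (by simp [Program.writes, Program.set]), l, le_rfl, hlh, rfl,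
      by simp, h0⟩ ?_ ?_
  · rintro m ν - ⟨hν, k, hk, hk', rfl, hik, hI⟩ hc
    have hh := hhi ν hν
    simp only [Expr.value_le, Expr.value_add, Expr.value_var, Expr.value_one, hik, hh] at hc
    have hkh : k < h := by
      by_contra hcon
      exact hc (if_neg (by omega))
    refine ⟨by omega, Total.seq ((step k ν hk hkh hν hik hI).mono le_rfl ?_)⟩
    intro ρ hρ hI' _
    have hiρ : ρ i 0 = k := by rw [hρ i hi', hik]
    have he : (Expr.var i + 1).value ρ = ((k + 1 : ℕ) : ℤ) := by simp [hiρ]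
    refine Total.set (by rw [he]; omega) ?_
    rw [he]
    exact ⟨(hν.trans (hρ.mono (List.subset_cons_self _ _))).trans
      ((agreeOff_write _ _ _ _).mono (by simp)), k + 1, by omega, by omega, by omega, by simp, hI'⟩
  · rintro m ν ⟨hν, k, hk, hk', rfl, hik, hI⟩ hc
    have hh := hhi ν hν
    simp only [Expr.value_le, Expr.value_add, Expr.value_var, Expr.value_one, hik, hh] at hc
    have hkh : k = h := by
      by_contra hcon
      rw [if_pos (by omega)] at hc
      exact one_ne_zero hc
    subst hkh
    exact ⟨hν, hik, hI⟩

end RandomAccess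

namespace RandomAccess

/-! ### Loops that compute sums and fill arrays -/

variable {V : ℕ} {P P' : Program} {μ : Memory} {Q Q' : Memory → Prop} {s s' : ℕ}

open Finset

/-- Store in the variable `t` the sum of the values of `e` as the variable `i` runs through
`0, …, hi - 1`. -/
def Program.sumLoop (t i : ℕ) (hi e : Expr) : Program :=
  .seq (.set t 0) (.forLoop i 0 hi (.set t (Expr.var t + e)))

theorem Total.sumLoop {t i : ℕ} {hi e : Expr} {h Z : ℕ} (f : ℕ → ℤ) (hti : t ≠ i) (hV : h ≤ V)
    (hZ : h ≤ Z) (hhi : ∀ ν, AgreeOff [i, t] μ ν → hi.value ν = h)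
    (he : ∀ k < h, ∀ ν, AgreeOff [i, t] μ ν → ν i 0 = k → e.value ν = f k)
    (hf : ∀ k ≤ h, (∑ j ∈ range k, f j).natAbs ≤ V)
    (hQ : ∀ ν, AgreeOff [i, t] μ ν → ν t 0 = ∑ j ∈ range h, f j → Q ν) :
    Total V (.sumLoop t i hi e) μ Q (Z * 3 + 3) := by
  have e1 : ∀ z, AgreeOff [i, t] μ (μ.write t 0 z) := fun z =>
    (agreeOff_write _ _ _ _).mono (by simp)
  rw [show Z * 3 + 3 = 1 + (Z * (1 + 2) + 2) by ring]
  refine Total.seq (Total.set (by simp) fun hag => ?_)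
  refine Total.forLoop (l := 0) (h := h) (fun k ν => ν t 0 = ∑ j ∈ range k, f j) (by simp)
    (Nat.zero_le _) hV (by omega) ?_ ?_ ?_ ?_ ?_
  · intro ν hν
    exact hhi ν ((e1 _).trans (hν.mono (by simp [Program.writes, Program.set])))
  · simp [Program.writes, Program.set, hti.symm]
  · simp [hti]
  · intro k ν _ hk hν hik hI
    have hev := he k hk ν ((e1 _).trans (hν.mono (by simp [Program.writes, Program.set]))) hik
    have h1 : (Expr.var t + e).value ν = ∑ j ∈ range (k + 1), f j := by
      simp [hev, hI, sum_range_succ]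
    refine Total.set (by rw [h1]; exact hf _ hk) ?_
    rw [h1]
    simp [hti]
  · intro ν hν _ hI
    exact hQ ν ((e1 _).trans (hν.mono (by simp [Program.writes, Program.set]))) hI

/-- As the variable `i` runs through `lo, …, hi - 1`, run `P` and write the value of `e` to
cell `o + i` of the array `a`. -/
def Program.fill (a i : ℕ) (lo hi o : Expr) (P : Program) (e : Expr) : Program :=
  .forLoop i lo hi (.seq P (.assign a (o + Expr.var i) e))

/-- The hypothesis `step` may use that the cells not yet reached still have their old contents. This
is needed when an array is overwritten while it is being read. -/
theorem Total.fill {a i : ℕ} {lo hi o e : Expr} {l h Z : ℕ} {o' : ℤ} (f : ℕ → ℤ)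
    (hlo : lo.value μ = l) (hlh : l ≤ h) (hV : h ≤ V) (hZ : h ≤ Z)
    (hhi : ∀ ν, AgreeOff (i :: a :: P.writes) μ ν → hi.value ν = h)
    (hia : i ≠ a) (hiP : i ∉ P.writes) (haP : a ∉ P.writes)
    (step : ∀ (k : ℕ) (ν : Memory), l ≤ k → k < h → AgreeOff (i :: a :: P.writes) μ ν →
      ν i 0 = k → (∀ y : ℤ, y < o' + l ∨ o' + k ≤ y → ν a y = μ a y) →
      Total V P ν (fun ρ => o.value ρ = o' ∧ e.value ρ = f k) s)
    (hf : ∀ k, l ≤ k → k < h → (f k).natAbs ≤ V)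
    (hQ : ∀ ν, AgreeOff (i :: a :: P.writes) μ ν →
      (∀ k : ℕ, l ≤ k → k < h → ν a (o' + k) = f k) →
      (∀ y : ℤ, y < o' + l ∨ o' + h ≤ y → ν a y = μ a y) → Q ν) :
    Total V (.fill a i lo hi o P e) μ Q (Z * (s + 3) + 2) := by
  have hw : i :: (Program.seq P (.assign a (o + Expr.var i) e)).writes ⊆ i :: a :: P.writes := by
    intro b hb
    simp only [Program.writes, List.mem_cons, List.mem_append, List.not_mem_nil, or_false] at *
    tauto
  refine Total.forLoop (s := s + 1) (l := l) (h := h) (fun k ν =>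
    (∀ j : ℕ, l ≤ j → j < k → ν a (o' + j) = f j) ∧
    (∀ y : ℤ, y < o' + l ∨ o' + k ≤ y → ν a y = μ a y)) hlo hlh hV (by omega) ?_ ?_ ?_ ?_ ?_
  · exact fun ν hν => hhi ν (hν.mono hw)
  · simp [Program.writes, hia, hiP]
  · refine ⟨fun j h1 h2 => by omega, fun y _ => by rw [write_of_array_ne hia.symm]⟩
  · rintro k ν hlk hk hν hik ⟨hI1, hI2⟩
    refine Total.seq ((step k ν hlk hk (hν.mono hw) hik hI2).mono le_rfl ?_)
    rintro ρ hρ ⟨ho, hev⟩ -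
    have hiρ : ρ i 0 = k := by rw [hρ i hiP, hik]
    have haρ : ρ a = ν a := hρ a haP
    refine Total.assign (by rw [hev]; exact hf k hlk hk) ?_
    simp only [Expr.value_add, Expr.value_var, ho, hev, hiρ]
    refine ⟨fun j hj hj' => ?_, fun y hy => ?_⟩
    · rw [write_of_array_ne hia.symm]
      rcases Nat.lt_succ_iff_lt_or_eq.mp hj' with h1 | rfl
      · rw [write_of_index_ne (by omega), haρ, hI1 j hj h1]
      · rw [write_same]
    · rw [write_of_array_ne hia.symm, write_of_index_ne (by push_cast at hy; omega), haρ]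
      exact hI2 y (by push_cast at hy; omega)
  · rintro ν hν _ ⟨hI1, hI2⟩
    exact hQ ν (hν.mono hw) hI1 hI2

/-! ### The program -/

notation "vN" => (2 : ℕ)
notation "vPos" => (3 : ℕ)
notation "vC" => (4 : ℕ)
notation "vK" => (5 : ℕ)
notation "vLab" => (6 : ℕ)
notation "vR" => (7 : ℕ)
notation "aBase" => (8 : ℕ)
notation "aStr" => (9 : ℕ)
notation "aKind" => (10 : ℕ)
notation "aGram" => (11 : ℕ)
notation "aM" => (12 : ℕ)
notation "aTmp" => (13 : ℕ)
notation "vCoeff" => (14 : ℕ)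
notation "vT" => (15 : ℕ)
notation "vSum" => (16 : ℕ)
notation "vBeta" => (17 : ℕ)
notation "vMod" => (18 : ℕ)
notation "vD" => (19 : ℕ)
notation "aW" => (20 : ℕ)
notation "aV" => (21 : ℕ)
notation "vQ" => (22 : ℕ)
notation "aU" => (23 : ℕ)
notation "vX" => (24 : ℕ)
notation "vY" => (25 : ℕ)
notation "vCount" => (26 : ℕ)
notation "aId" => (27 : ℕ)
notation "vi" => (28 : ℕ)
notation "vj" => (29 : ℕ)
notation "vt" => (30 : ℕ)
notation "vc" => (31 : ℕ)
notation "vl" => (32 : ℕ)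

open RandomAccess.Program RandomAccess.Expr

infixr:60 " ;; " => Program.seq

/-- Entry `i` of column `c` of the input. -/
def Expr.col (c i : Expr) : Expr := .read 0 (.read aBase c + i * .read aStr c)

/-- Register the columns of the matrix whose entries start at the current position. -/
def loadBlock : Program :=
  forLoop vc 0 (var vK)
    (.assign aBase (var vC) (var vPos + var vc) ;; .assign aStr (var vC) (var vK) ;;
      .assign aKind (var vC) (var vLab) ;; set vC (var vC + 1)) ;;
  set vPos (var vPos + var vN * var vK)

/-- Read a number of columns and register as many columns. -/
def loadNext (lab : Expr) : Program :=
  set vK (.read 0 (var vPos)) ;; set vPos (var vPos + 1) ;; set vLab lab ;; loadBlock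

/-- Register all columns of the input. The columns of the relations and of the generator matrix
of the subgroup are marked by `-1`, the columns of the generator matrix of member `l` of the
family by `l`. Nothing is registered if the columns are empty. -/
def parse : Program :=
  set vN (.read 0 0) ;; set vPos 1 ;;
  .branch (var vN)
    (set vK (var vN) ;; set vLab (0 - 1) ;; loadBlock ;;
      set vR (.read 0 (var vPos)) ;; set vPos (var vPos + 1) ;;
      forLoop vl 0 (var vR) (loadNext (var vl)) ;; loadNext (0 - 1))
    (set vR (.read 0 1))

/-- Compute a number that exceeds the entries of the input and of the Gram matrix. -/
def computeBeta : Program :=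
  sumLoop vSum vt (var vC * var vN)
    (col (var vt / var vN) (var vt % var vN) * col (var vt / var vN) (var vt % var vN)) ;;
  set vBeta (2 + var vN + var vC + var vR + var vSum)

/-- Compute the Gram matrix of the rows of the matrix of the columns marked by `-1`. -/
def computeGram : Program :=
  fill aGram vt 0 (var vN * var vN) 0
    (sumLoop vSum vc (var vC) (.le (.read aKind (var vc) + 1) 0 *
      (col (var vc) (var vt / var vN) * col (var vc) (var vt % var vN))))
    (var vSum)

/-- The Faddeev–LeVerrier algorithm: compute the last non-zero coefficient of the characteristic
polynomial of the Gram matrix. -/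
def leverrierProgram : Program :=
  set vCoeff 1 ;; set vT 1 ;;
  forLoop vi 0 (var vN)
    (fill aTmp vt 0 (var vN * var vN) 0
      (sumLoop vSum vc (var vN) (.read aGram (var vt / var vN * var vN + var vc) *
        .read aM (var vc * var vN + var vt % var vN)))
      (var vSum + var vCoeff * Expr.eq (var vt / var vN) (var vt % var vN)) ;;
    fill aM vt 0 (var vN * var vN) 0 .skip (.read aTmp (var vt)) ;;
    sumLoop vSum vt (var vN * var vN)
      (.read aGram (var vt) * .read aM (var vt % var vN * var vN + var vt / var vN)) ;;
    set vCoeff ((0 - var vSum) / (var vi + 1)) ;;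
    .branch (var vCoeff) (set vT (var vCoeff)) .skip)

/-- Compute the modulus. -/
def computeModulus : Program :=
  set vMod (var vT * var vT) ;;
  forLoop vi 0 (20 * (var vN + 1)) (set vMod (var vMod * var vBeta))

/-- Set up the triangular basis. -/
def initBasis : Program :=
  set vD (var vN + var vC) ;;
  fill aW vt 0 (var vD * var vD) 0 .skip (var vMod * Expr.eq (var vt / var vD) (var vt % var vD))

/-- A step of the Euclidean algorithm on row `i` of the basis and the vector to be inserted. -/
def euclidStep : Program :=
  set vQ (.read aW (var vi * var vD + var vi) / .read aV (var vi)) ;;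
  fill aTmp vj (var vi) (var vD) 0 .skip
    ((.read aW (var vi * var vD + var vj) - var vQ * .read aV (var vj)) % var vMod) ;;
  fill aW vj (var vi) (var vD) (var vi * var vD) .skip (.read aV (var vj)) ;;
  fill aV vj (var vi) (var vD) 0 .skip (.read aTmp (var vj))

/-- Insert a vector into the lattice. -/
def insertVector : Program :=
  forLoop vi 0 (var vD) (.loop (.read aV (var vi)) euclidStep)

/-- The vector that belongs to a column of the input. -/
def loadVector : Program :=
  fill aV vt 0 (var vD) 0 .skip
    (.le (var vt + 1) (var vN) * (col (var vc) (var vt) % var vMod) +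
      Expr.eq (var vt) (var vN + var vc) * .le 0 (.read aKind (var vc)))

/-- Insert all columns of the input. -/
def insertColumns : Program := forLoop vc 0 (var vC) (loadVector ;; insertVector)

/-- Reduce the triangular basis to Hermite normal form. -/
def reduceBasis : Program :=
  forLoop vi 0 (var vD) (forLoop vj (var vi + 1) (var vD)
    (set vQ (.read aW (var vi * var vD + var vj) / .read aW (var vj * var vD + var vj)) ;;
      fill aW vt (var vj) (var vD) (var vi * var vD) .skip
        ((.read aW (var vi * var vD + var vt) -
          var vQ * .read aW (var vj * var vD + var vt)) % var vMod)))

/-- Identify the labels of members of the family that are linked by an entry of the basis. -/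
def mergeLabels : Program :=
  fill aU vt 0 (var vR) 0 .skip (var vt) ;;
  forLoop vi 0 (var vC * var vC)
    (.branch (.read aW ((var vN + var vi / var vC) * var vD + var vN + var vi % var vC))
      (set vX (.read aU (.read aKind (var vi / var vC))) ;;
        set vY (.read aU (.read aKind (var vi % var vC))) ;;
        fill aU vt 0 (var vR) 0 .skip
          (.read aU (var vt) + Expr.eq (.read aU (var vt)) (var vX) *
            (var vY - .read aU (var vt))))
      .skip)

/-- Number the labels consecutively and write the output. -/
def writeOutput : Program :=
  set vCount 0 ;;
  forLoop vt 0 (var vR)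
    (.branch (Expr.eq (.read aU (var vt)) (var vt))
      (.assign aId (var vt) (var vCount) ;; set vCount (var vCount + 1)) .skip) ;;
  set 1 (var vCount) ;;
  fill 1 vt 0 (var vR) 1 .skip (.read aId (.read aU (var vt)))

/-- The algorithm. -/
def mainProgram : Program :=
  parse ;; computeBeta ;; computeGram ;; leverrierProgram ;; computeModulus ;; initBasis ;;
    insertColumns ;; reduceBasis ;; mergeLabels ;; writeOutput

end RandomAccess

/-! ### The Faddeev–LeVerrier algorithm -/

namespace FaddeevLeVerrier

open Matrix Polynomial Finset

/-- The Horner scheme for the value of the characteristic polynomial of `A` at `A`. -/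
noncomputable def horner {n : ℕ} {R : Type*} [CommRing R] (A : Matrix (Fin n) (Fin n) R) :
    ℕ → Matrix (Fin n) (Fin n) R
  | 0 => 0
  | k + 1 => A * horner A k + A.charpoly.coeff (n - k) • 1

/-- With B = x - A, the shifted characteristic polynomial is det B · det(1 + X B⁻¹), and the
derivative at 0 of the second factor is the trace of B⁻¹. -/
theorem derivative_charpoly_eval {n : ℕ} (A : Matrix (Fin n) (Fin n) ℚ) (x : ℚ)
    (hx : (scalar (Fin n) x - A).det ≠ 0) :
    A.charpoly.derivative.eval x =
      (scalar (Fin n) x - A).det * ((scalar (Fin n) x - A)⁻¹).trace := by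
  set B := scalar (Fin n) x - A with hB
  have hu : IsUnit B.det := isUnit_iff_ne_zero.mpr hx
  have h1 : A.charpoly.comp (X + C x) = C B.det * det (1 + (X : ℚ[X]) • (B⁻¹).map C) := by
    have e1 : C B.det = (B.map C).det := by
      rw [← RingHom.mapMatrix_apply, ← RingHom.map_det]
    rw [e1, ← det_mul]
    have e2 : B.map C * (1 + (X : ℚ[X]) • (B⁻¹).map C) =
        (charmatrix A).map (Polynomial.compRingHom (X + C x)) := by
      rw [mul_add, mul_one, mul_smul_comm, ← Matrix.map_mul, mul_nonsing_inv _ hu]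
      ext i j : 2
      by_cases hij : i = j
      · subst hij
        simp [hB, charmatrix, Matrix.map_apply]
        ring
      · simp [hB, charmatrix, Matrix.map_apply, hij]
    rw [e2, ← RingHom.mapMatrix_apply, ← RingHom.map_det]
    rfl
  have h2 := congrArg (fun p => (derivative p).eval 0) h1
  simp only [derivative_comp, derivative_mul, derivative_C, zero_mul, zero_add, eval_mul,
    eval_C, derivative_det_one_add_X_smul] at h2
  simpa [eval_comp] using h2

/-- The sum telescopes. For m = n the last Horner matrix vanishes, and the sum turns out to be the
adjugate of x - A. -/
theorem sub_mul_sum_horner {n : ℕ} (A : Matrix (Fin n) (Fin n) ℚ) (x : ℚ) (m : ℕ) :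
    (scalar (Fin n) x - A) * ∑ j ∈ range m, x ^ (m - 1 - j) • horner A (j + 1) =
      (∑ j ∈ range (m + 1), x ^ (m - j) * A.charpoly.coeff (n - j)) • 1 - horner A (m + 1) := by
  have hs : ∀ Y : Matrix (Fin n) (Fin n) ℚ, scalar (Fin n) x * Y = x • Y := by
    intro Y; rw [scalar_apply, ← smul_one_eq_diagonal, smul_mul_assoc, one_mul]
  induction m with
  | zero => simp [horner]
  | succ m ih =>
    have e1 : ∑ j ∈ range (m + 1), x ^ (m + 1 - 1 - j) • horner A (j + 1) =
        x • (∑ j ∈ range m, x ^ (m - 1 - j) • horner A (j + 1)) + horner A (m + 1) := by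
      rw [sum_range_succ, smul_sum]
      congr 1
      · refine sum_congr rfl fun j hj => ?_
        rw [mem_range] at hj
        rw [smul_smul, ← pow_succ']
        congr 2
        omega
      · simp
    have e2 : ∑ j ∈ range (m + 1 + 1), x ^ (m + 1 - j) * A.charpoly.coeff (n - j) =
        x * (∑ j ∈ range (m + 1), x ^ (m - j) * A.charpoly.coeff (n - j)) +
          A.charpoly.coeff (n - (m + 1)) := by
      rw [sum_range_succ, mul_sum]
      congr 1
      · refine sum_congr rfl fun j hj => ?_
        rw [mem_range] at hj
        rw [← mul_assoc, ← pow_succ']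
        congr 2
        omega
      · simp
    rw [e1, e2, mul_add, mul_smul_comm, ih, sub_mul, hs, horner.eq_2 A (m + 1), add_smul, mul_smul,
      smul_sub]
    abel

/-- The completed Horner scheme is the characteristic polynomial evaluated at A, so this is the
Cayley–Hamilton theorem. -/
theorem horner_last {n : ℕ} {R : Type*} [CommRing R] [Nontrivial R]
    (A : Matrix (Fin n) (Fin n) R) : horner A (n + 1) = 0 := by
  have key : ∀ m ≤ n, horner A (m + 1) =
      ∑ j ∈ range (m + 1), A.charpoly.coeff (n - j) • A ^ (m - j) := by
    intro m
    induction m with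
    | zero => simp [horner]
    | succ m ih =>
      intro hm
      rw [horner, ih (by omega), sum_range_succ _ (m + 1), mul_sum]
      congr 1
      · refine sum_congr rfl fun j hj => ?_
        rw [mem_range] at hj
        rw [mul_smul_comm, ← pow_succ']
        congr 2
        omega
      · simp
  rw [key n le_rfl, ← aeval_self_charpoly A, aeval_eq_sum_range, charpoly_natDegree_eq_dim,
    Fintype.card_fin, ← sum_range_reflect]
  refine sum_congr rfl fun j hj => ?_
  rw [mem_range] at hj
  congr 2 <;> omega

/-- The Horner matrices are the coefficients of the adjugate of x - A, whose trace is the derivative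
of the characteristic polynomial; the claim compares coefficients. -/
theorem trace_horner {n : ℕ} (A : Matrix (Fin n) (Fin n) ℚ) {j : ℕ} (hj : j < n) :
    (horner A (j + 1)).trace = (n - j : ℕ) * A.charpoly.coeff (n - j) := by
  have hc : ∀ x, (scalar (Fin n) x - A).det = A.charpoly.eval x := fun x =>
    (eval_charpoly A x).symm
  set p : ℚ[X] := ∑ j ∈ range n, C (horner A (j + 1)).trace * X ^ (n - 1 - j) with hp
  have h1 : p = derivative A.charpoly := by
    -- Both sides are compared at the infinitely many x that are not eigenvalues, where x - A is
    -- invertible.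
    refine eq_of_infinite_eval_eq _ _ (Set.Infinite.mono (s := {x | A.charpoly.IsRoot x}ᶜ) ?_ ?_)
    · intro x hx
      have hx' : (scalar (Fin n) x - A).det ≠ 0 := by rw [hc]; exact hx
      have e1 := sub_mul_sum_horner A x n
      rw [horner_last, sub_zero] at e1
      have e2 : ∑ j ∈ range (n + 1), x ^ (n - j) * A.charpoly.coeff (n - j) =
          (scalar (Fin n) x - A).det := by
        rw [hc, eval_eq_sum_range, charpoly_natDegree_eq_dim, Fintype.card_fin,
          ← sum_range_reflect]
        refine sum_congr rfl fun j hj => ?_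
        rw [mem_range] at hj
        rw [mul_comm]
        congr 2 <;> omega
      rw [e2] at e1
      have e3 := congrArg (fun Y => (scalar (Fin n) x - A)⁻¹ * Y) e1
      simp only [nonsing_inv_mul_cancel_left _ _ (isUnit_iff_ne_zero.mpr hx'),
        mul_smul_comm, mul_one] at e3
      have e4 := congrArg trace e3
      rw [trace_smul, smul_eq_mul, ← derivative_charpoly_eval A x hx', trace_sum] at e4
      show eval x p = _
      rw [← e4, hp, eval_finsetSum]
      refine sum_congr rfl fun j _ => ?_
      simp only [trace_smul, smul_eq_mul, eval_mul, eval_C, eval_pow, eval_X]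
      ring
    · refine Set.Finite.infinite_compl ?_
      have := (charpoly_monic A).ne_zero
      refine (A.charpoly.roots.toFinset.finite_toSet).subset fun x hx => ?_
      simpa [this] using hx
  have h2 := congrArg (fun q : ℚ[X] => q.coeff (n - 1 - j)) h1
  simp only [hp, finsetSum_coeff, coeff_C_mul, coeff_X_pow, coeff_derivative] at h2
  rw [sum_eq_single j] at h2
  · simp only [if_true, mul_one] at h2
    rw [h2, show n - 1 - j + 1 = n - j by omega, mul_comm]
    congr 1
    rw [← Nat.cast_add_one]
    congr 1
    omega
  · intro i hi hij
    rw [mem_range] at hi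
    rw [if_neg (by omega), mul_zero]
  · intro h
    exact absurd (mem_range.mpr hj) h

/-- This is what makes the scheme an algorithm: each coefficient is obtained from a trace that
involves only earlier data, by a division by k. -/
theorem trace_mul_horner {n : ℕ} (A : Matrix (Fin n) (Fin n) ℚ) {k : ℕ} (hk : k ≤ n) :
    (A * horner A k).trace = -(k * A.charpoly.coeff (n - k)) := by
  have h1 : A * horner A k = horner A (k + 1) - A.charpoly.coeff (n - k) • 1 := by
    rw [horner]; abel
  rw [h1, trace_sub, trace_smul, trace_one, Fintype.card_fin]
  rcases hk.lt_or_eq with h | rfl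
  · rw [trace_horner A h, Nat.cast_sub hk, smul_eq_mul]
    ring
  -- For k = n the next Horner matrix is zero by Cayley–Hamilton, and the trace of the scalar matrix
  -- already gives the formula.
  · rw [horner_last, trace_zero, smul_eq_mul]
    ring

theorem map_horner {n : ℕ} (A : Matrix (Fin n) (Fin n) ℤ) (k : ℕ) :
    (horner A k).map (Int.castRingHom ℚ) = horner (A.map (Int.castRingHom ℚ)) k := by
  induction k with
  | zero => simp [horner]
  | succ k ih =>
    rw [horner, horner, ← ih, ← Matrix.map_mul, Matrix.map_add _ (map_add _), charpoly_map, coeff_map]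
    congr 1
    ext i j
    by_cases hij : i = j
    · simp [hij, Matrix.smul_apply, -zsmul_eq_mul, -zsmul_one]
    · simp [hij, Matrix.smul_apply, -zsmul_eq_mul, -zsmul_one]

theorem trace_mul_horner_int {n : ℕ} (A : Matrix (Fin n) (Fin n) ℤ) {k : ℕ} (hk : k ≤ n) :
    (A * horner A k).trace = -(k * A.charpoly.coeff (n - k)) := by
  have h := trace_mul_horner (A.map (Int.castRingHom ℚ)) hk
  rw [← map_horner, ← Matrix.map_mul, charpoly_map, coeff_map] at h
  have e : ((A * horner A k).map (Int.castRingHom ℚ)).trace = (((A * horner A k).trace : ℤ) : ℚ) := by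
    simp [trace]
  rw [e] at h
  simp only [eq_intCast] at h
  exact_mod_cast h

/-- The matrices and coefficients that the Faddeev–LeVerrier algorithm computes for a matrix of
size `n`. -/
def step (n : ℕ) (A : ℕ → ℕ → ℤ) : ℕ → (ℕ → ℕ → ℤ) × ℤ
  | 0 => (0, 1)
  | k + 1 =>
    let M : ℕ → ℕ → ℤ := fun i j =>
      (∑ l ∈ range n, A i l * (step n A k).1 l j) + (step n A k).2 * if i = j then 1 else 0
    (M, (0 - ∑ i ∈ range n, ∑ l ∈ range n, A i l * M l i) / (k + 1))

/-- The square matrix of the first `n` rows and columns. -/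
def toMatrix (n : ℕ) (A : ℕ → ℕ → ℤ) : Matrix (Fin n) (Fin n) ℤ := of fun i j => A i j

/-- By `trace_mul_horner_int` the trace is an exact multiple of the divisor, so the Euclidean
division in the recursion loses nothing. -/
theorem step_eq_horner (n : ℕ) (A : ℕ → ℕ → ℤ) {k : ℕ} (hk : k ≤ n) :
    toMatrix n (step n A k).1 = horner (toMatrix n A) k ∧
      (step n A k).2 = (toMatrix n A).charpoly.coeff (n - k) := by
  induction k with
  | zero =>
    refine ⟨by ext i j; simp [toMatrix, step, horner], ?_⟩
    have h1 := (charpoly_monic (toMatrix n A)).coeff_natDegree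
    rw [charpoly_natDegree_eq_dim, Fintype.card_fin] at h1
    simpa [step] using h1.symm
  | succ k ih =>
    obtain ⟨ih1, ih2⟩ := ih (by omega)
    have h1 : toMatrix n (step n A (k + 1)).1 = horner (toMatrix n A) (k + 1) := by
      rw [horner, ← ih1, ← ih2]
      ext i j
      simp [toMatrix, step, Matrix.mul_apply, Finset.sum_range, Matrix.one_apply, Fin.ext_iff,
        Matrix.smul_apply, -zsmul_eq_mul, -zsmul_one]
    refine ⟨h1, ?_⟩
    have h2 := trace_mul_horner_int (toMatrix n A) hk
    rw [← h1] at h2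
    have h3 : (toMatrix n A * toMatrix n (step n A (k + 1)).1).trace =
        ∑ i ∈ range n, ∑ l ∈ range n, A i l * (step n A (k + 1)).1 l i := by
      simp [toMatrix, trace, Matrix.mul_apply, Finset.sum_range]
    rw [h3] at h2
    have h4 : (step n A (k + 1)).2 =
        (0 - ∑ i ∈ range n, ∑ l ∈ range n, A i l * (step n A (k + 1)).1 l i) / (k + 1) := rfl
    rw [h4, h2]
    push_cast
    rw [zero_sub, neg_neg]
    exact Int.mul_ediv_cancel_left _ (by omega)

/-- The last non-zero coefficient among the first `k` that the algorithm computes. -/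
def lastNonzero (n : ℕ) (A : ℕ → ℕ → ℤ) : ℕ → ℤ
  | 0 => 1
  | k + 1 => if (step n A (k + 1)).2 ≠ 0 then (step n A (k + 1)).2 else lastNonzero n A k

theorem exists_lastNonzero (n : ℕ) (A : ℕ → ℕ → ℤ) (m : ℕ) : ∃ k ≤ m, (step n A k).2 ≠ 0 ∧
    lastNonzero n A m = (step n A k).2 ∧ ∀ j, k < j → j ≤ m → (step n A j).2 = 0 := by
  induction m with
  | zero => exact ⟨0, le_rfl, by simp [step], by simp [step, lastNonzero], fun j h h' => by omega⟩
  | succ m ih =>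
    by_cases h : (step n A (m + 1)).2 = 0
    · obtain ⟨k, h1, h2, h3, h4⟩ := ih
      refine ⟨k, by omega, h2, by simp [lastNonzero, h, h3], fun j hj hj' => ?_⟩
      rcases hj'.lt_or_eq with h' | rfl
      · exact h4 j hj (by omega)
      · exact h
    · exact ⟨m + 1, le_rfl, h, by simp [lastNonzero, h], fun j h h' => by omega⟩

theorem horner_commute {n : ℕ} {R : Type*} [CommRing R] (A : Matrix (Fin n) (Fin n) R) (k : ℕ) :
    Commute A (horner A k) := by
  induction k with
  | zero => exact Commute.zero_right _
  | succ k ih =>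
    exact ((Commute.refl A).mul_right ih).add_right ((Commute.one_right A).smul_right _)

theorem horner_transpose {n : ℕ} {R : Type*} [CommRing R] {A : Matrix (Fin n) (Fin n) R}
    (hA : Aᵀ = A) (k : ℕ) : (horner A k)ᵀ = horner A k := by
  induction k with
  | zero => simp [horner]
  | succ k ih =>
    rw [horner, transpose_add, transpose_mul, ih, hA, transpose_smul, transpose_one,
      (horner_commute A k).eq]

/-- The diagonal entries of YᵀY are sums of squares of the entries of the columns of Y. -/
theorem transpose_mul_self_eq_zero_int {m n : Type*} [Fintype m] {Y : Matrix m n ℤ}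
    (h : Yᵀ * Y = 0) : Y = 0 := by
  ext i j
  have h1 := congrFun (congrFun h j) j
  simp only [Matrix.mul_apply, transpose_apply, Matrix.zero_apply] at h1
  have h2 := (sum_eq_zero_iff_of_nonneg (fun i _ => mul_self_nonneg (Y i j))).mp h1 i (mem_univ i)
  simpa using h2

/-- The Horner scheme, stopped at the last non-zero coefficient of the characteristic polynomial
of `H * Hᵀ`, gives a matrix that vanishes on the columns of `H`. -/
theorem horner_mul_eq_zero {n : ℕ} {m : Type*} [Fintype m] (H : Matrix (Fin n) m ℤ) {k : ℕ}
    (hk : k ≤ n) (h0 : ∀ j, k < j → j ≤ n → (H * Hᵀ).charpoly.coeff (n - j) = 0) :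
    horner (H * Hᵀ) (k + 1) * H = 0 := by
  set N := H * Hᵀ with hN
  have hNt : Nᵀ = N := by rw [hN, transpose_mul, transpose_transpose]
  set F := horner N (k + 1) with hF
  have hFt : Fᵀ = F := horner_transpose hNt _
  -- Beyond the last non-zero coefficient the Horner scheme only multiplies by N, so Cayley–Hamilton
  -- shows that a power of N kills F.
  have h1 : ∀ j, k + j ≤ n → horner N (k + 1 + j) = N ^ j * F := by
    intro j
    induction j with
    | zero => intro _; rw [add_zero, pow_zero, Matrix.one_mul]
    | succ j ih =>
      intro hj
      rw [← add_assoc, horner, ih (by omega), h0 _ (by omega) (by omega), zero_smul, add_zero,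
        pow_succ', mul_assoc]
  -- A symmetric integer matrix has no nilpotent part: N²Y = 0 gives (NY)ᵀ(NY) = 0.
  have h2 : ∀ j (Y : Matrix (Fin n) m ℤ), N ^ j * Y = 0 → N * Y = 0 := by
    intro j
    induction j with
    | zero => intro Y hY; rw [pow_zero, Matrix.one_mul] at hY; rw [hY, Matrix.mul_zero]
    | succ j ih =>
      intro Y hY
      rw [pow_succ, Matrix.mul_assoc] at hY
      have := ih _ hY
      refine transpose_mul_self_eq_zero_int ?_
      rw [transpose_mul, hNt, Matrix.mul_assoc, this, Matrix.mul_zero]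
  have h3 : N * (F * H) = 0 := by
    refine h2 (n - k) _ ?_
    have := h1 (n - k) (by omega)
    rw [show k + 1 + (n - k) = n + 1 by omega, horner_last] at this
    rw [← Matrix.mul_assoc, ← this, Matrix.zero_mul]
  -- Since F is symmetric, the square of the norm of HᵀFH is HᵀF·N·FH, which vanishes by `h3`.
  have h4 : Hᵀ * (F * H) = 0 := by
    refine transpose_mul_self_eq_zero_int ?_
    rw [transpose_mul, transpose_transpose, Matrix.mul_assoc, ← Matrix.mul_assoc H, ← hN, h3,
      Matrix.mul_zero]
  refine transpose_mul_self_eq_zero_int ?_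
  -- F is a multiple of N plus the scalar c, and N kills FH, so F acts on FH as c. Together with
  -- `h4` this makes (FH)ᵀ(FH) zero.
  have h5 : F * (F * H) = N.charpoly.coeff (n - k) • (F * H) := by
    have e : F = horner N k * N + N.charpoly.coeff (n - k) • 1 := by
      rw [hF, horner, (horner_commute N k).eq]
    nth_rewrite 1 [e]
    rw [Matrix.add_mul, Matrix.mul_assoc, h3, Matrix.mul_zero, zero_add, Matrix.smul_mul,
      Matrix.one_mul]
  rw [transpose_mul, hFt, Matrix.mul_assoc, h5, Matrix.mul_smul, h4, smul_zero]

end FaddeevLeVerrier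

/-! ### Size bounds and the integral generalized inverse -/

namespace FaddeevLeVerrier

open Matrix Polynomial Finset

theorem natAbs_sum_le {ι : Type*} (s : Finset ι) (f : ι → ℤ) {b : ℕ}
    (h : ∀ i ∈ s, (f i).natAbs ≤ b) : (∑ i ∈ s, f i).natAbs ≤ s.card * b :=
  (Int.natAbs_sum_le s f).trans (Finset.sum_le_card_nsmul s _ b h)

theorem natAbs_sum_range_le (m : ℕ) (f : ℕ → ℤ) {b : ℕ} (h : ∀ i < m, (f i).natAbs ≤ b) :
    (∑ i ∈ range m, f i).natAbs ≤ m * b := by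
  simpa using natAbs_sum_le (range m) f fun i hi => h i (mem_range.mp hi)

theorem natAbs_sum_mul_le {β m : ℕ} {f g : ℕ → ℤ} {x y : ℕ} (hm : m ≤ β)
    (hf : ∀ i < m, (f i).natAbs ≤ β ^ x) (hg : ∀ i < m, (g i).natAbs ≤ β ^ y) :
    (∑ i ∈ range m, f i * g i).natAbs ≤ β ^ (x + y + 1) := by
  refine (natAbs_sum_range_le m _ (b := β ^ x * β ^ y) fun i hi => ?_).trans ?_
  · rw [Int.natAbs_mul]
    exact Nat.mul_le_mul (hf i hi) (hg i hi)
  · rw [pow_succ', pow_add]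
    exact Nat.mul_le_mul_right _ hm

theorem pow_add_pow_le {β x y : ℕ} (hβ : 2 ≤ β) (h : x ≤ y) : β ^ x + β ^ y ≤ β ^ (y + 1) := by
  have h1 : β ^ x ≤ β ^ y := Nat.pow_le_pow_right (by omega) h
  calc β ^ x + β ^ y ≤ 2 * β ^ y := by omega
    _ ≤ β * β ^ y := Nat.mul_le_mul_right _ hβ
    _ = β ^ (y + 1) := (pow_succ' _ _).symm

variable {n β : ℕ} {A : ℕ → ℕ → ℤ}

/-- One step multiplies the bound by β⁶. The new matrix costs β³: an entry of A, at most β summands,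
and the added scalar. The trace of its product with A costs another β³: an entry of A and a double
sum. Division does not increase absolute values. -/
theorem natAbs_step_le (hβ : 2 ≤ β) (hn : n ≤ β)
    (hA : ∀ i < n, ∀ j < n, (A i j).natAbs ≤ β) (k : ℕ) :
    (∀ i < n, ∀ j < n, ((step n A k).1 i j).natAbs ≤ β ^ (6 * k)) ∧
      (step n A k).2.natAbs ≤ β ^ (6 * k) := by
  induction k with
  | zero => simp [step]
  | succ k ih =>
    obtain ⟨ih1, ih2⟩ := ih
    have h1 : ∀ i < n, ∀ j < n, ((step n A (k + 1)).1 i j).natAbs ≤ β ^ (6 * k + 3) := by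
      intro i hi j hj
      simp only [step]
      refine (Int.natAbs_add_le _ _).trans ?_
      rw [add_comm]
      refine le_trans (add_le_add (b := β ^ (6 * k)) (d := β ^ (6 * k + 2)) ?_ ?_)
        (pow_add_pow_le hβ (by omega))
      · split_ifs <;> simp [ih2]
      · refine (natAbs_sum_mul_le (x := 1) (y := 6 * k) hn
          (fun l hl => by simpa using hA i hi l hl) (fun l hl => ih1 l hl j hj)).trans ?_
        rw [show 1 + 6 * k + 1 = 6 * k + 2 by ring]
    refine ⟨fun i hi j hj => (h1 i hi j hj).trans (Nat.pow_le_pow_right (by omega) (by omega)), ?_⟩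
    have h2 : (step n A (k + 1)).2 =
        (0 - ∑ i ∈ range n, ∑ l ∈ range n, A i l * (step n A (k + 1)).1 l i) / (k + 1) := rfl
    rw [h2, zero_sub]
    refine (Int.natAbs_ediv_le_natAbs _ _).trans ?_
    rw [Int.natAbs_neg]
    refine (natAbs_sum_range_le n _ (b := β ^ (6 * k + 5)) fun i hi => ?_).trans ?_
    · refine (natAbs_sum_mul_le (x := 1) (y := 6 * k + 3) hn
          (fun l hl => by simpa using hA i hi l hl) (fun l hl => h1 l hl i hi)).trans ?_
      rw [show 1 + (6 * k + 3) + 1 = 6 * k + 5 by ring]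
    · calc n * β ^ (6 * k + 5) ≤ β * β ^ (6 * k + 5) := Nat.mul_le_mul_right _ hn
        _ = β ^ (6 * (k + 1)) := by ring

/-- The Faddeev–LeVerrier algorithm gives, up to a non-zero integer factor, a generalized inverse
of `H` whose entries are small. -/
theorem exists_generalized_inverse {C : ℕ} (hβ : 2 ≤ β) (hn : n ≤ β)
    (hA : ∀ i < n, ∀ j < n, (A i j).natAbs ≤ β) (H : Matrix (Fin n) (Fin C) ℤ)
    (hH : ∀ i c, (H i c).natAbs ≤ β) (hAH : toMatrix n A = H * Hᵀ) :
    lastNonzero n A n ≠ 0 ∧ ∃ (Φ : Matrix (Fin n) (Fin n) ℤ) (Z : Matrix (Fin C) (Fin n) ℤ),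
      lastNonzero n A n • (1 : Matrix (Fin n) (Fin n) ℤ) = Φ + H * Z ∧ Φ * H = 0 ∧
      (∀ i j, (Φ i j).natAbs ≤ β ^ (6 * n + 3)) ∧ ∀ c i, (Z c i).natAbs ≤ β ^ (6 * n + 2) := by
  obtain ⟨k, hk, h1, h2, h3⟩ := exists_lastNonzero n A n
  have hb := natAbs_step_le hβ hn hA k
  obtain ⟨e1, e2⟩ := step_eq_horner n A hk
  rw [h2]
  -- With M_k the Horner matrix at the last non-zero coefficient t, the recursion reads M_{k+1} =
  -- HHᵀM_k + t·1. So Φ = M_{k+1} and Z = -HᵀM_k.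
  refine ⟨h1, horner (H * Hᵀ) (k + 1), -(Hᵀ * horner (H * Hᵀ) k), ?_, ?_, ?_, ?_⟩
  · rw [horner, e2, hAH, Matrix.mul_neg, Matrix.mul_assoc]
    abel
  · refine horner_mul_eq_zero H hk fun j hj hj' => ?_
    rw [← hAH, ← (step_eq_horner n A hj').2]
    exact h3 j hj hj'
  · intro i j
    have hb' : (toMatrix n (step n A (k + 1)).1 i j).natAbs ≤ β ^ (6 * n + 3) := by
      simp only [step, toMatrix, of_apply]
      refine (Int.natAbs_add_le _ _).trans ?_
      rw [add_comm]
      refine le_trans (add_le_add (b := β ^ (6 * k)) (d := β ^ (6 * k + 2)) ?_ ?_)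
        ((pow_add_pow_le hβ (by omega)).trans (Nat.pow_le_pow_right (by omega) (by omega)))
      · split_ifs <;> simp [hb.2]
      · refine (natAbs_sum_mul_le (x := 1) (y := 6 * k) hn
          (fun l hl => by simpa using hA i i.2 l hl) (fun l hl => hb.1 l hl j j.2)).trans ?_
        rw [show 1 + 6 * k + 1 = 6 * k + 2 by ring]
    have e3 : toMatrix n (step n A (k + 1)).1 = horner (toMatrix n A) (k + 1) := by
      rw [horner, ← e1, ← e2]
      ext i j
      simp [toMatrix, step, Matrix.mul_apply, Finset.sum_range, Matrix.one_apply, Fin.ext_iff,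
        Matrix.smul_apply, -zsmul_eq_mul, -zsmul_one]
    rwa [e3, hAH] at hb'
  · intro c i
    rw [Matrix.neg_apply, Int.natAbs_neg, ← hAH, ← e1, Matrix.mul_apply]
    refine (natAbs_sum_le univ _ (b := β * β ^ (6 * k)) fun l _ => ?_).trans ?_
    · rw [Int.natAbs_mul]
      exact Nat.mul_le_mul (hH l c) (hb.1 l l.2 i i.2)
    · rw [card_univ, Fintype.card_fin]
      calc n * (β * β ^ (6 * k)) ≤ β * (β * β ^ (6 * k)) := Nat.mul_le_mul_right _ hn
        _ = β ^ (6 * k + 2) := by ring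
        _ ≤ _ := Nat.pow_le_pow_right (by omega) (by omega)

end FaddeevLeVerrier

/-! ### Splitting a submodule along a decomposition -/

namespace ModuleDecomposition

variable {R : Type*} [Ring R] {M : Type*} [AddCommGroup M] [Module R M] {I : Type*}
  {𝒜 : I → Submodule R M} {B : Submodule R M}

/-- The sum of the members of a family with index in `T`. -/
def part (𝒜 : I → Submodule R M) (T : Set I) : Submodule R M := ⨆ i ∈ T, 𝒜 i

/-- `B` splits along `T` if it is the sum of its intersections with the partial sums of the family
over `T` and over the complement of `T`. -/
def Splits (𝒜 : I → Submodule R M) (B : Submodule R M) (T : Set I) : Prop :=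
  ∀ b ∈ B, ∃ x ∈ part 𝒜 T, ∃ y ∈ part 𝒜 Tᶜ, b = x + y ∧ x ∈ B

theorem le_part {T : Set I} {i : I} (hi : i ∈ T) : 𝒜 i ≤ part 𝒜 T := le_biSup 𝒜 hi

theorem part_mono {S T : Set I} (h : S ⊆ T) : part 𝒜 S ≤ part 𝒜 T := biSup_mono h

theorem part_union (S T : Set I) : part 𝒜 (S ∪ T) = part 𝒜 S ⊔ part 𝒜 T := iSup_union

theorem isDecomposition_iff : IsDecomposition 𝒜 ↔ iSupIndep 𝒜 ∧ iSup 𝒜 = ⊤ := by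
  classical
  exact DirectSum.isInternal_submodule_iff_iSupIndep_and_iSup_eq_top 𝒜

theorem disjoint_part (h : iSupIndep 𝒜) {S T : Set I} (hST : Disjoint S T) :
    Disjoint (part 𝒜 S) (part 𝒜 T) := h.disjoint_biSup_biSup hST

theorem eq_of_add_eq_add (h : iSupIndep 𝒜) {S T : Set I} (hST : Disjoint S T) {x x' y y' : M}
    (hx : x ∈ part 𝒜 S) (hx' : x' ∈ part 𝒜 S) (hy : y ∈ part 𝒜 T) (hy' : y' ∈ part 𝒜 T)
    (e : x + y = x' + y') : x = x' ∧ y = y' := by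
  have h1 : x - x' = y' - y := by
    rw [sub_eq_sub_iff_add_eq_add, e, add_comm]
  have h2 := Submodule.disjoint_def.mp (disjoint_part h hST) (x - x') (sub_mem hx hx')
    (h1 ▸ sub_mem hy' hy)
  refine ⟨sub_eq_zero.mp h2, ?_⟩
  rw [h2] at h1
  exact (sub_eq_zero.mp h1.symm).symm

theorem exists_part_add (h : iSup 𝒜 = ⊤) (T : Set I) (a : M) :
    ∃ x ∈ part 𝒜 T, ∃ y ∈ part 𝒜 Tᶜ, a = x + y := by
  have h1 : part 𝒜 T ⊔ part 𝒜 Tᶜ = ⊤ := by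
    rw [← part_union, Set.union_compl_self, ← h]
    simp [part]
  obtain ⟨x, hx, y, hy, e⟩ := Submodule.mem_sup.mp (h1 ▸ Submodule.mem_top : a ∈ _ ⊔ _)
  exact ⟨x, hx, y, hy, e.symm⟩

theorem pushforward_eq_part {J : Type*} (f : I → J) (j : J) :
    pushforward f 𝒜 j = part 𝒜 (f ⁻¹' {j}) := rfl

/-- The component at j is separated from the sum of all others. J may be infinite here, as the
universal property quantifies over all targets. -/
theorem splits_of_restrictsTo {J : Type*} {f : I → J} (h : RestrictsTo (pushforward f 𝒜) B)
    (j : J) : Splits 𝒜 B (f ⁻¹' {j}) := by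
  intro b hb
  have h1 := (isDecomposition_iff.mp h).2
  have h2 : (⟨b, hb⟩ : B) ∈ ⨆ j, (pushforward f 𝒜 j).comap B.subtype := h1 ▸ Submodule.mem_top
  rw [iSup_split_single _ j, Submodule.mem_sup] at h2
  obtain ⟨x, hx, y, hy, e⟩ := h2
  refine ⟨x, hx, y, ?_, by rw [← Submodule.coe_add, e], x.2⟩
  have h3 : ⨆ i, ⨆ (_ : i ≠ j), (pushforward f 𝒜 i).comap B.subtype ≤
      (part 𝒜 (f ⁻¹' {j})ᶜ).comap B.subtype := by
    refine iSup₂_le fun i hi => Submodule.comap_mono ?_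
    rw [pushforward_eq_part]
    refine part_mono ?_
    rintro k rfl
    exact hi
  exact h3 hy

/-- Independence is inherited from 𝒜. For generation, the components of an element of B are split
off one index of J at a time, which is where finiteness of J enters. -/
theorem restrictsTo_of_splits {J : Type*} [Finite J] {f : I → J} (h : IsDecomposition 𝒜)
    (hf : ∀ j, Splits 𝒜 B (f ⁻¹' {j})) : RestrictsTo (pushforward f 𝒜) B := by
  classical
  obtain ⟨hi, ht⟩ := isDecomposition_iff.mp h
  refine isDecomposition_iff.mpr ⟨?_, ?_⟩
  · intro j
    refine Submodule.disjoint_def.mpr fun x hx hx' => ?_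
    have h1 : ⨆ i, ⨆ (_ : i ≠ j), (pushforward f 𝒜 i).comap B.subtype ≤
        (part 𝒜 (f ⁻¹' {j})ᶜ).comap B.subtype := by
      refine iSup₂_le fun i hi => Submodule.comap_mono ?_
      rw [pushforward_eq_part]
      refine part_mono ?_
      rintro k rfl
      exact hi
    have h2 := Submodule.disjoint_def.mp (disjoint_part hi disjoint_compl_right) x
      (show (x : M) ∈ part 𝒜 (f ⁻¹' {j}) from hx) (h1 hx')
    exact Subtype.ext h2
  · rw [eq_top_iff]
    rintro ⟨b, hb⟩ -
    -- After the indices in S have been treated, the remainder lies in the sum over the indices that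
    -- f maps outside S. For S = J the remainder is zero.
    have key : ∀ S : Finset J, ∃ x : B, x ∈ ⨆ j, (pushforward f 𝒜 j).comap B.subtype ∧
        b - x ∈ part 𝒜 (f ⁻¹' (S : Set J))ᶜ := by
      intro S
      induction S using Finset.induction_on with
      | empty =>
        refine ⟨0, zero_mem _, ?_⟩
        have : b - (0 : B) ∈ iSup 𝒜 := ht ▸ Submodule.mem_top
        simpa [part] using this
      | insert j S hj ih =>
        obtain ⟨x, hx, hbx⟩ := ih
        obtain ⟨p, hp, q, hq, e, hpB⟩ := hf j (b - x) (sub_mem hb x.2)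
        have h1 : (f ⁻¹' (S : Set J))ᶜ = f ⁻¹' {j} ∪ (f ⁻¹' ((insert j S : Finset J) : Set J))ᶜ := by
          ext i
          simp only [Set.mem_compl_iff, Set.mem_preimage, Finset.mem_coe, Set.mem_union,
            Set.mem_singleton_iff, Finset.coe_insert, Set.mem_insert_iff]
          constructor
          · tauto
          · rintro (h | h)
            · rw [h]; exact hj
            · tauto
        rw [h1, part_union] at hbx
        obtain ⟨p', hp', q', hq', e'⟩ := Submodule.mem_sup.mp hbx
        have h2 : part 𝒜 (f ⁻¹' ((insert j S : Finset J) : Set J))ᶜ ≤ part 𝒜 (f ⁻¹' {j})ᶜ := by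
          refine part_mono (Set.compl_subset_compl.mpr (Set.preimage_mono ?_))
          simp
        obtain ⟨-, rfl⟩ := eq_of_add_eq_add hi disjoint_compl_right hp hp' hq (h2 hq')
          (e.symm.trans e'.symm)
        refine ⟨x + ⟨p, hpB⟩, add_mem hx (Submodule.mem_iSup_of_mem j hp), ?_⟩
        have : b - (x + ⟨p, hpB⟩ : B) = q := by
          rw [Submodule.coe_add, ← sub_sub, e]
          simp
        rw [this]
        exact hq'
    have := Fintype.ofFinite J
    obtain ⟨x, hx, hbx⟩ := key Finset.univ
    have h3 : b - x = 0 := by simpa [part] using hbx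
    have h4 : (⟨b, hb⟩ : B) = x := Subtype.ext (sub_eq_zero.mp h3)
    rw [h4]
    exact hx

/-- A surjection whose fibres are the classes of the finest partition along which `B` splits is
universal. -/
theorem isUniversalRestricting_of_splits {U : Type*} [Finite U] (h : IsDecomposition 𝒜)
    {u : I → U} (hu : Function.Surjective u)
    (hsplit : ∀ T : Set I, Splits 𝒜 B T ↔ ∀ i j, u i = u j → (i ∈ T ↔ j ∈ T)) :
    IsUniversalRestricting 𝒜 B u := by
  refine ⟨restrictsTo_of_splits h fun j => (hsplit _).mpr fun i i' e => by simp [e], ?_⟩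
  intro J f hf
  -- B splits along the fibres of f, and every set along which B splits is a union of fibres of u.
  -- So f is constant on the fibres of u.
  have h1 : ∀ i i', u i = u i' → f i = f i' := by
    intro i i' e
    have := ((hsplit _).mp (splits_of_restrictsTo hf (f i')) i i' e).mpr rfl
    exact this
  refine ⟨fun x => f (Function.surjInv hu x), ?_, ?_⟩
  · funext i
    exact h1 _ _ (Function.surjInv_eq hu (u i))
  · intro g hg
    funext x
    rw [← hg]
    simp [Function.surjInv_eq hu x]

/-- Splitting can be tested on generators. -/
theorem splits_of_span {s : Set M} {T : Set I} (hs : Submodule.span R s = B)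
    (h : ∀ b ∈ s, ∃ x ∈ part 𝒜 T, ∃ y ∈ part 𝒜 Tᶜ, b = x + y ∧ x ∈ B) : Splits 𝒜 B T := by
  intro b hb
  rw [← hs] at hb
  induction hb using Submodule.span_induction with
  | mem b hb => exact h b hb
  | zero => exact ⟨0, zero_mem _, 0, zero_mem _, by simp, zero_mem _⟩
  | add b c _ _ ihb ihc =>
    obtain ⟨x, hx, y, hy, rfl, hxB⟩ := ihb
    obtain ⟨x', hx', y', hy', rfl, hxB'⟩ := ihc
    exact ⟨x + x', add_mem hx hx', y + y', add_mem hy hy', by abel, add_mem hxB hxB'⟩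
  | smul r b _ ih =>
    obtain ⟨x, hx, y, hy, rfl, hxB⟩ := ih
    exact ⟨r • x, Submodule.smul_mem _ _ hx, r • y, Submodule.smul_mem _ _ hy, smul_add _ _ _,
      Submodule.smul_mem _ _ hxB⟩

end ModuleDecomposition

/-! ### Lattices with a triangular basis -/

namespace TriangularBasis

open Finset

/-- The first `D` entries of a vector. -/
def trunc (D : ℕ) (w : ℕ → ℤ) : ℕ → ℤ := fun j => if j < D then w j else 0

/-- The lattice that is spanned by the rows `k, …, D - 1` of `W`. -/
def tail (D : ℕ) (W : ℕ → ℕ → ℤ) (k : ℕ) : Submodule ℤ (ℕ → ℤ) :=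
  Submodule.span ℤ ((fun a => trunc D (W a)) '' (Ico k D : Finset ℕ))

/-- The first `D` rows and columns of `W` form an upper triangular matrix with positive diagonal
entries. -/
structure IsTriangular (D : ℕ) (W : ℕ → ℕ → ℤ) : Prop where
  zero : ∀ a < D, ∀ j < a, W a j = 0
  pos : ∀ a < D, 0 < W a a

variable {D : ℕ} {W : ℕ → ℕ → ℤ}

theorem trunc_mem_tail {k a : ℕ} (h : k ≤ a) (ha : a < D) : trunc D (W a) ∈ tail D W k :=
  Submodule.subset_span ⟨a, by simp [h, ha], rfl⟩

theorem tail_mono {k l : ℕ} (h : k ≤ l) : tail D W l ≤ tail D W k := by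
  refine Submodule.span_mono (Set.image_mono ?_)
  intro a
  simp only [coe_Ico, Set.mem_Ico]
  omega

theorem mem_tail_iff {k : ℕ} {x : ℕ → ℤ} :
    x ∈ tail D W k ↔ ∃ y : ℕ → ℤ, ∑ a ∈ Ico k D, y a • trunc D (W a) = x := by
  rw [tail, Submodule.mem_span_image_finset_iff_exists_fun']

theorem sum_apply_of_zero (hW : IsTriangular D W) {y : ℕ → ℤ} {m : ℕ} (hm : m < D)
    (hy : ∀ a < m, y a = 0) : (∑ a ∈ Ico 0 D, y a • trunc D (W a)) m = y m * W m m := by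
  rw [Finset.sum_apply, sum_eq_single m]
  · simp [trunc, hm]
  · intro b hb hbm
    rcases lt_or_gt_of_ne hbm with h | h
    · simp [hy b h]
    · simp only [mem_Ico] at hb
      simp [trunc, hm, hW.zero b hb.2 m h]
  · intro h
    simp at h
    omega

/-- Forward substitution: the first non-zero coefficient would show up as a non-zero multiple of the
pivot in its column. -/
theorem coeff_eq_zero (hW : IsTriangular D W) {y : ℕ → ℤ} {m : ℕ}
    (hx : ∀ j < m, (∑ a ∈ Ico 0 D, y a • trunc D (W a)) j = 0) :
    ∀ a < m, a < D → y a = 0 := by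
  intro a
  induction a using Nat.strong_induction_on with
  | _ a ih =>
    intro ham haD
    have h1 := hx a ham
    rw [sum_apply_of_zero hW haD fun b hb => ih b hb (hb.trans ham) (hb.trans haD)] at h1
    exact (mul_eq_zero.mp h1).resolve_right (hW.pos a haD).ne'

theorem dvd_of_mem (hW : IsTriangular D W) {x : ℕ → ℤ} (hx : x ∈ tail D W 0) {m : ℕ}
    (hm : m < D) (h : ∀ j < m, x j = 0) : W m m ∣ x m := by
  obtain ⟨y, rfl⟩ := mem_tail_iff.mp hx
  rw [sum_apply_of_zero hW hm fun a ha => coeff_eq_zero hW h a ha (ha.trans hm)]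
  exact dvd_mul_left _ _

/-- The part of row a outside S is again a lattice vector. Its entries are entries of a reduced row
to the right of the pivot, hence smaller than the pivots below them, whereas its leading entry would
have to be divisible by such a pivot. So this part is zero. -/
theorem entry_eq_zero_of_indicator_mem (hW : IsTriangular D W)
    (hred : ∀ j < D, ∀ i < j, 0 ≤ W i j ∧ W i j < W j j) {n : ℕ} {S : Set ℕ}
    (h : ∀ x ∈ tail D W 0, (∀ j < n, x j = 0) → S.indicator x ∈ tail D W 0) {a c : ℕ}
    (hna : n ≤ a) (ha : a < D) (hc : c < D) (haS : a ∈ S) (hcS : c ∉ S) : W a c = 0 := by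
  have hx : trunc D (W a) ∈ tail D W 0 := trunc_mem_tail (Nat.zero_le _) ha
  have hx0 : ∀ j < a, trunc D (W a) j = 0 := fun j hj => by simp [trunc, hW.zero a ha j hj]
  set z := trunc D (W a) - S.indicator (trunc D (W a)) with hz
  have hzm : z ∈ tail D W 0 := sub_mem hx (h _ hx fun j hj => hx0 j (by omega))
  have hzv : ∀ j, z j = 0 ∨ (a < j ∧ j < D ∧ z j = W a j) := by
    intro j
    by_cases hjS : j ∈ S
    · left; simp [hz, hjS]
    · by_cases hjD : j < D
      · rcases lt_trichotomy j a with hj | rfl | hj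
        · left; simp [hz, hjS, hx0 j hj]
        · exact absurd haS hjS
        · right; exact ⟨hj, hjD, by simp [hz, hjS, trunc, hjD]⟩
      · left; simp [hz, hjS, trunc, hjD]
  -- Strong induction treats entry j as the leading entry: when all earlier ones vanish, the pivot W
  -- j j divides it, and 0 ≤ W a j < W j j leaves only zero.
  have hz0 : ∀ j, z j = 0 := by
    intro j
    induction j using Nat.strong_induction_on with
    | _ j ih =>
      rcases hzv j with h0 | ⟨h1, h2, h3⟩
      · exact h0
      · have hd := dvd_of_mem hW hzm h2 ih
        have hr := hred j h2 a h1
        rw [h3] at hd ⊢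
        exact Int.eq_zero_of_dvd_of_nonneg_of_lt hr.1 hr.2 hd
  have := hz0 c
  simpa [hz, hcS, trunc, hc] using this

/-- A lattice with a basis in Hermite normal form splits along a set of coordinates if and only if
each basis vector has its support in the set or in its complement. -/
theorem indicator_mem_iff (hW : IsTriangular D W)
    (hred : ∀ j < D, ∀ i < j, 0 ≤ W i j ∧ W i j < W j j) (n : ℕ) (S : Set ℕ) :
    (∀ x ∈ tail D W 0, (∀ j < n, x j = 0) → S.indicator x ∈ tail D W 0) ↔
      ∀ a c, n ≤ a → a < D → n ≤ c → c < D → W a c ≠ 0 → (a ∈ S ↔ c ∈ S) := by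
  constructor
  · intro h a c hna ha hnc hc hac
    by_contra hcon
    by_cases haS : a ∈ S
    · exact hac (entry_eq_zero_of_indicator_mem hW hred h hna ha hc haS (by tauto))
    -- The condition is symmetric in S and its complement, so the case that only c lies in S reduces
    -- to the previous one.
    · refine hac (entry_eq_zero_of_indicator_mem hW hred (S := Sᶜ) ?_ hna ha hc haS
        (by simp only [Set.mem_compl_iff]; tauto))
      intro x hx hx0
      rw [Set.indicator_compl]
      exact sub_mem hx (h x hx hx0)
  · intro h x hx hx0
    obtain ⟨y, rfl⟩ := mem_tail_iff.mp hx
    -- A lattice vector that vanishes on the first n coordinates does not involve the first n rows.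
    -- Only rows from n on have to be considered, and each is either kept or killed by the
    -- projection.
    have hy := coeff_eq_zero hW hx0
    have e : S.indicator (∑ a ∈ Ico 0 D, y a • trunc D (W a)) =
        ∑ a ∈ Ico 0 D, y a • S.indicator (trunc D (W a)) := by
      funext j
      by_cases hj : j ∈ S <;> simp [hj]
    rw [e]
    refine sum_mem fun a ha => ?_
    simp only [mem_Ico, Nat.zero_le, true_and] at ha
    by_cases han : a < n
    · rw [hy a han ha, zero_smul]
      exact zero_mem _
    · refine Submodule.smul_mem _ _ ?_
      have hsupp : ∀ j, trunc D (W a) j ≠ 0 → (a ∈ S ↔ j ∈ S) := by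
        intro j hj
        have hjD : j < D := by
          by_contra hjD
          simp [trunc, hjD] at hj
        simp only [trunc, hjD, if_true] at hj
        refine h a j (by omega) ha ?_ hjD hj
        by_contra hjn
        exact hj (hW.zero a ha j (by omega))
      by_cases haS : a ∈ S
      · have : S.indicator (trunc D (W a)) = trunc D (W a) := by
          rw [Set.indicator_eq_self]
          exact fun j hj => (hsupp j hj).mp haS
        rw [this]
        exact trunc_mem_tail (Nat.zero_le _) ha
      · have : S.indicator (trunc D (W a)) = 0 := by
          funext j
          by_cases hjS : j ∈ S
          · have : trunc D (W a) j = 0 := by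
              by_contra hj
              exact haS ((hsupp j hj).mpr hjS)
            simp [this]
          · simp [hjS]
        rw [this]
        exact zero_mem _

end TriangularBasis

/-! ### The lattice of a decomposition -/

namespace DecompositionInput

open Finset ModuleDecomposition TriangularBasis

/-- The first `n` entries of a column. -/
def columnVector (n : ℕ) (col : ℕ → ℕ → ℤ) (c : ℕ) : Fin n → ℤ := fun i => col c i

/-- The columns `col c` with `c < C` are the columns of all matrices of the input: those of
the relations come first, those of member `l` of the family are marked by `kind c = l`, and those
of the relations and of the subgroup by `kind c = -1`. -/
structure IsColumns (X : DecompositionInput) (C : ℕ) (col : ℕ → ℕ → ℤ) (kind : ℕ → ℤ) : Prop where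
  kind_eq : ∀ c < C, kind c = -1 ∨ ∃ l : Fin X.r, kind c = (l : ℕ)
  span_family : ∀ l : Fin X.r, Submodule.span ℤ (columnVector X.n col ''
    ((range C).filter fun c => kind c = (l : ℕ) : Finset ℕ)) =
      LinearMap.range (X.generators l).mulVecLin
  kind_of_lt : ∀ c < C, c < X.n → kind c = -1
  span_relations : Submodule.span ℤ (columnVector X.n col ''
    ((range C).filter fun c => c < X.n : Finset ℕ)) = LinearMap.range X.relations.mulVecLin
  span_neg : Submodule.span ℤ (columnVector X.n col ''
    ((range C).filter fun c => kind c < 0 : Finset ℕ)) =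
      LinearMap.range X.relations.mulVecLin ⊔ LinearMap.range X.subgroupGenerators.mulVecLin

/-- The vector that a column contributes to the lattice. -/
def latticeVector (n : ℕ) (col : ℕ → ℕ → ℤ) (kind : ℕ → ℤ) (c : ℕ) : ℕ → ℤ := fun x =>
  if x < n then col c x else if x = n + c ∧ 0 ≤ kind c then 1 else 0

/-- The lattice that describes the subgroup modulo `N`. -/
def lattice (n C : ℕ) (col : ℕ → ℕ → ℤ) (kind : ℕ → ℤ) (N : ℤ) : Submodule ℤ (ℕ → ℤ) :=
  Submodule.span ℤ (latticeVector n col kind '' (range C : Finset ℕ)) ⊔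
    Submodule.span ℤ ((fun j => Pi.single j N) '' (range (n + C) : Finset ℕ))

variable {X : DecompositionInput} {C : ℕ} {col : ℕ → ℕ → ℤ} {kind : ℕ → ℤ}

/-- The projection of `ℤⁿ` to the group. -/
abbrev toGroup (X : DecompositionInput) : (Fin X.n → ℤ) →ₗ[ℤ] X.Group :=
  (LinearMap.range X.relations.mulVecLin).mkQ

theorem toGroup_eq_zero_iff {v : Fin X.n → ℤ} :
    X.toGroup v = 0 ↔ v ∈ LinearMap.range X.relations.mulVecLin :=
  Submodule.Quotient.mk_eq_zero _

theorem toGroup_surjective : Function.Surjective X.toGroup := Submodule.mkQ_surjective _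

/-- The preimage of B in ℤⁿ contains the relations. This is why both the relations and the
generators of B carry the mark -1. -/
theorem toGroup_mem_subgroup_iff (h : X.IsColumns C col kind) {v : Fin X.n → ℤ} :
    X.toGroup v ∈ X.subgroup ↔ v ∈ Submodule.span ℤ (columnVector X.n col ''
      ((range C).filter fun c => kind c < 0 : Finset ℕ)) := by
  rw [h.span_neg, Submodule.mem_sup]
  constructor
  · rintro ⟨w, hw, e⟩
    refine ⟨v - w, ?_, w, hw, by simp⟩
    rw [← toGroup_eq_zero_iff, map_sub, sub_eq_zero]
    exact e.symm
  · rintro ⟨x, hx, w, hw, rfl⟩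
    rw [map_add, toGroup_eq_zero_iff.mpr hx, zero_add]
    exact ⟨w, hw, rfl⟩

theorem column_mem_subgroup (h : X.IsColumns C col kind) {c : ℕ} (hc : c < C) (hk : kind c < 0) :
    X.toGroup (columnVector X.n col c) ∈ X.subgroup :=
  (toGroup_mem_subgroup_iff h).mpr (Submodule.subset_span ⟨c, by simp [hc, hk], rfl⟩)

theorem column_mem_family (h : X.IsColumns C col kind) {c : ℕ} (hc : c < C) {l : Fin X.r}
    (hk : kind c = (l : ℕ)) : X.toGroup (columnVector X.n col c) ∈ X.family l := by
  refine ⟨_, ?_, rfl⟩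
  have := h.span_family l
  rw [← this]
  exact Submodule.subset_span ⟨c, by simp [hc, hk], rfl⟩

/-- The coordinates of the columns of the members of the family with index in `T`. -/
def coordinates (X : DecompositionInput) (C : ℕ) (kind : ℕ → ℤ) (T : Set (Fin X.r)) : Set ℕ :=
  {x | ∃ c < C, x = X.n + c ∧ ∃ l ∈ T, kind c = (l : ℕ)}

/-- The element of the group with given coordinates. -/
noncomputable def combination (X : DecompositionInput) (C : ℕ) (col : ℕ → ℕ → ℤ) (kind : ℕ → ℤ)
    (x : ℕ → ℤ) : X.Group :=
  ∑ c ∈ range C, if 0 ≤ kind c then x (X.n + c) • X.toGroup (columnVector X.n col c) else 0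

theorem combination_add (x y : ℕ → ℤ) : X.combination C col kind (x + y) =
    X.combination C col kind x + X.combination C col kind y := by
  simp only [combination, ← sum_add_distrib]
  refine sum_congr rfl fun c _ => ?_
  split_ifs
  · rw [Pi.add_apply, add_smul]
  · simp

theorem combination_mem_part (h : X.IsColumns C col kind) {T : Set (Fin X.r)} {x : ℕ → ℤ}
    (hx : ∀ c < C, ∀ l ∉ T, kind c = (l : ℕ) → x (X.n + c) = 0) :
    X.combination C col kind x ∈ part X.family T := by
  refine sum_mem fun c hc => ?_
  rw [mem_range] at hc
  split_ifs with hk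
  · rcases h.kind_eq c hc with h1 | ⟨l, hl⟩
    · omega
    · by_cases hlT : l ∈ T
      · exact Submodule.smul_mem _ _ (le_part hlT (column_mem_family h hc hl))
      · rw [hx c hc l hlT hl, zero_smul]
        exact zero_mem _
  · exact zero_mem _

theorem combination_indicator_mem_part (h : X.IsColumns C col kind) (T : Set (Fin X.r))
    (x : ℕ → ℤ) : X.combination C col kind ((X.coordinates C kind T).indicator x) ∈
      part X.family T := by
  refine combination_mem_part h fun c hc l hl hk => Set.indicator_of_notMem ?_ _
  rintro ⟨c', -, e, l', hl', hk'⟩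
  obtain rfl : c = c' := by omega
  have : l = l' := Fin.ext (by omega)
  exact hl (this ▸ hl')

theorem combination_sub_indicator_mem_part (h : X.IsColumns C col kind) (T : Set (Fin X.r))
    (x : ℕ → ℤ) : X.combination C col kind (x - (X.coordinates C kind T).indicator x) ∈
      part X.family Tᶜ := by
  refine combination_mem_part h fun c hc l hl hk => ?_
  have : X.n + c ∈ X.coordinates C kind T := ⟨c, hc, rfl, l, by simpa using hl, hk⟩
  simp [this]

theorem combination_indicator_univ (h : X.IsColumns C col kind) (x : ℕ → ℤ) :
    X.combination C col kind ((X.coordinates C kind Set.univ).indicator x) =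
      X.combination C col kind x := by
  refine sum_congr rfl fun c hc => ?_
  rw [mem_range] at hc
  split_ifs with hk
  · rcases h.kind_eq c hc with h1 | ⟨l, hl⟩
    · omega
    · rw [Set.indicator_of_mem]
      exact ⟨c, hc, rfl, l, trivial, hl⟩
  · rfl

theorem exists_combination_eq (h : X.IsColumns C col kind) (ht : iSup X.family = ⊤)
    (a : X.Group) : ∃ x, X.combination C col kind x = a := by
  have hmem : a ∈ iSup X.family := ht ▸ Submodule.mem_top
  induction hmem using Submodule.iSup_induction' with
  | mem l a ha =>
    obtain ⟨v, hv, rfl⟩ := ha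
    rw [SetLike.mem_coe, ← h.span_family l,
      Submodule.mem_span_image_finset_iff_exists_fun'] at hv
    obtain ⟨y, rfl⟩ := hv
    refine ⟨fun x => if kind (x - X.n) = (l : ℕ) then y (x - X.n) else 0, ?_⟩
    rw [map_sum, sum_filter, combination]
    refine sum_congr rfl fun c _ => ?_
    by_cases hk : kind c = (l : ℕ)
    · rw [if_pos (by omega), if_pos hk, map_smul]
      simp only [add_tsub_cancel_left, hk, if_true]
    · simp [hk]
  | zero => exact ⟨0, by simp [combination]⟩
  | add a b _ _ iha ihb =>
    obtain ⟨x, rfl⟩ := iha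
    obtain ⟨y, rfl⟩ := ihb
    exact ⟨x + y, combination_add x y⟩

/-- The elements of the subgroup modulo `N`. -/
def modSubgroup (X : DecompositionInput) (N : ℤ) : Submodule ℤ X.Group :=
  X.subgroup ⊔ LinearMap.range (LinearMap.lsmul ℤ X.Group N)

theorem mem_modSubgroup {N : ℤ} {p : X.Group} :
    p ∈ X.modSubgroup N ↔ ∃ b ∈ X.subgroup, ∃ a : X.Group, p = b + N • a := by
  rw [modSubgroup, Submodule.mem_sup]
  constructor
  · rintro ⟨b, hb, _, ⟨a, rfl⟩, rfl⟩
    exact ⟨b, hb, a, rfl⟩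
  · rintro ⟨b, hb, a, rfl⟩
    exact ⟨b, hb, _, ⟨a, rfl⟩, rfl⟩

theorem smul_mem_modSubgroup {N : ℤ} (a : X.Group) : N • a ∈ X.modSubgroup N :=
  mem_modSubgroup.mpr ⟨0, zero_mem _, a, by simp⟩

/-- Vanishing of the first n coordinates is a relation, modulo N, between all columns. Moving the
columns marked -1 to the other side expresses the combination of the family generators through B and
NA. -/
theorem combination_mem_modSubgroup (h : X.IsColumns C col kind) {N : ℤ} {x : ℕ → ℤ}
    (hx : x ∈ lattice X.n C col kind N) (hx0 : ∀ j < X.n, x j = 0) :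
    X.combination C col kind x ∈ X.modSubgroup N := by
  obtain ⟨p, hp, q, hq, rfl⟩ := Submodule.mem_sup.mp hx
  rw [Submodule.mem_span_image_finset_iff_exists_fun'] at hp hq
  obtain ⟨y, rfl⟩ := hp
  obtain ⟨z, rfl⟩ := hq
  have hz : ∀ j < X.n + C, (∑ i ∈ range (X.n + C), z i • (Pi.single i N : ℕ → ℤ)) j = N * z j := by
    intro j hj
    rw [Finset.sum_apply, sum_eq_single j]
    · simp [mul_comm]
    · intro b _ hb
      simp [hb.symm]
    · intro hj'
      exact absurd (mem_range.mpr hj) hj'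
  have h1 : ∑ c ∈ range C, y c • X.toGroup (columnVector X.n col c) ∈ X.modSubgroup N := by
    -- Read off from the first n coordinates of the lattice vector.
    have e : ∑ c ∈ range C, y c • columnVector X.n col c = N • fun i : Fin X.n => -z i := by
      funext i
      have := hx0 i i.2
      rw [Pi.add_apply, hz i (by omega), Finset.sum_apply] at this
      have e2 : ∀ c, (y c • latticeVector X.n col kind c) i = y c * col c i := by
        intro c; simp [latticeVector]
      simp only [e2] at this
      simp only [Finset.sum_apply, Pi.smul_apply, smul_eq_mul, columnVector]
      linarith
    have e' := congrArg X.toGroup e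
    rw [map_sum, map_smul] at e'
    simp only [map_smul] at e'
    rw [e']
    exact smul_mem_modSubgroup _
  -- The coordinate at n + c is the coefficient of column c plus a multiple of N. The combination is
  -- therefore the full sum from `h1`, minus the terms marked -1, plus multiples of N.
  have h2 : X.combination C col kind (∑ i ∈ range C, y i • latticeVector X.n col kind i +
      ∑ i ∈ range (X.n + C), z i • Pi.single i N) =
      ∑ c ∈ range C, y c • X.toGroup (columnVector X.n col c) +
        ∑ c ∈ range C, ((if 0 ≤ kind c then 0 else -y c • X.toGroup (columnVector X.n col c)) +
          if 0 ≤ kind c then N • z (X.n + c) • X.toGroup (columnVector X.n col c) else 0) := by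
    rw [combination, ← sum_add_distrib]
    refine sum_congr rfl fun c hc => ?_
    rw [mem_range] at hc
    by_cases hk : 0 ≤ kind c
    · have e3 : (∑ i ∈ range C, y i • latticeVector X.n col kind i) (X.n + c) = y c := by
        rw [Finset.sum_apply, sum_eq_single c]
        · simp [latticeVector, hk]
        · intro b _ hb
          simp [latticeVector, hb.symm]
        · intro hc'
          exact absurd (mem_range.mpr hc) hc'
      simp only [hk, if_true, Pi.add_apply, e3, hz _ (show X.n + c < X.n + C by omega), add_smul,
        mul_smul, zero_add]
    · simp [hk]
  rw [h2]
  refine add_mem h1 (sum_mem fun c hc => add_mem ?_ ?_)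
  · rw [mem_range] at hc
    split_ifs with hk
    · exact zero_mem _
    · exact Submodule.smul_mem _ _ (Submodule.mem_sup_left (column_mem_subgroup h hc (by omega)))
  · split_ifs
    · exact smul_mem_modSubgroup _
    · exact zero_mem _

/-- Converse of `combination_mem_modSubgroup`: a representation of the combination modulo B and N
lifts to ℤⁿ and provides the missing coefficients. Outside the coordinates of the family the lattice
contains only multiples of N, hence the support condition. -/
theorem mem_lattice_of_combination_mem (h : X.IsColumns C col kind) {N : ℤ} {x : ℕ → ℤ}
    (hx : X.combination C col kind x ∈ X.modSubgroup N)
    (hx0 : ∀ j, j ∉ X.coordinates C kind Set.univ → x j = 0) :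
    x ∈ lattice X.n C col kind N := by
  obtain ⟨b, hb, a, e⟩ := mem_modSubgroup.mp hx
  obtain ⟨α, rfl⟩ := toGroup_surjective a
  have h1 : X.toGroup ((∑ c ∈ range C, if 0 ≤ kind c then x (X.n + c) • columnVector X.n col c
      else 0) - N • α) = b := by
    rw [map_sub, map_smul, map_sum, sub_eq_iff_eq_add, ← e, combination]
    refine sum_congr rfl fun c _ => ?_
    split_ifs
    · exact map_smul _ _ _
    · exact map_zero _
  rw [← h1, toGroup_mem_subgroup_iff h, Submodule.mem_span_image_finset_iff_exists_fun'] at hb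
  obtain ⟨y, hy⟩ := hb
  -- The family columns are taken with the coordinates of x, the columns marked -1 with the
  -- negatives of the coefficients of b, and -α corrects the first n coordinates to zero.
  have hxe : x = ∑ c ∈ range C, (if 0 ≤ kind c then x (X.n + c) else -y c) •
      latticeVector X.n col kind c +
      ∑ j ∈ range (X.n + C), (if hj : j < X.n then -α ⟨j, hj⟩ else 0) • Pi.single j N := by
    have hz : ∀ j, (∑ i ∈ range (X.n + C),
        (if hj : i < X.n then -α ⟨i, hj⟩ else 0) • (Pi.single i N : ℕ → ℤ)) j =
          if hj : j < X.n then -α ⟨j, hj⟩ * N else 0 := by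
      intro j
      rw [Finset.sum_apply]
      by_cases hj : j < X.n
      · rw [sum_eq_single j]
        · simp [hj]
        · intro b _ hb
          simp [hb.symm]
        · intro hj'
          exact absurd (mem_range.mpr (by omega)) hj'
      · rw [sum_eq_zero]
        · simp [hj]
        · intro i _
          by_cases hi : i < X.n
          · have : j ≠ i := by omega
            simp [this]
          · simp [hi]
    funext j
    rw [Pi.add_apply, hz, Finset.sum_apply]
    by_cases hj : j < X.n
    · have hxj : x j = 0 := hx0 j (by rintro ⟨c, _, e, -⟩; omega)
      have hyj := congrFun hy ⟨j, hj⟩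
      rw [Finset.sum_apply, Pi.sub_apply, Finset.sum_apply, sum_filter] at hyj
      rw [hxj]
      simp only [hj, dite_true]
      have e2 : ∑ c ∈ range C, ((if 0 ≤ kind c then x (X.n + c) else -y c) •
          latticeVector X.n col kind c) j =
          ∑ c ∈ range C, ((if 0 ≤ kind c then x (X.n + c) • columnVector X.n col c else 0)
            ⟨j, hj⟩ - if kind c < 0 then (y c • columnVector X.n col c) ⟨j, hj⟩ else 0) := by
        refine sum_congr rfl fun c _ => ?_
        by_cases hk : 0 ≤ kind c
        · simp [hk, hk.not_gt, latticeVector, hj, columnVector]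
        · simp [hk, not_le.mp hk, latticeVector, hj, columnVector]
      rw [e2, sum_sub_distrib, hyj]
      simp
      ring
    · simp only [hj, dite_false, add_zero]
      by_cases hjc : j ∈ X.coordinates C kind Set.univ
      · obtain ⟨c, hc, rfl, l, -, hl⟩ := hjc
        rw [sum_eq_single c]
        · have hk : 0 ≤ kind c := by omega
          simp [latticeVector, hk]
        · intro b _ hb
          simp [latticeVector, hb.symm]
        · intro hc'
          exact absurd (mem_range.mpr hc) hc'
      · rw [hx0 j hjc, sum_eq_zero]
        intro c hc
        rw [mem_range] at hc
        simp only [latticeVector, hj, if_false, Pi.smul_apply]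
        have h3 : ¬(j = X.n + c ∧ 0 ≤ kind c) := by
          rintro ⟨rfl, hk⟩
          rcases h.kind_eq c hc with h2 | ⟨l, hl⟩
          · omega
          · exact hjc ⟨c, hc, rfl, l, trivial, hl⟩
        rw [if_neg h3, smul_zero]
  rw [hxe]
  refine add_mem (Submodule.mem_sup_left (sum_mem fun c hc => ?_))
    (Submodule.mem_sup_right (sum_mem fun j hj => ?_))
  · exact Submodule.smul_mem _ _ (Submodule.subset_span ⟨c, by simpa using hc, rfl⟩)
  · exact Submodule.smul_mem _ _ (Submodule.subset_span ⟨j, by simpa using hj, rfl⟩)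

end DecompositionInput

/-! ### A modulus that preserves the splitting behaviour -/

namespace DecompositionInput

open Finset ModuleDecomposition TriangularBasis FaddeevLeVerrier Matrix

/-- The Gram matrix of the rows of the matrix with columns `col c` for `c < C`, weighted by `w`. -/
def gram (C : ℕ) (col : ℕ → ℕ → ℤ) (w : ℕ → ℤ) (i j : ℕ) : ℤ :=
  ∑ c ∈ range C, w c * (col c i * col c j)

/-- The matrix with columns `w c • col c` for `c < C`. -/
def weightedMatrix (n C : ℕ) (col : ℕ → ℕ → ℤ) (w : ℕ → ℤ) : Matrix (Fin n) (Fin C) ℤ :=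
  of fun i c => w c * col c i

/-- The weights are idempotent, so a single factor in the Gram matrix accounts for both copies of
the weighted column. -/
theorem toMatrix_gram {n C : ℕ} {col : ℕ → ℕ → ℤ} {w : ℕ → ℤ} (hw : ∀ c, w c = 0 ∨ w c = 1) :
    toMatrix n (gram C col w) = weightedMatrix n C col w * (weightedMatrix n C col w)ᵀ := by
  ext i j
  simp only [toMatrix, gram, weightedMatrix, of_apply, Matrix.mul_apply, transpose_apply,
    Finset.sum_range]
  refine sum_congr rfl fun c _ => ?_
  rcases hw c with h | h <;> simp [h]

/-- The sum of the squares of all entries. -/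
def sumSquares (n C : ℕ) (col : ℕ → ℕ → ℤ) : ℤ :=
  ∑ c ∈ range C, ∑ i ∈ range n, col c i * col c i

theorem natAbs_mul_le_max (a b : ℤ) : ((a * b).natAbs : ℤ) ≤ max (a * a) (b * b) := by
  rw [Int.natCast_natAbs, abs_mul]
  rcases le_total |a| |b| with h | h
  · exact le_max_of_le_right (by rw [← abs_mul_abs_self b]; gcongr)
  · exact le_max_of_le_left (by rw [← abs_mul_abs_self a]; gcongr)

theorem natAbs_mul_le_sum {n : ℕ} {v : ℕ → ℤ} {i j : ℕ} (hi : i < n) (hj : j < n) :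
    ((v i * v j).natAbs : ℤ) ≤ ∑ i ∈ range n, v i * v i := by
  refine (natAbs_mul_le_max _ _).trans (max_le ?_ ?_)
  · exact single_le_sum (f := fun i => v i * v i) (fun k _ => mul_self_nonneg (v k))
      (mem_range.mpr hi)
  · exact single_le_sum (f := fun i => v i * v i) (fun k _ => mul_self_nonneg (v k))
      (mem_range.mpr hj)

/-- The bound also covers the sums over the first m columns, because the program stores every
partial sum. -/
theorem natAbs_gram_le {n C m : ℕ} {col : ℕ → ℕ → ℤ} {w : ℕ → ℤ} (hw : ∀ c, w c = 0 ∨ w c = 1)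
    (hm : m ≤ C) {i j : ℕ} (hi : i < n) (hj : j < n) :
    ((gram m col w i j).natAbs : ℤ) ≤ sumSquares n C col := by
  calc ((gram m col w i j).natAbs : ℤ) ≤
      ∑ c ∈ range m, ((w c * (col c i * col c j)).natAbs : ℤ) := by
        exact_mod_cast Int.natAbs_sum_le _ _
    _ ≤ ∑ c ∈ range m, ∑ i ∈ range n, col c i * col c i := by
        refine sum_le_sum fun c _ => ?_
        refine le_trans ?_ (natAbs_mul_le_sum (v := col c) hi hj)
        rcases hw c with h | h
        · simp [h, mul_nonneg]
        · simp [h]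
    _ ≤ _ := by
        refine sum_le_sum_of_subset_of_nonneg (range_subset_range.mpr hm) fun c _ _ => ?_
        exact sum_nonneg fun i _ => mul_self_nonneg _

theorem natAbs_entry_le {n C : ℕ} {col : ℕ → ℕ → ℤ} {c i : ℕ} (hc : c < C) (hi : i < n) :
    ((col c i).natAbs : ℤ) ≤ sumSquares n C col := by
  calc ((col c i).natAbs : ℤ) ≤ ((col c i * col c i).natAbs : ℤ) := by
        rw [Int.natAbs_mul]; exact_mod_cast Nat.le_mul_self _
    _ ≤ ∑ i ∈ range n, col c i * col c i := natAbs_mul_le_sum hi hi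
    _ ≤ _ := single_le_sum (f := fun c => ∑ i ∈ range n, col c i * col c i)
        (fun c _ => sum_nonneg fun i _ => mul_self_nonneg _) (mem_range.mpr hc)

/-- The weights of the columns marked by `-1`. -/
def negWeight (kind : ℕ → ℤ) (c : ℕ) : ℤ := if kind c + 1 ≤ 0 then 1 else 0

variable {X : DecompositionInput} {C : ℕ} {col : ℕ → ℕ → ℤ} {kind : ℕ → ℤ}

theorem weightedMatrix_mulVec {n C : ℕ} {col : ℕ → ℕ → ℤ} {w : ℕ → ℤ} {y : ℕ → ℤ}
    {v : Fin C → ℤ} (hv : ∀ c : Fin C, v c = y c) : (weightedMatrix n C col w) *ᵥ v =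
      ∑ c ∈ range C, (w c * y c) • columnVector n col c := by
  funext i
  simp only [Matrix.mulVec, dotProduct, weightedMatrix, of_apply, Finset.sum_range,
    Finset.sum_apply, Pi.smul_apply, columnVector, smul_eq_mul, hv]
  exact sum_congr rfl fun c _ => by ring

theorem mulVec_mem_span_neg (y : Fin C → ℤ) :
    (weightedMatrix X.n C col (negWeight kind)) *ᵥ y ∈
      Submodule.span ℤ (columnVector X.n col ''
        ((range C).filter fun c => kind c < 0 : Finset ℕ)) := by
  rw [weightedMatrix_mulVec (y := fun c => if h : c < C then y ⟨c, h⟩ else 0) fun c => by simp]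
  refine sum_mem fun c hc => ?_
  unfold negWeight
  split_ifs with h
  · exact Submodule.smul_mem _ _ (Submodule.subset_span ⟨c, by
      simp only [coe_filter, mem_range, Set.mem_ofPred_eq] at hc ⊢; exact ⟨hc, by omega⟩, rfl⟩)
  all_goals simp

theorem exists_mulVec_eq_of_mem_span_neg {v : Fin X.n → ℤ}
    (hv : v ∈ Submodule.span ℤ (columnVector X.n col ''
        ((range C).filter fun c => kind c < 0 : Finset ℕ))) :
    ∃ y, (weightedMatrix X.n C col (negWeight kind)) *ᵥ y = v := by
  obtain ⟨y, rfl⟩ := Submodule.mem_span_image_finset_iff_exists_fun' ℤ |>.mp hv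
  refine ⟨fun c => y c, ?_⟩
  rw [weightedMatrix_mulVec fun _ => rfl, sum_filter]
  refine sum_congr rfl fun c _ => ?_
  unfold negWeight
  by_cases h : kind c < 0
  · rw [if_pos (by omega), if_pos h, one_mul]
  · rw [if_neg (by omega), if_neg h, zero_mul, zero_smul]

/-- The weights of the columns of the relations and of the members of the family. -/
def mainWeight (n : ℕ) (kind : ℕ → ℤ) (c : ℕ) : ℤ := if c < n ∨ 0 ≤ kind c then 1 else 0

/-- The A_i generate A, so the generators of the family and the relations together generate ℤⁿ. -/
theorem exists_mainWeight_mulVec_eq (h : X.IsColumns C col kind) (ht : iSup X.family = ⊤)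
    (v : Fin X.n → ℤ) : ∃ y, (weightedMatrix X.n C col (mainWeight X.n kind)) *ᵥ y = v := by
  obtain ⟨x, hx⟩ := exists_combination_eq h ht (X.toGroup v)
  have h1 : v - ∑ c ∈ range C, (if 0 ≤ kind c then x (X.n + c) • columnVector X.n col c else 0) ∈
      LinearMap.range X.relations.mulVecLin := by
    rw [← toGroup_eq_zero_iff, map_sub, sub_eq_zero, ← hx, map_sum, combination]
    refine sum_congr rfl fun c _ => ?_
    split_ifs
    · exact (map_smul _ _ _).symm
    · exact (map_zero _).symm
  rw [← h.span_relations, Submodule.mem_span_image_finset_iff_exists_fun'] at h1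
  obtain ⟨y, hy⟩ := h1
  refine ⟨fun c => if 0 ≤ kind c then x (X.n + c) else y c, ?_⟩
  rw [weightedMatrix_mulVec (y := fun c => if 0 ≤ kind c then x (X.n + c) else y c) fun _ => rfl]
  rw [eq_sub_iff_add_eq, sum_filter, ← sum_add_distrib] at hy
  rw [← hy]
  refine sum_congr rfl fun c hc => ?_
  rw [mem_range] at hc
  unfold mainWeight
  by_cases hk : 0 ≤ kind c
  · have hcn : ¬c < X.n := fun hcn => by have := h.kind_of_lt c hc hcn; omega
    simp [hk, hcn]
  · by_cases hcn : c < X.n <;> simp [hk, hcn]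

theorem natAbs_mulVec_le {m n β x y : ℕ} {A : Matrix (Fin m) (Fin n) ℤ} {v : Fin n → ℤ}
    (hn : n ≤ β) (hA : ∀ i j, (A i j).natAbs ≤ β ^ x) (hv : ∀ j, (v j).natAbs ≤ β ^ y)
    (i : Fin m) : ((A *ᵥ v) i).natAbs ≤ β ^ (x + y + 1) := by
  change (∑ j, A i j * v j).natAbs ≤ _
  refine (natAbs_sum_le univ _ (b := β ^ x * β ^ y) fun j _ => ?_).trans ?_
  · rw [Int.natAbs_mul]
    exact Nat.mul_le_mul (hA i j) (hv j)
  · rw [card_univ, Fintype.card_fin, pow_succ', pow_add]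
    exact Nat.mul_le_mul_right _ hn

/-- The modulus for a bound `β` for the size of the input. -/
def modulus (n C : ℕ) (col : ℕ → ℕ → ℤ) (kind : ℕ → ℤ) (β : ℤ) : ℤ :=
  lastNonzero n (gram C col (negWeight kind)) n * lastNonzero n (gram C col (negWeight kind)) n *
    β ^ (20 * (n + 1))

/-- It is enough to treat generators of B, whose components have small multiples by an integral form
of Cramer's rule. Membership of such a component in B + NA forces membership in B, because Φ maps
its small multiple to a vector that is both small and highly divisible. -/
theorem splits_of_splits_modSubgroup (h : X.IsColumns C col kind)
    (hdec : IsDecomposition X.family) {β : ℕ} (hβ : 2 ≤ β) (hn : X.n ≤ β) (hC : C ≤ β)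
    (hsq : sumSquares X.n C col ≤ β) {T : Set (Fin X.r)}
    (hT : ∀ b ∈ X.subgroup, ∃ p ∈ part X.family T, ∃ q ∈ part X.family Tᶜ, b = p + q ∧
      p ∈ X.modSubgroup (modulus X.n C col kind β)) : Splits X.family X.subgroup T := by
  obtain ⟨hind, htop⟩ := isDecomposition_iff.mp hdec
  have hw1 : ∀ c, negWeight kind c = 0 ∨ negWeight kind c = 1 := fun c => by
    unfold negWeight; split_ifs <;> simp
  have hw2 : ∀ c, mainWeight X.n kind c = 0 ∨ mainWeight X.n kind c = 1 := fun c => by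
    unfold mainWeight; split_ifs <;> simp
  have hent : ∀ c < C, ∀ i < X.n, (col c i).natAbs ≤ β := fun c hc i hi => by
    exact_mod_cast (natAbs_entry_le hc hi).trans hsq
  have hgram : ∀ w : ℕ → ℤ, (∀ c, w c = 0 ∨ w c = 1) → ∀ i < X.n, ∀ j < X.n,
      (gram C col w i j).natAbs ≤ β := fun w hw i hi j hj => by
    exact_mod_cast (natAbs_gram_le hw le_rfl hi hj).trans hsq
  have hmat : ∀ w : ℕ → ℤ, (∀ c, w c = 0 ∨ w c = 1) → ∀ i c,
      (weightedMatrix X.n C col w i c).natAbs ≤ β := fun w hw i c => by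
    have := hent c c.2 i i.2
    simp only [weightedMatrix, of_apply]
    rcases hw c with h | h <;> simp [h, this]
  obtain ⟨ht1, Φ, Z, e1, hΦ, bΦ, -⟩ := exists_generalized_inverse hβ hn (hgram _ hw1) _
    (hmat _ hw1) (toMatrix_gram hw1)
  obtain ⟨ht2, Φ', Z', e2, hΦ', -, bZ'⟩ := exists_generalized_inverse hβ hn (hgram _ hw2) _
    (hmat _ hw2) (toMatrix_gram hw2)
  unfold modulus at hT
  generalize lastNonzero X.n (gram C col (negWeight kind)) X.n = t at *
  generalize lastNonzero X.n (gram C col (mainWeight X.n kind)) X.n = t' at *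
  set H := weightedMatrix X.n C col (negWeight kind) with hH
  set K := weightedMatrix X.n C col (mainWeight X.n kind) with hK
  -- Φ' vanishes on the columns of K, and these generate ℤⁿ, so Φ' = 0 and t'·1 = KZ'.
  have hK0 : ∀ v, Φ' *ᵥ v = 0 := by
    intro v
    obtain ⟨y, hy⟩ := exists_mainWeight_mulVec_eq h htop v
    rw [← hy, Matrix.mulVec_mulVec, ← hK, hΦ', Matrix.zero_mulVec]
  have hB : Submodule.span ℤ ((fun c => X.toGroup (columnVector X.n col c)) ''
      ((range C).filter fun c => kind c < 0 : Finset ℕ)) = X.subgroup := by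
    apply le_antisymm
    · rw [Submodule.span_le]
      rintro _ ⟨c, hc, rfl⟩
      simp only [coe_filter, mem_range, Set.mem_ofPred_eq] at hc
      exact column_mem_subgroup h hc.1 hc.2
    · intro b hb
      obtain ⟨v, rfl⟩ := toGroup_surjective b
      rw [toGroup_mem_subgroup_iff h, Submodule.mem_span_image_finset_iff_exists_fun'] at hb
      obtain ⟨y, rfl⟩ := hb
      rw [map_sum]
      exact sum_mem fun c hc => by
        rw [map_smul]; exact Submodule.smul_mem _ _ (Submodule.subset_span ⟨c, hc, rfl⟩)
  refine splits_of_span hB ?_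
  rintro _ ⟨c₀, hc₀, rfl⟩
  simp only [coe_filter, mem_range, Set.mem_ofPred_eq] at hc₀
  obtain ⟨p, hp, q, hq, hpq, hpN⟩ := hT _ (column_mem_subgroup h hc₀.1 hc₀.2)
  refine ⟨p, hp, q, hq, hpq, ?_⟩
  set v := columnVector X.n col c₀ with hv
  set y := Z' *ᵥ v with hy
  -- The exponent is 6n + 2 for Z', 1 for the entries of v and 1 for the number of summands.
  have by' : ∀ c, (y c).natAbs ≤ β ^ (6 * X.n + 4) := natAbs_mulVec_le (y := 1) hn bZ'
    (fun i => by rw [pow_one]; exact hent c₀ hc₀.1 i i.2)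
  -- the coordinates of `t' • v`, extended by zero
  set x : ℕ → ℤ := fun j => if hj : j - X.n < C then y ⟨j - X.n, hj⟩ else 0 with hx
  have hxc : ∀ c (hc : c < C), x (X.n + c) = y ⟨c, hc⟩ := fun c hc => by simp [hx, hc]
  have hKv : t' • v = ∑ c ∈ range C,
      (mainWeight X.n kind c * x (X.n + c)) • columnVector X.n col c := by
    have e3 : t' • v = (t' • (1 : Matrix (Fin X.n) (Fin X.n) ℤ)) *ᵥ v := by
      rw [Matrix.smul_mulVec, Matrix.one_mulVec]
    have e4 : ∀ c : Fin C, y c = (fun c : ℕ => x (X.n + c)) c := fun c => (hxc c c.2).symm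
    rw [e3, e2, Matrix.add_mulVec, hK0, zero_add, ← Matrix.mulVec_mulVec, ← hy, hK,
      weightedMatrix_mulVec (y := fun c => x (X.n + c)) e4]
  have hcomb : X.combination C col kind x = t' • X.toGroup v := by
    rw [← map_smul, hKv, map_sum, combination]
    refine sum_congr rfl fun c hc => ?_
    rw [mem_range] at hc
    rw [map_smul]
    by_cases hk : 0 ≤ kind c
    · simp only [hk, if_true, mainWeight, or_true, one_mul]
    · by_cases hcn : c < X.n
      · have : X.toGroup (columnVector X.n col c) = 0 := by
          rw [toGroup_eq_zero_iff, ← h.span_relations]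
          exact Submodule.subset_span ⟨c, by simp [hc, hcn], rfl⟩
        rw [if_neg hk, this, smul_zero]
      · simp [hk, mainWeight, hcn]
  set z := (X.coordinates C kind T).indicator x with hz
  -- Both sides are the component over T of t'·v in the direct sum decomposition of A.
  have hp' : t' • p = X.combination C col kind z := by
    refine (eq_of_add_eq_add hind disjoint_compl_right (Submodule.smul_mem _ t' hp)
      (combination_indicator_mem_part h T x) (Submodule.smul_mem _ t' hq)
      (combination_sub_indicator_mem_part h T x) ?_).1
    rw [← smul_add, ← hpq, ← combination_add, add_sub_cancel, hcomb]
  -- a small vector that represents `t' • p`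
  set f : Fin X.n → ℤ := ∑ c ∈ range C,
    (if 0 ≤ kind c then z (X.n + c) else 0) • columnVector X.n col c with hf
  have hfp : X.toGroup f = t' • p := by
    rw [hp', hf, map_sum, combination]
    refine sum_congr rfl fun c _ => ?_
    rw [map_smul]
    split_ifs <;> simp
  have bf : ∀ i, (f i).natAbs ≤ β ^ (6 * X.n + 6) := by
    intro i
    rw [hf, Finset.sum_apply]
    refine (natAbs_sum_mul_le (x := 6 * X.n + 4) (y := 1) hC (fun c hc => ?_)
      (fun c hc => ?_)).trans (Nat.pow_le_pow_right (by omega) (by omega))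
    · split_ifs
      · by_cases hcT : X.n + c ∈ X.coordinates C kind T
        · rw [hz, Set.indicator_of_mem hcT, hxc c hc]
          exact by' _
        · rw [hz, Set.indicator_of_notMem hcT]
          simp
      · simp
    · rw [pow_one]
      exact hent c hc i i.2
  -- The product is at most β^((6n + 3) + (6n + 6) + 1), which explains the exponent 20(n + 1) in
  -- the modulus.
  have bΦf : ∀ i, ((Φ *ᵥ f) i).natAbs < β ^ (20 * (X.n + 1)) := by
    intro i
    refine (natAbs_mulVec_le hn bΦ bf i).trans_lt (Nat.pow_lt_pow_right (by omega) (by omega))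
  have hΦspan : ∀ w ∈ Submodule.span ℤ (columnVector X.n col ''
      ((range C).filter fun c => kind c < 0 : Finset ℕ)), Φ *ᵥ w = 0 := by
    intro w hw
    obtain ⟨y, rfl⟩ := exists_mulVec_eq_of_mem_span_neg hw
    rw [Matrix.mulVec_mulVec, ← hH, hΦ, Matrix.zero_mulVec]
  obtain ⟨b, hb, a, hpa⟩ := mem_modSubgroup.mp hpN
  obtain ⟨e, rfl⟩ := toGroup_surjective p
  obtain ⟨α, rfl⟩ := toGroup_surjective a
  set N := t * t * (β : ℤ) ^ (20 * (X.n + 1)) with hN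
  have hβ0 : (β : ℤ) ^ (20 * (X.n + 1)) ≠ 0 := pow_ne_zero _ (by omega)
  have hN0 : N ≠ 0 := mul_ne_zero (mul_ne_zero ht1 ht1) hβ0
  have h1 : e - N • α ∈ Submodule.span ℤ (columnVector X.n col ''
      ((range C).filter fun c => kind c < 0 : Finset ℕ)) := by
    rw [← toGroup_mem_subgroup_iff h, map_sub, map_smul, hpa, add_sub_cancel_right]
    exact hb
  have h2 : t' • e - f ∈ Submodule.span ℤ (columnVector X.n col ''
      ((range C).filter fun c => kind c < 0 : Finset ℕ)) := by
    rw [← toGroup_mem_subgroup_iff h, map_sub, map_smul, hfp, sub_self]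
    exact zero_mem _
  -- Φ kills the preimage of B, so it sees only the part of e that is divisible by N.
  have h3 : Φ *ᵥ e = N • (Φ *ᵥ α) := by
    have := hΦspan _ h1
    rwa [Matrix.mulVec_sub, Matrix.mulVec_smul, sub_eq_zero] at this
  have h4 : Φ *ᵥ f = t' • (Φ *ᵥ e) := by
    have := hΦspan _ h2
    rw [Matrix.mulVec_sub, Matrix.mulVec_smul, sub_eq_zero] at this
    exact this.symm
  -- By `h3` and `h4` the vector is t'N·Φα, so its entries are divisible by the power of β in N,
  -- which they do not reach in absolute value.
  have h5 : Φ *ᵥ f = 0 := by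
    funext i
    refine Int.eq_zero_of_abs_lt_dvd (m := (β : ℤ) ^ (20 * (X.n + 1))) ?_ ?_
    · rw [h4, h3]
      simp only [Pi.smul_apply, smul_eq_mul, hN]
      exact ⟨t' * (t * t * (Φ *ᵥ α) i), by ring⟩
    · have := bΦf i
      rw [Int.abs_eq_natAbs]
      exact_mod_cast this
  have h6 : Φ *ᵥ α = 0 := by
    rw [h4, h3] at h5
    exact (smul_eq_zero.mp ((smul_eq_zero.mp h5).resolve_left ht2)).resolve_left hN0
  rw [toGroup_mem_subgroup_iff h, ← sub_add_cancel e (N • α)]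
  refine add_mem h1 ?_
  -- As Φα = 0, the identity t·1 = Φ + HZ puts tα into the span of the columns of H. Since t divides
  -- N, also Nα lies there.
  have h7 : t • α = H *ᵥ (Z *ᵥ α) := by
    have e3 : t • α = (t • (1 : Matrix (Fin X.n) (Fin X.n) ℤ)) *ᵥ α := by
      rw [Matrix.smul_mulVec, Matrix.one_mulVec]
    rw [e3, e1, Matrix.add_mulVec, h6, zero_add, ← Matrix.mulVec_mulVec]
  have h8 : N • α = (t * (β : ℤ) ^ (20 * (X.n + 1))) • (t • α) := by
    rw [smul_smul, hN]; congr 1; ring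
  rw [h8, h7]
  exact Submodule.smul_mem _ _ (mulVec_mem_span_neg _)

/-- The subgroup splits along a set of members of the family if and only if no non-zero entry of
the Hermite normal form of the lattice links a member in the set with one outside. -/
theorem splits_iff (h : X.IsColumns C col kind)
    (hdec : IsDecomposition X.family) {β : ℕ} (hβ : 2 ≤ β) (hn : X.n ≤ β) (hC : C ≤ β)
    (hsq : sumSquares X.n C col ≤ β) {W : ℕ → ℕ → ℤ} (hW : IsTriangular (X.n + C) W)
    (hred : ∀ j < X.n + C, ∀ i < j, 0 ≤ W i j ∧ W i j < W j j)
    (hspan : tail (X.n + C) W 0 = lattice X.n C col kind (modulus X.n C col kind β))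
    (T : Set (Fin X.r)) : Splits X.family X.subgroup T ↔
      ∀ a < C, ∀ c < C, W (X.n + a) (X.n + c) ≠ 0 →
        ((∃ l ∈ T, kind a = (l : ℕ)) ↔ ∃ l ∈ T, kind c = (l : ℕ)) := by
  obtain ⟨hind, htop⟩ := isDecomposition_iff.mp hdec
  have hcoord : ∀ c < C, (X.n + c ∈ X.coordinates C kind T ↔ ∃ l ∈ T, kind c = (l : ℕ)) := by
    intro c hc
    constructor
    · rintro ⟨c', -, e, l, hl, hk⟩
      obtain rfl : c = c' := by omega
      exact ⟨l, hl, hk⟩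
    · rintro ⟨l, hl, hk⟩
      exact ⟨c, hc, rfl, l, hl, hk⟩
  have hsub : X.coordinates C kind T ⊆ X.coordinates C kind Set.univ := by
    rintro _ ⟨c, hc, rfl, l, -, hk⟩
    exact ⟨c, hc, rfl, l, trivial, hk⟩
  trans (∀ x ∈ tail (X.n + C) W 0, (∀ j < X.n, x j = 0) →
    (X.coordinates C kind T).indicator x ∈ tail (X.n + C) W 0)
  · rw [hspan]
    constructor
    -- The combination of x has the form b + Na. Both b and a split along T, and uniqueness
    -- identifies the component over T with the combination of the projection of x.
    · intro hS x hx hx0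
      refine mem_lattice_of_combination_mem h ?_ fun j hj => Set.indicator_of_notMem
        (fun hj' => hj (hsub hj')) _
      obtain ⟨b, hb, a, e⟩ := mem_modSubgroup.mp (combination_mem_modSubgroup h hx hx0)
      obtain ⟨p, hp, q, hq, rfl, hpB⟩ := hS b hb
      obtain ⟨a₁, ha₁, a₂, ha₂, rfl⟩ := exists_part_add htop T a
      have := (eq_of_add_eq_add hind disjoint_compl_right
        (combination_indicator_mem_part h T x)
        (add_mem hp (Submodule.smul_mem _ (modulus X.n C col kind β) ha₁))
        (combination_sub_indicator_mem_part h T x)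
        (add_mem hq (Submodule.smul_mem _ (modulus X.n C col kind β) ha₂)) (by
          rw [← combination_add, add_sub_cancel, e, smul_add]; abel)).1
      rw [this]
      exact mem_modSubgroup.mpr ⟨p, hpB, a₁, rfl⟩
    -- An element b of B is represented by a lattice vector x supported on the family coordinates.
    -- Stability under the projection gives a component in B + NA only; the choice of the modulus
    -- improves this to B.
    · intro hS
      refine splits_of_splits_modSubgroup h hdec hβ hn hC hsq fun b hb => ?_
      obtain ⟨x', hx'⟩ := exists_combination_eq h htop b
      set x := (X.coordinates C kind Set.univ).indicator x' with hx
      have hxb : X.combination C col kind x = b := by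
        rw [hx, combination_indicator_univ h, hx']
      have hx0 : ∀ j, j ∉ X.coordinates C kind Set.univ → x j = 0 := fun j hj =>
        Set.indicator_of_notMem hj _
      have hxL : x ∈ lattice X.n C col kind (modulus X.n C col kind β) :=
        mem_lattice_of_combination_mem h (hxb ▸ mem_modSubgroup.mpr ⟨b, hb, 0, by simp⟩) hx0
      have hlt : ∀ j < X.n, x j = 0 := fun j hj => hx0 j (by rintro ⟨c, _, e, -⟩; omega)
      refine ⟨_, combination_indicator_mem_part h T x, _,
        combination_sub_indicator_mem_part h T x, ?_, ?_⟩
      · rw [← combination_add, add_sub_cancel, hxb]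
      · refine combination_mem_modSubgroup h (hS x hxL hlt) fun j hj => ?_
        by_cases hjT : j ∈ X.coordinates C kind T
        · rw [Set.indicator_of_mem hjT, hlt j hj]
        · exact Set.indicator_of_notMem hjT _
  · rw [indicator_mem_iff hW hred]
    constructor
    · intro hE a ha c hc hac
      rw [← hcoord a ha, ← hcoord c hc]
      exact hE _ _ (by omega) (by omega) (by omega) (by omega) hac
    · intro hE a c hna ha hnc hc hac
      obtain ⟨a, rfl⟩ := Nat.exists_eq_add_of_le hna
      obtain ⟨c, rfl⟩ := Nat.exists_eq_add_of_le hnc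
      rw [hcoord a (by omega), hcoord c (by omega)]
      exact hE a (by omega) c (by omega) hac

end DecompositionInput

/-! ### Correctness of the computation of the modulus -/

namespace RandomAccess

open Finset DecompositionInput FaddeevLeVerrier RandomAccess.Program RandomAccess.Expr

/-- The input is registered in the memory: there are `C` columns `col c` of length `n`,
marked by `kind c`, and the family has `r` members. -/
structure Loaded (n C r : ℕ) (col : ℕ → ℕ → ℤ) (kind : ℕ → ℤ) (μ : Memory) : Prop where
  n_eq : μ vN 0 = n
  C_eq : μ vC 0 = C
  r_eq : μ vR 0 = r
  col_eq : ∀ c i : ℕ, μ 0 (μ aBase c + i * μ aStr c) = col c i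
  kind_eq : ∀ c : ℕ, μ aKind c = kind c

variable {V Z n C r : ℕ} {col : ℕ → ℕ → ℤ} {kind : ℕ → ℤ} {μ ν : Memory} {Q : Memory → Prop}

theorem Loaded.agree (h : Loaded n C r col kind μ) {l : List ℕ} (hag : AgreeOff l μ ν)
    (hl : ∀ a ∈ [0, vN, vC, vR, aBase, aStr, aKind], a ∉ l) : Loaded n C r col kind ν := by
  have h0 := hag 0 (hl 0 (by decide))
  have h1 := hag vN (hl vN (by decide))
  have h2 := hag vC (hl vC (by decide))
  have h3 := hag vR (hl vR (by decide))
  have h4 := hag aBase (hl aBase (by decide))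
  have h5 := hag aStr (hl aStr (by decide))
  have h6 := hag aKind (hl aKind (by decide))
  exact ⟨h1 ▸ h.n_eq, h2 ▸ h.C_eq, h3 ▸ h.r_eq, by rw [h0, h4, h5]; exact h.col_eq,
    by rw [h6]; exact h.kind_eq⟩

theorem Loaded.value_col (h : Loaded n C r col kind μ) {e f : Expr} {c i : ℕ}
    (he : e.value μ = c) (hf : f.value μ = i) : (Expr.col e f).value μ = col c i := by
  simp only [Expr.col, value_read, value_add, value_mul, he, hf]
  exact h.col_eq c i

/-- The program runs double loops as single loops whose variable encodes both indices by quotient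
and remainder. -/
theorem sum_range_mul_div_mod {α : Type*} [AddCommMonoid α] (f : ℕ → ℕ → α) (a b : ℕ) :
    ∑ x ∈ range (a * b), f (x / b) (x % b) = ∑ i ∈ range a, ∑ j ∈ range b, f i j := by
  induction a with
  | zero => simp
  | succ a ih =>
    rw [Nat.succ_mul, sum_range_add, ih, sum_range_succ]
    congr 1
    refine sum_congr rfl fun j hj => ?_
    rw [mem_range] at hj
    rw [mul_comm, Nat.mul_add_div (by omega), Nat.mul_add_mod, Nat.div_eq_of_lt hj,
      Nat.mod_eq_of_lt hj, add_zero]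

theorem mul_add_div_mod {n i j : ℕ} (hj : j < n) :
    (i * n + j) / n = i ∧ (i * n + j) % n = j := by
  rw [mul_comm, Nat.mul_add_div (by omega), Nat.mul_add_mod, Nat.div_eq_of_lt hj,
    Nat.mod_eq_of_lt hj, add_zero]
  exact ⟨rfl, rfl⟩

theorem mul_add_lt {n m i j : ℕ} (hi : i < m) (hj : j < n) : i * n + j < m * n := by
  have : (i + 1) * n ≤ m * n := Nat.mul_le_mul_right n hi
  rw [add_mul, one_mul] at this
  omega

/-- The weights of the columns after which the data of the algorithm are sized. -/
def size (n C r : ℕ) (col : ℕ → ℕ → ℤ) : ℤ := 2 + n + C + r + sumSquares n C col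

theorem sumSquares_nonneg (n C : ℕ) (col : ℕ → ℕ → ℤ) : 0 ≤ sumSquares n C col :=
  sum_nonneg fun _ _ => sum_nonneg fun _ _ => mul_self_nonneg _

theorem total_computeBeta (h : Loaded n C r col kind μ) (hZ : C * n ≤ Z) (hZV : Z ≤ V)
    (hV : size n C r col ≤ V)
    (hQ : ∀ ν, AgreeOff computeBeta.writes μ ν → ν vBeta 0 = size n C r col → Q ν) :
    Total V computeBeta μ Q (Z * 3 + 3 + 1) := by
  have hs := sumSquares_nonneg n C col
  refine Total.mono (Q := fun ν => ν vBeta 0 = size n C r col) ?_ le_rfl hQ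
  have hsum : ∑ x ∈ range (C * n), col (x / n) (x % n) * col (x / n) (x % n) =
      sumSquares n C col := sum_range_mul_div_mod (fun c i => col c i * col c i) C n
  refine Total.seq (Total.sumLoop (h := C * n)
    (fun x => col (x / n) (x % n) * col (x / n) (x % n)) (by decide) (by omega) hZ ?_ ?_ ?_ ?_)
  · intro ν hν
    have := h.agree hν (by decide)
    simp [this.n_eq, this.C_eq]
  · intro k _ ν hν hk
    have hL := h.agree hν (by decide)
    have e1 : (var vt / var vN).value ν = ((k / n : ℕ) : ℤ) := by simp [hk, hL.n_eq]
    have e2 : (var vt % var vN).value ν = ((k % n : ℕ) : ℤ) := by simp [hk, hL.n_eq]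
    rw [value_mul, hL.value_col e1 e2]
  · intro k hk
    have h1 : 0 ≤ ∑ x ∈ range k, col (x / n) (x % n) * col (x / n) (x % n) :=
      sum_nonneg fun _ _ => mul_self_nonneg _
    have h2 : ∑ x ∈ range k, col (x / n) (x % n) * col (x / n) (x % n) ≤
        ∑ x ∈ range (C * n), col (x / n) (x % n) * col (x / n) (x % n) :=
      sum_le_sum_of_subset_of_nonneg (range_subset_range.mpr hk)
        fun _ _ _ => mul_self_nonneg _
    rw [hsum] at h2
    unfold size at hV
    omega
  · intro ν hν hsν hν'
    have hL := h.agree hν (by decide)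
    have e : (2 + var vN + var vC + var vR + var vSum).value ν = size n C r col := by
      simp [hL.n_eq, hL.C_eq, hL.r_eq, hsν, hsum, size]
    refine Total.set ?_ ?_
    · rw [e]
      unfold size at hV ⊢
      omega
    · rw [e, write_same]

theorem total_computeGram (h : Loaded n C r col kind μ) (hZ : n * n ≤ Z) (hC : C ≤ Z)
    (hZV : Z ≤ V) (hV : sumSquares n C col ≤ V)
    (hQ : ∀ ν, AgreeOff computeGram.writes μ ν →
      (∀ i < n, ∀ j < n, ν aGram (i * n + j : ℕ) = gram C col (negWeight kind) i j) → Q ν) :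
    Total V computeGram μ Q (Z * (Z * 3 + 3 + 3) + 2) := by
  refine Total.mono (Q := fun ν => ∀ i < n, ∀ j < n,
    ν aGram (i * n + j : ℕ) = gram C col (negWeight kind) i j) ?_ le_rfl hQ
  have hw1 : ∀ c, negWeight kind c = 0 ∨ negWeight kind c = 1 := fun c => by
    unfold negWeight; split_ifs <;> simp
  have hb : ∀ m ≤ C, ∀ k < n * n,
      (gram m col (negWeight kind) (k / n) (k % n)).natAbs ≤ V := by
    intro m hm k hk
    have hn : 0 < n := Nat.pos_of_ne_zero (by rintro rfl; simp at hk)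
    have := natAbs_gram_le (n := n) (col := col) hw1 hm (Nat.div_lt_of_lt_mul hk) (Nat.mod_lt k hn)
    omega
  refine Total.fill (l := 0) (h := n * n) (o' := 0)
    (fun x => gram C col (negWeight kind) (x / n) (x % n)) (by simp) (by omega) (by omega) hZ ?_
    (by decide) (by decide) (by decide) ?_ ?_ ?_
  · intro ν hν
    have := h.agree hν (by decide)
    simp [this.n_eq]
  · intro k ν _ hk hν hkν _
    have hL := h.agree hν (by decide)
    refine Total.sumLoop (h := C) (fun c => negWeight kind c * (col c (k / n) * col c (k % n)))
      (by decide) (by omega) hC ?_ ?_ ?_ ?_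
    · intro ρ hρ
      simp [(hL.agree hρ (by decide)).C_eq]
    · intro c _ ρ hρ hc
      have hL' := hL.agree hρ (by decide)
      have hk' : ρ vt 0 = k := by rw [hρ vt (by decide), hkν]
      have e0 : (var vc).value ρ = c := by simp [hc]
      have e1 : (var vt / var vN).value ρ = ((k / n : ℕ) : ℤ) := by simp [hk', hL'.n_eq]
      have e2 : (var vt % var vN).value ρ = ((k % n : ℕ) : ℤ) := by simp [hk', hL'.n_eq]
      rw [value_mul, value_mul, hL'.value_col e0 e1, hL'.value_col e0 e2]
      simp [hc, hL'.kind_eq, negWeight]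
    · intro m hm
      exact hb m hm k hk
    · intro ρ hρ hs
      exact ⟨by simp, hs⟩
  · intro k _ hk
    exact hb C le_rfl k hk
  · intro ν hν hf _ i hi j hj
    have := hf (i * n + j) (by omega) (mul_add_lt hi hj)
    simp only [zero_add, (mul_add_div_mod hj).1, (mul_add_div_mod hj).2] at this
    exact this

end RandomAccess

/-! ### Verification of the Faddeev–LeVerrier program and of the modulus -/

namespace RandomAccess

open Finset DecompositionInput FaddeevLeVerrier RandomAccess.Program RandomAccess.Expr

variable {V Z n C r : ℕ} {col : ℕ → ℕ → ℤ} {kind : ℕ → ℤ} {μ ν : Memory} {Q : Memory → Prop}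

/-- The steps of the Faddeev–LeVerrier program. -/
def leverrierSteps (Z : ℕ) : ℕ :=
  1 + (1 + (Z * ((Z * (Z * 3 + 3 + 3) + 2) + ((Z * (1 + 3) + 2) + ((Z * 3 + 3) +
    (1 + (1 + 1)))) + 2) + 2))

theorem total_leverrierProgram {A : ℕ → ℕ → ℤ} {β : ℕ} (hn : μ vN 0 = n)
    (hA : ∀ i < n, ∀ j < n, μ aGram (i * n + j : ℕ) = A i j) (hM : ∀ x, μ aM x = 0)
    (hZ : n * n ≤ Z) (hZV : Z ≤ V) (hβ : 2 ≤ β) (hnβ : n ≤ β)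
    (hAβ : ∀ i < n, ∀ j < n, (A i j).natAbs ≤ β) (hV : β ^ (6 * n + 6) ≤ V)
    (hQ : ∀ ν, AgreeOff leverrierProgram.writes μ ν → ν vT 0 = lastNonzero n A n → Q ν) :
    Total V leverrierProgram μ Q (leverrierSteps Z) := by
  have hnZ : n ≤ Z := (Nat.le_mul_self n).trans hZ
  have hb := natAbs_step_le hβ hnβ hAβ
  have hpow : ∀ m, m ≤ 6 * n + 6 → β ^ m ≤ V := fun m hm =>
    (Nat.pow_le_pow_right (by omega) hm).trans hV
  have hV1 : 1 ≤ V := (Nat.one_le_pow _ _ (by omega)).trans hV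
  have hdm : ∀ k < n * n, k / n < n ∧ k % n < n := by
    intro k hk
    have hn : 0 < n := Nat.pos_of_ne_zero (by rintro rfl; simp at hk)
    exact ⟨Nat.div_lt_of_lt_mul hk, Nat.mod_lt k hn⟩
  have hcell : ∀ i j : ℕ, (i : ℤ) * n + j = ((i * n + j : ℕ) : ℤ) := fun i j => by push_cast; rfl
  refine Total.mono (Q := fun ν => ν vT 0 = lastNonzero n A n) ?_ le_rfl hQ
  refine Total.seq (Total.set (by simpa using hV1) fun hag1 => ?_)
  refine Total.seq (Total.set (by simpa using hV1) fun hag2 => ?_)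
  have hag := (hag1.mono (l' := [vCoeff, vT]) (by decide)).trans
    (hag2.mono (l' := [vCoeff, vT]) (by decide))
  refine Total.forLoop (l := 0) (h := n) (fun k ν =>
    (∀ i < n, ∀ j < n, ν aM (i * n + j : ℕ) = (step n A k).1 i j) ∧
    ν vCoeff 0 = (step n A k).2 ∧ ν vT 0 = lastNonzero n A k)
    (by simp) (by omega) (by omega) (by omega) ?_ (by decide) ?_ ?_ ?_
  · intro ν hν
    simp [hν vN (by decide), hn]
  · refine ⟨fun i _ j _ => ?_, ?_, ?_⟩
    · simp [hM, step]
    · simp [step]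
    · simp [lastNonzero]
  · rintro k ν - hk hν hik ⟨hI1, hI2, hI3⟩
    have hnν : ν vN 0 = n := by rw [hν vN (by decide), hag vN (by decide), hn]
    have hAν : ∀ i < n, ∀ j < n, ν aGram (i * n + j : ℕ) = A i j := by
      intro i hi j hj
      rw [hν aGram (by decide), hag aGram (by decide), hA i hi j hj]
    -- The new matrix is built in a scratch array, because the old one is still read for every
    -- entry, and is copied afterwards.
    refine Total.seq (Total.fill (l := 0) (h := n * n) (o' := 0)
      (fun x => (step n A (k + 1)).1 (x / n) (x % n)) (by simp) (by omega) (by omega) hZ ?_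
      (by decide) (by decide) (by decide) ?_ ?_ ?_)
    · intro ρ hρ
      simp [hρ vN (by decide), hnν]
    · intro x ρ _ hx hρ hxρ _
      obtain ⟨hx1, hx2⟩ := hdm x hx
      refine Total.sumLoop (h := n) (fun l => A (x / n) l * (step n A k).1 l (x % n))
        (by decide) (by omega) hnZ ?_ ?_ ?_ ?_
      · intro σ hσ
        simp [hσ vN (by decide), hρ vN (by decide), hnν]
      · intro l hl σ hσ hlσ
        have e1 : σ vt 0 = x := by rw [hσ vt (by decide), hxρ]
        have e2 : σ vN 0 = n := by rw [hσ vN (by decide), hρ vN (by decide), hnν]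
        have e3 : σ aGram = ν aGram := by rw [hσ aGram (by decide), hρ aGram (by decide)]
        have e4 : σ aM = ν aM := by rw [hσ aM (by decide), hρ aM (by decide)]
        simp only [value_mul, value_read, value_add, value_div, value_mod, value_var, e1, e2, hlσ,
          e3, e4, ← Int.natCast_div, ← Int.natCast_mod, hcell]
        rw [hAν _ hx1 _ hl, hI1 _ hl _ hx2]
      · intro m hm
        exact (natAbs_sum_mul_le (x := 1) (y := 6 * k) (hm.trans hnβ)
          (fun l hl => by simpa using hAβ _ hx1 l (by omega))
          (fun l hl => (hb k).1 l (by omega) _ hx2)).trans (hpow _ (by omega))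
      · intro σ hσ hs
        have e1 : σ vt 0 = x := by rw [hσ vt (by decide), hxρ]
        have e2 : σ vN 0 = n := by rw [hσ vN (by decide), hρ vN (by decide), hnν]
        have e3 : σ vCoeff 0 = (step n A k).2 := by
          rw [hσ vCoeff (by decide), hρ vCoeff (by decide), hI2]
        refine ⟨by simp, ?_⟩
        simp only [value_mul, value_add, value_div, value_mod, value_var, value_eq, e1, e2, e3, hs,
          ← Int.natCast_div, ← Int.natCast_mod, Nat.cast_inj, step]
    · intro x _ hx
      obtain ⟨hx1, hx2⟩ := hdm x hx
      exact ((hb (k + 1)).1 _ hx1 _ hx2).trans (hpow _ (by omega))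
    intro ν₁ hν₁ hf₁ _ _
    refine Total.seq (Total.fill (l := 0) (h := n * n) (o' := 0)
      (fun x => (step n A (k + 1)).1 (x / n) (x % n)) (by simp) (by omega) (by omega) hZ ?_
      (by decide) (by decide) (by decide) ?_ ?_ ?_)
    · intro ρ hρ
      simp [hρ vN (by decide), hν₁ vN (by decide), hnν]
    · intro x ρ _ hx hρ hxρ _
      refine Total.skip ⟨by simp, ?_⟩
      have := hf₁ x (by omega) hx
      rw [zero_add] at this
      simp [hxρ, hρ aTmp (by decide), this]
    · intro x _ hx
      obtain ⟨hx1, hx2⟩ := hdm x hx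
      exact ((hb (k + 1)).1 _ hx1 _ hx2).trans (hpow _ (by omega))
    intro ν₂ hν₂ hf₂ _ _
    have hM₂ : ∀ i < n, ∀ j < n, ν₂ aM (i * n + j : ℕ) = (step n A (k + 1)).1 i j := by
      intro i hi j hj
      have := hf₂ (i * n + j) (by omega) (mul_add_lt hi hj)
      simpa only [zero_add, (mul_add_div_mod hj).1, (mul_add_div_mod hj).2] using this
    refine Total.seq (Total.sumLoop (h := n * n)
      (fun x => A (x / n) (x % n) * (step n A (k + 1)).1 (x % n) (x / n))
      (by decide) (by omega) hZ ?_ ?_ ?_ ?_)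
    · intro ρ hρ
      simp [hρ vN (by decide), hν₂ vN (by decide), hν₁ vN (by decide), hnν]
    · intro x hx ρ hρ hxρ
      obtain ⟨hx1, hx2⟩ := hdm x hx
      have e2 : ρ vN 0 = n := by
        rw [hρ vN (by decide), hν₂ vN (by decide), hν₁ vN (by decide), hnν]
      have e3 : ρ aGram x = A (x / n) (x % n) := by
        rw [hρ aGram (by decide), hν₂ aGram (by decide), hν₁ aGram (by decide),
          ← hAν _ hx1 _ hx2, Nat.div_add_mod']
      simp only [value_mul, value_read, value_add, value_div, value_mod, value_var, hxρ, e2,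
        ← Int.natCast_div, ← Int.natCast_mod, hcell, e3, hρ aM (by decide)]
      rw [hM₂ _ hx2 _ hx1]
    -- Partial sums of the trace have at most n² ≤ β² summands. As k < n, the exponent 6k + 9 is
    -- below 6n + 6.
    · intro m hm
      refine (natAbs_sum_range_le m _ (b := β * β ^ (6 * (k + 1))) fun x hx => ?_).trans ?_
      · obtain ⟨hx1, hx2⟩ := hdm x (by omega)
        rw [Int.natAbs_mul]
        exact Nat.mul_le_mul (hAβ _ hx1 _ hx2) ((hb (k + 1)).1 _ hx2 _ hx1)
      · refine le_trans ?_ (hpow (6 * k + 9) (by omega))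
        calc m * (β * β ^ (6 * (k + 1))) ≤ (β * β) * (β * β ^ (6 * (k + 1))) :=
              Nat.mul_le_mul_right _ (hm.trans (Nat.mul_le_mul hnβ hnβ))
          _ = β ^ (6 * k + 9) := by ring
    intro ν₃ hν₃ hs₃ _
    have ec : ((0 - var vSum) / (var vi + 1)).value ν₃ = (step n A (k + 1)).2 := by
      have e1 : ν₃ vi 0 = k := by
        rw [hν₃ vi (by decide), hν₂ vi (by decide), hν₁ vi (by decide), hik]
      have e2 : ∑ x ∈ range (n * n), A (x / n) (x % n) * (step n A (k + 1)).1 (x % n) (x / n) =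
          ∑ i ∈ range n, ∑ l ∈ range n, A i l * (step n A (k + 1)).1 l i :=
        sum_range_mul_div_mod (fun i l => A i l * (step n A (k + 1)).1 l i) n n
      simp only [value_div, value_sub, value_zero, value_var, value_add, value_one, e1, hs₃, e2]
      rfl
    refine Total.seq (Total.set (by rw [ec]; exact (hb (k + 1)).2.trans (hpow _ (by omega)))
      fun _ => ?_)
    rw [ec]
    refine Total.branch (fun hc => ?_) (fun hc => ?_)
    · rw [value_var, write_same] at hc
      refine Total.set ?_ ?_
      · rw [value_var, write_same]
        exact (hb (k + 1)).2.trans (hpow _ (by omega))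
      · refine ⟨fun i hi j hj => ?_, ?_, ?_⟩
        · simp [hν₃ aM (by decide), ← hM₂ i hi j hj]
        · simp
        · simp [lastNonzero, hc]
    · rw [value_var, write_same] at hc
      refine Total.skip ⟨fun i hi j hj => ?_, ?_, ?_⟩
      · simp [hν₃ aM (by decide), ← hM₂ i hi j hj]
      · simp
      · simp only [lastNonzero, hc]
        simp [hν₃ vT (by decide), hν₂ vT (by decide), hν₁ vT (by decide), hI3]
  · rintro ν hν hi ⟨-, -, hI3⟩
    exact hI3

theorem natAbs_modulus_mono {t β : ℕ} (hβ : 1 ≤ β) {a b : ℕ} (h : a ≤ b) :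
    t * β ^ a ≤ t * β ^ b := Nat.mul_le_mul_left _ (Nat.pow_le_pow_right hβ h)

theorem total_computeModulus {t : ℤ} {β : ℕ} (hn : μ vN 0 = n) (ht : μ vT 0 = t)
    (hβμ : μ vBeta 0 = β) (hβ : 1 ≤ β) (hZ : 20 * (n + 1) ≤ Z) (hZV : Z ≤ V)
    (hV : (t * t).natAbs * β ^ (20 * (n + 1)) ≤ V)
    (hQ : ∀ ν, AgreeOff computeModulus.writes μ ν →
      ν vMod 0 = t * t * (β : ℤ) ^ (20 * (n + 1)) → Q ν) :
    Total V computeModulus μ Q (1 + (Z * (1 + 2) + 2)) := by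
  refine Total.mono (Q := fun ν => ν vMod 0 = t * t * (β : ℤ) ^ (20 * (n + 1))) ?_ le_rfl hQ
  refine Total.seq (Total.set ?_ fun hag => ?_)
  · have := natAbs_modulus_mono (t := (t * t).natAbs) hβ (Nat.zero_le (20 * (n + 1)))
    simp only [value_mul, value_var, ht]
    rw [pow_zero, mul_one] at this
    omega
  refine Total.forLoop (l := 0) (h := 20 * (n + 1)) (fun k ν => ν vMod 0 = t * t * (β : ℤ) ^ k)
    (by simp) (by omega) (by omega) (by omega) ?_ (by decide) ?_ ?_ ?_
  · intro ν hν
    simp [hν vN (by decide), hn]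
  · simp [ht]
  · intro k ν _ hk hν hik hI
    have e : (var vMod * var vBeta).value ν = t * t * (β : ℤ) ^ (k + 1) := by
      simp [hI, hν vBeta (by decide), hβμ]
      ring
    refine Total.set ?_ ?_
    · rw [e, Int.natAbs_mul, Int.natAbs_pow, Int.natAbs_natCast]
      exact (natAbs_modulus_mono hβ hk).trans hV
    · rw [e]; simp
  · exact fun ν _ _ hI => hI

end RandomAccess

/-! ### Insertion of vectors into a triangular basis and reduction of the basis -/

namespace TriangularBasis

open Finset

variable {D : ℕ} {N : ℤ} {W W' : ℕ → ℕ → ℤ} {v v' : ℕ → ℤ} {L : Submodule ℤ (ℕ → ℤ)}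

/-- The rows of `W` are a triangular basis of the lattice `L`, which contains the multiples
of `N`. -/
structure IsBasis (D : ℕ) (N : ℤ) (W : ℕ → ℕ → ℤ) (L : Submodule ℤ (ℕ → ℤ)) : Prop where
  tri : IsTriangular D W
  bound : ∀ a < D, ∀ j < D, 0 ≤ W a j ∧ W a j ≤ N
  single_mem : ∀ j < D, Pi.single j N ∈ tail D W j
  span_eq : tail D W 0 = L

/-- The rows of `W` and the vector `v`, the first `i` entries of which are zero, span `L`; this
is the situation after `i` rounds of the insertion of a vector. -/
structure IsInsertion (D : ℕ) (N : ℤ) (W : ℕ → ℕ → ℤ) (v : ℕ → ℤ) (i : ℕ)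
    (L : Submodule ℤ (ℕ → ℤ)) : Prop where
  tri : IsTriangular D W
  bound : ∀ a < D, ∀ j < D, 0 ≤ W a j ∧ W a j ≤ N
  vector_bound : ∀ j < D, 0 ≤ v j ∧ v j < N
  vector_zero : ∀ j < i, v j = 0
  single_mem : ∀ j < D, i < j → Pi.single j N ∈ tail D W j
  single_mem_sup : ∀ j < D, j ≤ i →
    Pi.single j N ∈ tail D W j ⊔ Submodule.span ℤ {trunc D v}
  span_eq : tail D W 0 ⊔ Submodule.span ℤ {trunc D v} = L

theorem trunc_congr {w w' : ℕ → ℤ} (h : ∀ j < D, w j = w' j) : trunc D w = trunc D w' := by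
  funext j
  unfold trunc
  split_ifs with hj
  · exact h j hj
  · rfl

theorem tail_congr {k : ℕ} (h : ∀ a, k ≤ a → a < D → ∀ j < D, W a j = W' a j) :
    tail D W k = tail D W' k := by
  unfold tail
  congr 1
  refine Set.image_congr fun a ha => ?_
  simp only [coe_Ico, Set.mem_Ico] at ha
  exact trunc_congr (h a ha.1 ha.2)

theorem tail_le {k : ℕ} {S : Submodule ℤ (ℕ → ℤ)}
    (h : ∀ a, k ≤ a → a < D → trunc D (W a) ∈ S) : tail D W k ≤ S := by
  refine Submodule.span_le.mpr ?_
  rintro _ ⟨a, ha, rfl⟩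
  simp only [coe_Ico, Set.mem_Ico] at ha
  exact h a ha.1 ha.2

/-- This justifies reduction modulo N: a change by multiples of N in the coordinates from k on stays
within the span of the rows from k on. -/
theorem mem_tail_of_dvd {k : ℕ} {f : ℕ → ℤ} (hN : ∀ x, k ≤ x → x < D → N ∣ f x)
    (h0 : ∀ x, x < k ∨ D ≤ x → f x = 0)
    (hs : ∀ x, k ≤ x → x < D → Pi.single x N ∈ tail D W x) : f ∈ tail D W k := by
  have e : f = ∑ x ∈ Ico k D, (f x / N) • (Pi.single x N : ℕ → ℤ) := by
    funext y
    rw [Finset.sum_apply]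
    by_cases hy : k ≤ y ∧ y < D
    · rw [sum_eq_single y]
      · simp [Int.ediv_mul_cancel (hN y hy.1 hy.2)]
      · intro b _ hb
        simp [hb.symm]
      · intro hy'
        exact absurd (mem_Ico.mpr hy) hy'
    · rw [h0 y (by omega), sum_eq_zero]
      intro x hx
      rw [mem_Ico] at hx
      have : y ≠ x := by omega
      simp [this]
  rw [e]
  refine sum_mem fun x hx => Submodule.smul_mem _ _ ?_
  rw [mem_Ico] at hx
  exact tail_mono hx.1 (hs x hx.1 hx.2)

/-- Exchanging row i and v for v and row i minus q·v preserves the span. Entry i of the difference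
is a remainder below v i < N, so the reduction modulo N changes only later coordinates, and that
change lies in the span of the untouched rows beyond i. -/
theorem IsInsertion.euclid {i : ℕ} (h : IsInsertion D N W v i L) (hi : i < D) (hv : v i ≠ 0)
    (hW : ∀ a < D, a ≠ i → ∀ j < D, W' a j = W a j) (hWi : ∀ j < D, W' i j = v j)
    (hv' : ∀ j < D, v' j = (W i j - W i i / v i * v j) % N) :
    IsInsertion D N W' v' i L ∧ v' i = W i i % v i := by
  have hvi := h.vector_bound i hi
  have hpos : 0 < v i := by omega
  have hNpos : 0 < N := by omega
  set q := W i i / v i with hq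
  have hqi : W i i - q * v i = W i i % v i := by
    rw [hq, Int.emod_def]; ring
  have hr0 := Int.emod_nonneg (W i i) hv
  have hr1 := Int.emod_lt_of_pos (W i i) hpos
  have hvi' : v' i = W i i % v i := by
    rw [hv' i hi, hqi, Int.emod_eq_of_lt hr0 (by omega)]
  have hz : ∀ j < i, W i j - q * v j = 0 := fun j hj => by
    rw [h.tri.zero i hi j hj, h.vector_zero j hj]; simp
  have hU : ∀ k, i < k → tail D W' k = tail D W k := fun k hk =>
    tail_congr fun a hka ha j hj => hW a ha (by omega) j hj
  -- the vector that the reduction modulo `N` adds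
  set f : ℕ → ℤ := trunc D v' - (trunc D (W i) - q • trunc D v) with hf
  have hfm : f ∈ tail D W (i + 1) := by
    refine mem_tail_of_dvd (N := N) ?_ ?_ fun x hx hxD => h.single_mem x hxD (by omega)
    · intro x _ hxD
      simp only [hf, trunc, Pi.sub_apply, Pi.smul_apply, smul_eq_mul, hxD, if_true, hv' x hxD]
      exact (Int.mod_modEq _ _).symm.dvd
    · intro x hx
      by_cases hxD : x < D
      · simp only [hf, trunc, Pi.sub_apply, Pi.smul_apply, smul_eq_mul, hxD, if_true]
        rcases (by omega : x < i ∨ x = i) with hxi | rfl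
        · rw [hv' x hxD, hz x hxi]; simp
        · rw [hvi', hqi, sub_self]
      · simp [hf, trunc, hxD]
  -- For k ≤ i the span of the rows from k on together with the vector is unchanged; k = 0 gives the
  -- lattice, and the other k give the multiples of N that are needed at the coordinates up to i.
  have hsup : ∀ k ≤ i, tail D W' k ⊔ Submodule.span ℤ {trunc D v'} =
      tail D W k ⊔ Submodule.span ℤ {trunc D v} := by
    intro k hk
    have hle1 : tail D W (i + 1) ≤ tail D W k := tail_mono (by omega)
    have hle2 : tail D W (i + 1) ≤ tail D W' k := by
      rw [← hU _ (Nat.lt_succ_self i)]; exact tail_mono (by omega)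
    have hv1 : trunc D v ∈ tail D W k ⊔ Submodule.span ℤ {trunc D v} :=
      Submodule.mem_sup_right (Submodule.mem_span_singleton_self _)
    have hv2 : trunc D v ∈ tail D W' k := by
      rw [← trunc_congr hWi]; exact trunc_mem_tail hk hi
    apply le_antisymm
    · refine sup_le (tail_le fun a hka ha => ?_) ((Submodule.span_singleton_le_iff_mem _ _).mpr ?_)
      · by_cases hai : a = i
        · rw [hai, trunc_congr hWi]; exact hv1
        · rw [trunc_congr (hW a ha hai)]
          exact Submodule.mem_sup_left (trunc_mem_tail hka ha)
      · have e : trunc D v' = f + (trunc D (W i) - q • trunc D v) := by rw [hf]; abel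
        rw [e]
        exact add_mem (Submodule.mem_sup_left (hle1 hfm)) (sub_mem
          (Submodule.mem_sup_left (trunc_mem_tail hk hi)) (Submodule.smul_mem _ _ hv1))
    · refine sup_le (tail_le fun a hka ha => ?_) ((Submodule.span_singleton_le_iff_mem _ _).mpr
        (Submodule.mem_sup_left hv2))
      by_cases hai : a = i
      · have e : trunc D (W i) = trunc D v' + q • trunc D v - f := by rw [hf]; abel
        rw [hai, e]
        exact sub_mem (add_mem (Submodule.mem_sup_right (Submodule.mem_span_singleton_self _))
          (Submodule.smul_mem _ _ (Submodule.mem_sup_left hv2))) (Submodule.mem_sup_left (hle2 hfm))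
      · rw [← trunc_congr (hW a ha hai)]
        exact Submodule.mem_sup_left (trunc_mem_tail hka ha)
  refine ⟨⟨⟨?_, ?_⟩, ?_, ?_, ?_, ?_, ?_, ?_⟩, hvi'⟩
  · intro a ha j hj
    by_cases hai : a = i
    · rw [hai, hWi j (by omega), h.vector_zero j (by omega)]
    · rw [hW a ha hai j (by omega), h.tri.zero a ha j hj]
  · intro a ha
    by_cases hai : a = i
    · rw [hai, hWi i hi]; exact hpos
    · rw [hW a ha hai a ha]; exact h.tri.pos a ha
  · intro a ha j hj
    by_cases hai : a = i
    · rw [hai, hWi j hj]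
      have := h.vector_bound j hj
      omega
    · rw [hW a ha hai j hj]; exact h.bound a ha j hj
  · intro j hj
    rw [hv' j hj]
    exact ⟨Int.emod_nonneg _ hNpos.ne', Int.emod_lt_of_pos _ hNpos⟩
  · intro j hj
    rw [hv' j (by omega), hz j hj]; simp
  · intro j hj hij
    rw [hU j hij]; exact h.single_mem j hj hij
  · intro j hj hij
    rw [hsup j hij]; exact h.single_mem_sup j hj hij
  · rw [hsup 0 (Nat.zero_le _), h.span_eq]

theorem IsInsertion.next {i : ℕ} (h : IsInsertion D N W v i L) (hv : v i = 0) :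
    IsInsertion D N W v (i + 1) L := by
  refine ⟨h.tri, h.bound, h.vector_bound, ?_, fun j hj hij => h.single_mem j hj (by omega), ?_,
    h.span_eq⟩
  · intro j hj
    rcases (by omega : j < i ∨ j = i) with hji | rfl
    · exact h.vector_zero j hji
    · exact hv
  · intro j hj hij
    rcases (by omega : j ≤ i ∨ i < j) with hji | hji
    · exact h.single_mem_sup j hj hji
    · exact Submodule.mem_sup_left (h.single_mem j hj hji)

theorem IsInsertion.isBasis (h : IsInsertion D N W v D L) : IsBasis D N W L := by
  have e : trunc D v = 0 := by
    funext j
    unfold trunc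
    split_ifs with hj
    · exact h.vector_zero j hj
    · rfl
  have e2 : ∀ k, tail D W k ⊔ Submodule.span ℤ {trunc D v} = tail D W k := by
    intro k; simp [e]
  refine ⟨h.tri, h.bound, fun j hj => ?_, ?_⟩
  · have := h.single_mem_sup j hj hj.le
    rwa [e2] at this
  · rw [← h.span_eq, e2]

theorem IsBasis.isInsertion (h : IsBasis D N W L) (hv : ∀ j < D, 0 ≤ v j ∧ v j < N) :
    IsInsertion D N W v 0 (L ⊔ Submodule.span ℤ {trunc D v}) :=
  ⟨h.tri, h.bound, hv, fun j hj => by omega, fun j hj _ => h.single_mem j hj,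
    fun j hj _ => Submodule.mem_sup_left (h.single_mem j hj), by rw [h.span_eq]⟩

/-- Row j vanishes before its pivot, and the new entry at j is a remainder below the pivot W j j ≤
N. The reduction modulo N therefore acts only beyond j, where its effect is absorbed by the rows
after j. -/
theorem IsBasis.reduce {i j : ℕ} (h : IsBasis D N W L) (hij : i < j) (hj : j < D)
    (hW : ∀ a < D, a ≠ i → ∀ t < D, W' a t = W a t) (hWlt : ∀ t < j, W' i t = W i t)
    (hWi : ∀ t, j ≤ t → t < D → W' i t = (W i t - W i j / W j j * W j t) % N) :
    IsBasis D N W' L ∧ W' i j = W i j % W j j := by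
  have hi : i < D := by omega
  have hpos := h.tri.pos j hj
  have hjN := (h.bound j hj j hj).2
  have hNpos : 0 < N := by omega
  set q := W i j / W j j with hq
  have hqj : W i j - q * W j j = W i j % W j j := by
    rw [hq, Int.emod_def]; ring
  have hr0 := Int.emod_nonneg (W i j) hpos.ne'
  have hr1 := Int.emod_lt_of_pos (W i j) hpos
  have hWij : W' i j = W i j % W j j := by
    rw [hWi j le_rfl hj, hqj, Int.emod_eq_of_lt hr0 (by omega)]
  have hU : ∀ k, i < k → tail D W' k = tail D W k := fun k hk =>
    tail_congr fun a hka ha j hj => hW a ha (by omega) j hj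
  set f : ℕ → ℤ := trunc D (W' i) - (trunc D (W i) - q • trunc D (W j)) with hf
  have hfm : f ∈ tail D W (j + 1) := by
    refine mem_tail_of_dvd (N := N) ?_ ?_ fun x hx hxD => h.single_mem x hxD
    · intro x hx hxD
      simp only [hf, trunc, Pi.sub_apply, Pi.smul_apply, smul_eq_mul, hxD, if_true,
        hWi x (by omega) hxD]
      exact (Int.mod_modEq _ _).symm.dvd
    · intro x hx
      by_cases hxD : x < D
      · simp only [hf, trunc, Pi.sub_apply, Pi.smul_apply, smul_eq_mul, hxD, if_true]
        rcases (by omega : x < j ∨ x = j) with hxi | rfl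
        · rw [hWlt x hxi, h.tri.zero j hj x hxi]; simp
        · rw [hWij, hqj, sub_self]
      · simp [hf, trunc, hxD]
  have htail : ∀ k, tail D W' k = tail D W k := by
    intro k
    rcases lt_or_ge i k with hk | hk
    · exact hU k hk
    have hle1 : tail D W (j + 1) ≤ tail D W k := tail_mono (by omega)
    have hle2 : tail D W (j + 1) ≤ tail D W' k := by
      rw [← hU (j + 1) (by omega)]; exact tail_mono (by omega)
    have hWj : trunc D (W' j) = trunc D (W j) := trunc_congr (hW j hj (by omega))
    apply le_antisymm
    · refine tail_le fun a hka ha => ?_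
      by_cases hai : a = i
      · have e : trunc D (W' i) = f + (trunc D (W i) - q • trunc D (W j)) := by rw [hf]; abel
        rw [hai, e]
        exact add_mem (hle1 hfm) (sub_mem (trunc_mem_tail hk hi)
          (Submodule.smul_mem _ _ (trunc_mem_tail (by omega) hj)))
      · rw [trunc_congr (hW a ha hai)]
        exact trunc_mem_tail hka ha
    · refine tail_le fun a hka ha => ?_
      by_cases hai : a = i
      · have e : trunc D (W i) = trunc D (W' i) + q • trunc D (W' j) - f := by
          rw [hf, hWj]; abel
        rw [hai, e]
        exact sub_mem (add_mem (trunc_mem_tail hk hi)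
          (Submodule.smul_mem _ _ (trunc_mem_tail (by omega) hj))) (hle2 hfm)
      · rw [← trunc_congr (hW a ha hai)]
        exact trunc_mem_tail hka ha
  refine ⟨⟨⟨?_, ?_⟩, ?_, ?_, ?_⟩, hWij⟩
  · intro a ha t ht
    by_cases hai : a = i
    · rw [hai, hWlt t (by omega), h.tri.zero i hi t (by omega)]
    · rw [hW a ha hai t (by omega), h.tri.zero a ha t ht]
  · intro a ha
    by_cases hai : a = i
    · rw [hai, hWlt i hij]; exact h.tri.pos i hi
    · rw [hW a ha hai a ha]; exact h.tri.pos a ha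
  · intro a ha t ht
    by_cases hai : a = i
    · rcases lt_or_ge t j with htj | htj
      · rw [hai, hWlt t htj]; exact h.bound i hi t ht
      · rw [hai, hWi t htj ht]
        exact ⟨Int.emod_nonneg _ hNpos.ne', (Int.emod_lt_of_pos _ hNpos).le⟩
    · rw [hW a ha hai t ht]; exact h.bound a ha t ht
  · intro k hk
    rw [htail]; exact h.single_mem k hk
  · rw [htail, h.span_eq]

/-- The starting basis N·1 has N itself on the diagonal, which is why basis entries are bounded by N
inclusively while the inserted vector stays strictly below N. -/
theorem isBasis_diagonal (hN : 0 < N) (hW : ∀ a < D, ∀ j < D, W a j = if a = j then N else 0) :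
    IsBasis D N W (Submodule.span ℤ ((fun j => Pi.single j N) '' (range D : Finset ℕ))) := by
  have hrow : ∀ a < D, trunc D (W a) = Pi.single a N := by
    intro a ha
    funext j
    unfold trunc
    by_cases hja : j = a
    · subst hja; simp [ha, hW j ha j ha]
    · by_cases hj : j < D
      · simp [hj, hW a ha j hj, hja, Ne.symm hja]
      · simp [hj, hja]
  refine ⟨⟨?_, ?_⟩, ?_, ?_, ?_⟩
  · intro a ha j hj
    rw [hW a ha j (by omega), if_neg (by omega)]
  · intro a ha
    rw [hW a ha a ha, if_pos rfl]; exact hN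
  · intro a ha j hj
    rw [hW a ha j hj]
    split_ifs <;> omega
  · intro j hj
    rw [← hrow j hj]
    exact trunc_mem_tail le_rfl hj
  · unfold tail
    congr 1
    rw [← Finset.range_eq_Ico]
    refine Set.image_congr fun a ha => hrow a ?_
    simpa using ha

/-- If v < w, then w mod v is less than half of w, so at least one binary digit is lost. -/
theorem size_mod_lt {w v : ℕ} (hv : 0 < v) (h : v < w) : (w % v).size + 1 ≤ w.size := by
  have h1 : 2 * (w % v) < w := by
    have h2 := Nat.div_add_mod w v
    have h3 : 1 ≤ w / v := Nat.div_pos h.le hv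
    have h4 := Nat.mod_lt w hv
    have h5 : v * 1 ≤ v * (w / v) := Nat.mul_le_mul_left v h3
    omega
  have h6 : 0 < w.size := Nat.size_pos.mpr (by omega)
  obtain ⟨s, hs⟩ := Nat.exists_eq_succ_of_ne_zero h6.ne'
  have h7 := Nat.lt_size_self w
  rw [hs, Nat.pow_succ] at h7
  have h8 : (w % v).size ≤ s := Nat.size_le.mpr (by omega)
  omega

end TriangularBasis

/-! ### Correctness of the computation of the Hermite normal form -/

namespace RandomAccess

open Finset DecompositionInput TriangularBasis RandomAccess.Program RandomAccess.Expr

variable {V Z n C r D i : ℕ} {N : ℤ} {col : ℕ → ℕ → ℤ} {kind : ℕ → ℤ} {μ ν : Memory}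
  {Q : Memory → Prop} {L : Submodule ℤ (ℕ → ℤ)}

/-- The rows of the basis in the memory. -/
def basisOf (D : ℕ) (μ : Memory) (a j : ℕ) : ℤ := μ aW (a * D + j : ℕ)

/-- The vector in the memory that is to be inserted into the basis. -/
def vectorOf (μ : Memory) (j : ℕ) : ℤ := μ aV j

/-- Serves the frame condition of `Total.fill`: overwriting the end of one row of the flattened
matrix leaves the other rows alone. -/
theorem row_disjoint {a i j D : ℕ} (hai : a ≠ i) (hj : j < D) (k : ℕ) :
    ((a * D + j : ℕ) : ℤ) < i * D + k ∨ (i * D + D : ℤ) ≤ (a * D + j : ℕ) := by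
  rcases lt_or_gt_of_ne hai with h | h
  · left
    have := Nat.mul_le_mul_right D (show a + 1 ≤ i from h)
    rw [add_mul, one_mul] at this
    have h2 : a * D + j < i * D + k := by omega
    exact_mod_cast h2
  · right
    have := Nat.mul_le_mul_right D (show i + 1 ≤ a from h)
    rw [add_mul, one_mul] at this
    have h2 : i * D + D ≤ a * D + j := by omega
    exact_mod_cast h2

/-- The steps of a round of the Euclidean algorithm. -/
def euclidSteps (Z : ℕ) : ℕ :=
  1 + ((Z * (1 + 3) + 2) + ((Z * (1 + 3) + 2) + (Z * (1 + 3) + 2)))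

theorem total_euclidStep (hD : μ vD 0 = D) (hN : μ vMod 0 = N) (hi : μ vi 0 = i) (hiD : i < D)
    (h : IsInsertion D N (basisOf D μ) (vectorOf μ) i L) (hv : vectorOf μ i ≠ 0)
    (hZ : D ≤ Z) (hZV : Z ≤ V) (hNV : N.natAbs ≤ V)
    (hQ : ∀ ν, AgreeOff euclidStep.writes μ ν →
      IsInsertion D N (basisOf D ν) (vectorOf ν) i L →
      vectorOf ν i = basisOf D μ i i % vectorOf μ i → basisOf D ν i i = vectorOf μ i → Q ν) :
    Total V euclidStep μ Q (euclidSteps Z) := by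
  have hvi := h.vector_bound i hiD
  have hWi := h.bound i hiD i hiD
  have hq : (.read aW (var vi * var vD + var vi) / .read aV (var vi) : Expr).value μ =
      basisOf D μ i i / vectorOf μ i := by
    simp [hi, hD, basisOf, vectorOf]
  have hNpos : 0 < N := by omega
  refine Total.mono (Q := fun ν => IsInsertion D N (basisOf D ν) (vectorOf ν) i L ∧
    vectorOf ν i = basisOf D μ i i % vectorOf μ i ∧ basisOf D ν i i = vectorOf μ i) ?_ le_rfl
    fun ν hν h' => hQ ν hν h'.1 h'.2.1 h'.2.2
  refine Total.seq (Total.set ?_ fun hag => ?_)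
  · rw [hq]
    refine (Int.natAbs_ediv_le_natAbs _ _).trans ?_
    omega
  rw [hq] at hag ⊢
  set q := basisOf D μ i i / vectorOf μ i with hqdef
  -- The remainder goes to a scratch array first, because the old vector is still to be copied into
  -- row i.
  refine Total.seq (Total.fill (l := i) (h := D) (o' := 0)
    (fun j => (basisOf D μ i j - q * vectorOf μ j) % N) (by simp [hi]) hiD.le (by omega) hZ ?_
    (by decide) (by decide) (by decide) ?_ ?_ ?_)
  · intro ν hν
    simp [hν vD (by decide), hD]
  · intro k ν _ hk hν hkν _
    refine Total.skip ⟨by simp, ?_⟩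
    simp [hkν, hν vi (by decide), hν vD (by decide), hν aW (by decide), hν aV (by decide),
      hν vQ (by decide), hν vMod (by decide), hi, hD, hN, basisOf, vectorOf]
  · intro k _ hk
    have h1 := Int.emod_nonneg (basisOf D μ i k - q * vectorOf μ k) hNpos.ne'
    have h2 := Int.emod_lt_of_pos (basisOf D μ i k - q * vectorOf μ k) hNpos
    omega
  intro ν₁ hν₁ hf₁ _ _
  refine Total.seq (Total.fill (l := i) (h := D) (o' := i * D) (vectorOf μ)
    (by simp [hν₁ vi (by decide), hi]) hiD.le (by omega) hZ ?_
    (by decide) (by decide) (by decide) ?_ ?_ ?_)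
  · intro ν hν
    simp [hν vD (by decide), hν₁ vD (by decide), hD]
  · intro k ν _ hk hν hkν _
    refine Total.skip ⟨?_, ?_⟩
    · simp [hν vi (by decide), hν vD (by decide), hν₁ vi (by decide), hν₁ vD (by decide), hi, hD]
    · simp [hkν, hν aV (by decide), hν₁ aV (by decide), vectorOf]
  · intro k _ hk
    have := h.vector_bound k hk
    omega
  intro ν₂ hν₂ hf₂ hg₂ _
  refine Total.fill (l := i) (h := D) (o' := 0)
    (fun j => (basisOf D μ i j - q * vectorOf μ j) % N)
    (by simp [hν₁ vi (by decide), hν₂ vi (by decide), hi]) hiD.le (by omega) hZ ?_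
    (by decide) (by decide) (by decide) ?_ ?_ ?_
  · intro ν hν
    simp [hν vD (by decide), hν₂ vD (by decide), hν₁ vD (by decide), hD]
  · intro k ν hik hk hν hkν _
    refine Total.skip ⟨by simp, ?_⟩
    have := hf₁ k hik hk
    rw [zero_add] at this
    simp [hkν, hν aTmp (by decide), hν₂ aTmp (by decide), this]
  · intro k _ hk
    have h1 := Int.emod_nonneg (basisOf D μ i k - q * vectorOf μ k) hNpos.ne'
    have h2 := Int.emod_lt_of_pos (basisOf D μ i k - q * vectorOf μ k) hNpos
    omega
  intro ν hν hf hg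
  have hWν : ν aW = ν₂ aW := hν aW (by decide)
  have hW₁ : ν₁ aW = μ aW := hν₁ aW (by decide)
  have hV₂ : ν₂ aV = μ aV := by
    rw [hν₂ aV (by decide), hν₁ aV (by decide)]; rfl
  have hrow : ∀ j < D, basisOf D ν i j = vectorOf μ j := by
    intro j hj
    rcases lt_or_ge j i with hji | hji
    · rw [basisOf, hWν, hg₂ _ (Or.inl (by push_cast; omega)), hW₁]
      have h1 := h.tri.zero i hiD j hji
      have h2 := h.vector_zero j hji
      rw [basisOf] at h1
      rw [h1, h2]
    · rw [basisOf, hWν, Nat.cast_add, Nat.cast_mul]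
      exact hf₂ j hji hj
  have hins := h.euclid (W' := basisOf D ν) (v' := vectorOf ν) hiD hv ?_ hrow ?_
  · exact ⟨hins.1, hins.2, hrow i hiD⟩
  · intro a _ hai j hj
    rw [basisOf, hWν, hg₂ _ (row_disjoint hai hj i), hW₁, basisOf]
  · intro j hj
    rcases lt_or_ge j i with hji | hji
    · rw [vectorOf, hg _ (Or.inl (by omega)), hV₂]
      have h1 := h.tri.zero i hiD j hji
      have h2 := h.vector_zero j hji
      rw [h1, h2]
      rw [vectorOf] at h2
      rw [h2]
      simp
    · have := hf j hji hj
      rwa [zero_add] at this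

/-- The steps of the insertion of a vector. -/
def insertSteps (Z : ℕ) : ℕ := Z * ((2 * Z + 1) * (euclidSteps Z + 1) + 1 + 2) + 2

/-- The coordinates are cleared one after the other by the Euclidean algorithm on the pivot and the
entry of the vector. The number of rounds per coordinate is bounded by the bit length of N. -/
theorem total_insertVector (hD : μ vD 0 = D) (hN : μ vMod 0 = N)
    (h : IsInsertion D N (basisOf D μ) (vectorOf μ) 0 L)
    (hZ : D ≤ Z) (hZV : Z ≤ V) (hNV : N.natAbs ≤ V) (hNZ : N.natAbs.size ≤ Z)
    (hQ : ∀ ν, AgreeOff insertVector.writes μ ν → IsBasis D N (basisOf D ν) L → Q ν) :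
    Total V insertVector μ Q (insertSteps Z) := by
  refine Total.mono (Q := fun ν => IsBasis D N (basisOf D ν) L) ?_ le_rfl hQ
  refine Total.forLoop (l := 0) (h := D) (fun i ν =>
    IsInsertion D N (basisOf D ν) (vectorOf ν) i L) (by simp) (by omega) (by omega) (by omega) ?_
    (by decide) ?_ ?_ ?_
  · intro ν hν
    simp [hν vD (by decide), hD]
  · exact h
  · intro i ν _ hiD hν hi hI
    have hDν : ν vD 0 = D := by rw [hν vD (by decide), hD]
    have hNν : ν vMod 0 = N := by rw [hν vMod (by decide), hN]
    -- The measure is the sum of the bit lengths of the pivot and of the entry. The last alternative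
    -- describes the start, where the entry may exceed the pivot: the first round may merely swap
    -- them, and the extra 1 pays for it.
    refine Total.loop (fun m ρ => AgreeOff euclidStep.writes ν ρ ∧
      IsInsertion D N (basisOf D ρ) (vectorOf ρ) i L ∧
      (vectorOf ρ i = 0 ∨
        (vectorOf ρ i).natAbs < (basisOf D ρ i i).natAbs ∧
          (vectorOf ρ i).natAbs.size + (basisOf D ρ i i).natAbs.size ≤ m ∨
        (vectorOf ρ i).natAbs.size + (basisOf D ρ i i).natAbs.size + 1 ≤ m)) _ ?_ ?_ ?_
    · refine ⟨.refl _ _, hI, Or.inr (Or.inr ?_)⟩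
      have h1 := hI.vector_bound i hiD
      have h2 := hI.bound i hiD i hiD
      have h3 : (vectorOf ν i).natAbs.size ≤ Z := (Nat.size_le_size (by omega)).trans hNZ
      have h4 : (basisOf D ν i i).natAbs.size ≤ Z := (Nat.size_le_size (by omega)).trans hNZ
      omega
    · rintro m ρ - ⟨hρ, hIρ, hm⟩ hc
      have hi' : ρ vi 0 = i := by rw [hρ vi (by decide), hi]
      have hv : vectorOf ρ i ≠ 0 := by simpa [hi', vectorOf] using hc
      have hv0 := hIρ.vector_bound i hiD
      have hw0 := hIρ.bound i hiD i hiD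
      have hvpos : 0 < (vectorOf ρ i).natAbs := by omega
      have hspos : 0 < (vectorOf ρ i).natAbs.size := Nat.size_pos.mpr hvpos
      have hmod : (basisOf D ρ i i % vectorOf ρ i).natAbs =
          (basisOf D ρ i i).natAbs % (vectorOf ρ i).natAbs := by
        have e1 : basisOf D ρ i i = (basisOf D ρ i i).natAbs := by omega
        have e2 : vectorOf ρ i = (vectorOf ρ i).natAbs := by omega
        conv_lhs => rw [e1, e2, ← Int.natCast_mod, Int.natAbs_natCast]
      have hlt := Nat.mod_lt (basisOf D ρ i i).natAbs hvpos
      refine ⟨by omega, ?_⟩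
      refine total_euclidStep (by rw [hρ vD (by decide), hDν]) (by rw [hρ vMod (by decide), hNν])
        hi' hiD hIρ hv hZ hZV hNV fun σ hσ hIσ e1 e2 => ⟨hρ.trans hσ, hIσ, Or.inr (Or.inl ?_)⟩
      rw [e1, e2, hmod]
      refine ⟨hlt, ?_⟩
      rcases hm with h0 | ⟨h1, h2⟩ | h2
      · exact absurd h0 hv
      · have := size_mod_lt hvpos h1
        omega
      · have : ((basisOf D ρ i i).natAbs % (vectorOf ρ i).natAbs).size ≤
            (basisOf D ρ i i).natAbs.size := Nat.size_le_size (Nat.mod_le _ _)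
        omega
    · rintro m ρ ⟨hρ, hIρ, -⟩ hc
      have hi' : ρ vi 0 = i := by rw [hρ vi (by decide), hi]
      exact hIρ.next (by simpa [hi', vectorOf] using hc)
  · intro ν _ _ hI
    exact hI.isBasis

/-- The lattice spanned by the vectors of the first `m` columns and the multiples of `N`. -/
def partialLattice (n C : ℕ) (col : ℕ → ℕ → ℤ) (kind : ℕ → ℤ) (N : ℤ) (m : ℕ) :
    Submodule ℤ (ℕ → ℤ) :=
  Submodule.span ℤ (latticeVector n col kind '' (range m : Finset ℕ)) ⊔
    Submodule.span ℤ ((fun j => Pi.single j N) '' (range (n + C) : Finset ℕ))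

/-- Since m < C, the vector of column m vanishes beyond n + C, so storing it truncated and reduced
modulo N changes it only by multiples of N that are already in the lattice. -/
theorem partialLattice_succ {n C m : ℕ} (hm : m < C) {v : ℕ → ℤ}
    (hv : ∀ j < n + C, v j = latticeVector n col kind m j % N) :
    partialLattice n C col kind N m ⊔ Submodule.span ℤ {trunc (n + C) v} =
      partialLattice n C col kind N (m + 1) := by
  have hf : trunc (n + C) v - latticeVector n col kind m ∈
      Submodule.span ℤ ((fun j => Pi.single j N) '' (range (n + C) : Finset ℕ)) := by
    rw [Submodule.mem_span_image_finset_iff_exists_fun']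
    refine ⟨fun j => -(latticeVector n col kind m j / N), ?_⟩
    funext y
    rw [Finset.sum_apply]
    by_cases hy : y < n + C
    · rw [sum_eq_single y]
      · simp only [Pi.smul_apply, Pi.single_eq_same, smul_eq_mul, Pi.sub_apply, trunc, hy, if_true,
          hv y hy, Int.emod_def]
        ring
      · intro b _ hb
        simp [hb.symm]
      · intro hy'
        exact absurd (mem_range.mpr hy) hy'
    · rw [sum_eq_zero]
      · have : ¬(y = n + m) := by omega
        have hyn : ¬(y < n) := by omega
        simp [trunc, hy, latticeVector, this, hyn]
      · intro x hx
        rw [mem_range] at hx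
        have : y ≠ x := by omega
        simp [this]
  have e1 : latticeVector n col kind '' ((range (m + 1) : Finset ℕ) : Set ℕ) =
      insert (latticeVector n col kind m) (latticeVector n col kind '' (range m : Finset ℕ)) := by
    rw [range_add_one, coe_insert, Set.image_insert_eq]
  unfold partialLattice
  rw [e1, Submodule.span_insert]
  apply le_antisymm
  · refine sup_le (sup_le ?_ le_sup_right) ?_
    · exact le_sup_right.trans le_sup_left
    · rw [Submodule.span_singleton_le_iff_mem]
      have : trunc (n + C) v = latticeVector n col kind m +
          (trunc (n + C) v - latticeVector n col kind m) := by abel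
      rw [this]
      exact add_mem (Submodule.mem_sup_left (Submodule.mem_sup_left
        (Submodule.mem_span_singleton_self _))) (Submodule.mem_sup_right hf)
  · refine sup_le (sup_le ?_ (le_sup_left.trans le_sup_left)) (le_sup_right.trans le_sup_left)
    rw [Submodule.span_singleton_le_iff_mem]
    have : latticeVector n col kind m = trunc (n + C) v -
        (trunc (n + C) v - latticeVector n col kind m) := by abel
    rw [this]
    exact sub_mem (Submodule.mem_sup_right (Submodule.mem_span_singleton_self _))
      (Submodule.mem_sup_left (Submodule.mem_sup_right hf))

theorem total_loadVector (h : Loaded n C r col kind μ) (hD : μ vD 0 = (n + C : ℕ))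
    (hN : μ vMod 0 = N) (hN1 : 1 < N) {c : ℕ} (hc : μ vc 0 = c)
    (hZ : n + C ≤ Z) (hZV : Z ≤ V) (hNV : N.natAbs ≤ V)
    (hQ : ∀ ν, AgreeOff loadVector.writes μ ν →
      (∀ j < n + C, vectorOf ν j = latticeVector n col kind c j % N) → Q ν) :
    Total V loadVector μ Q (Z * (1 + 3) + 2) := by
  refine Total.mono (Q := fun ν => ∀ j < n + C,
    vectorOf ν j = latticeVector n col kind c j % N) ?_ le_rfl hQ
  refine Total.fill (l := 0) (h := n + C) (o' := 0) (fun j => latticeVector n col kind c j % N)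
    (by simp) (by omega) (by omega) hZ ?_ (by decide) (by decide) (by decide) ?_ ?_ ?_
  · intro ν hν
    simp [hν vD (by decide), hD]
  · intro k ν _ hk hν hkν _
    have hL := h.agree hν (by decide)
    refine Total.skip ⟨by simp, ?_⟩
    have e1 : ν vc 0 = c := by rw [hν vc (by decide), hc]
    have e2 := hL.value_col (e := var vc) (f := var vt) (by simpa using e1) (by simpa using hkν)
    have e3 : ((k : ℤ) + 1 ≤ n) ↔ k < n := by omega
    have e4 : ((k : ℤ) = n + c) ↔ k = n + c := by omega
    simp only [value_add, value_mul, value_mod, value_le, value_eq, value_var, value_one,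
      value_zero, value_read, e2, hkν, hL.n_eq, e1, hL.kind_eq, hν vMod (by decide), hN,
      latticeVector, e3, e4]
    by_cases hkn : k < n
    · have : ¬(k = n + c) := by omega
      simp [hkn, this]
    · by_cases hkc : k = n + c
      · by_cases hk0 : 0 ≤ kind c
        · have hNe : (1 : ℤ) % N = 1 := Int.emod_eq_of_lt (by omega) hN1
          simp [hkc, hk0, hNe]
        · simp [hkc, hk0]
      · simp [hkn, hkc]
  · intro k _ hk
    have h1 := Int.emod_nonneg (latticeVector n col kind c k) (show N ≠ 0 by omega)
    have h2 := Int.emod_lt_of_pos (latticeVector n col kind c k) (show 0 < N by omega)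
    omega
  · intro ν _ hf _ j hj
    have := hf j (by omega) hj
    rwa [zero_add] at this

theorem total_initBasis (h : Loaded n C r col kind μ) (hN : μ vMod 0 = N) (hN1 : 1 < N)
    (hZ : (n + C) * (n + C) ≤ Z) (hZV : Z ≤ V) (hNV : N.natAbs ≤ V)
    (hQ : ∀ ν, AgreeOff initBasis.writes μ ν → ν vD 0 = (n + C : ℕ) →
      IsBasis (n + C) N (basisOf (n + C) ν) (partialLattice n C col kind N 0) → Q ν) :
    Total V initBasis μ Q (1 + (Z * (1 + 3) + 2)) := by
  have hDZ : n + C ≤ Z := (Nat.le_mul_self _).trans hZ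
  refine Total.mono (Q := fun ν => ν vD 0 = (n + C : ℕ) ∧
    IsBasis (n + C) N (basisOf (n + C) ν) (partialLattice n C col kind N 0)) ?_ le_rfl
    fun ν hν h' => hQ ν hν h'.1 h'.2
  have e : (var vN + var vC).value μ = ((n + C : ℕ) : ℤ) := by simp [h.n_eq, h.C_eq]
  refine Total.seq (Total.set (by rw [e]; omega) fun hag => ?_)
  rw [e] at hag ⊢
  refine Total.fill (l := 0) (h := (n + C) * (n + C)) (o' := 0)
    (fun x => N * if x / (n + C) = x % (n + C) then 1 else 0)
    (by simp) (by omega) (by omega) hZ ?_ (by decide) (by decide) (by decide) ?_ ?_ ?_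
  · intro ν hν
    simp [hν vD (by decide)]
  · intro k ν _ hk hν hkν _
    refine Total.skip ⟨by simp, ?_⟩
    have e1 : ν vD 0 = ((n + C : ℕ) : ℤ) := by simp [hν vD (by decide)]
    have e2 : ν vMod 0 = N := by simp [hν vMod (by decide), hN]
    simp only [value_mul, value_eq, value_div, value_mod, value_var, hkν, e1, e2,
      ← Int.natCast_div, ← Int.natCast_mod, Nat.cast_inj]
  · intro k _ _
    split_ifs <;> simp [hNV]
  · intro ν hν hf _
    refine ⟨by simp [hν vD (by decide)], ?_⟩
    have e0 : partialLattice n C col kind N 0 =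
        Submodule.span ℤ ((fun j => Pi.single j N) '' (range (n + C) : Finset ℕ)) := by
      simp [partialLattice]
    rw [e0]
    refine isBasis_diagonal (by omega) fun a ha j hj => ?_
    have := hf (a * (n + C) + j) (by omega) (mul_add_lt ha hj)
    rw [zero_add, (mul_add_div_mod hj).1, (mul_add_div_mod hj).2] at this
    rw [basisOf, this]
    split_ifs <;> simp

theorem total_insertColumns (h : Loaded n C r col kind μ) (hD : μ vD 0 = (n + C : ℕ))
    (hN : μ vMod 0 = N) (hN1 : 1 < N)
    (hI : IsBasis (n + C) N (basisOf (n + C) μ) (partialLattice n C col kind N 0))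
    (hZ : n + C ≤ Z) (hZV : Z ≤ V) (hNV : N.natAbs ≤ V) (hNZ : N.natAbs.size ≤ Z)
    (hQ : ∀ ν, AgreeOff insertColumns.writes μ ν →
      IsBasis (n + C) N (basisOf (n + C) ν) (lattice n C col kind N) → Q ν) :
    Total V insertColumns μ Q (Z * ((Z * (1 + 3) + 2) + insertSteps Z + 2) + 2) := by
  refine Total.mono (Q := fun ν =>
    IsBasis (n + C) N (basisOf (n + C) ν) (lattice n C col kind N)) ?_ le_rfl hQ
  refine Total.forLoop (l := 0) (h := C) (fun m ν =>
    IsBasis (n + C) N (basisOf (n + C) ν) (partialLattice n C col kind N m)) (by simp) (by omega)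
    (by omega) (by omega) ?_ (by decide) ?_ ?_ ?_
  · intro ν hν
    simp [hν vC (by decide), h.C_eq]
  · exact hI
  · intro m ν _ hm hν hc hIν
    have hL := h.agree hν (by decide)
    have hDν : ν vD 0 = (n + C : ℕ) := by rw [hν vD (by decide), hD]
    have hNν : ν vMod 0 = N := by rw [hν vMod (by decide), hN]
    refine Total.seq (total_loadVector hL hDν hNν hN1 hc hZ hZV hNV fun ρ hρ hv _ => ?_)
    have hWρ : basisOf (n + C) ρ = basisOf (n + C) ν := by
      funext a j; rw [basisOf, basisOf, hρ aW (by decide)]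
    have hins := IsBasis.isInsertion (v := vectorOf ρ) (hWρ ▸ hIν) fun j hj => by
      rw [hv j hj]
      exact ⟨Int.emod_nonneg _ (by omega), Int.emod_lt_of_pos _ (by omega)⟩
    rw [partialLattice_succ hm hv] at hins
    exact total_insertVector (by rw [hρ vD (by decide), hDν]) (by rw [hρ vMod (by decide), hNν])
      hins hZ hZV hNV hNZ fun σ _ hσ => hσ
  · exact fun ν _ _ hI => hI

/-- The steps of the reduction of the basis. -/
def reduceSteps (Z : ℕ) : ℕ := Z * (Z * (1 + (Z * (1 + 3) + 2) + 2) + 2 + 2) + 2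

/-- For each row the columns are treated from left to right. Subtracting row j affects only the
entries from j on, so entries reduced earlier stay reduced, and pivots never change. -/
theorem total_reduceBasis (hD : μ vD 0 = D) (hN : μ vMod 0 = N)
    (hI : IsBasis D N (basisOf D μ) L) (hZ : D ≤ Z) (hZV : Z ≤ V) (hNV : N.natAbs ≤ V)
    (hQ : ∀ ν, AgreeOff reduceBasis.writes μ ν → IsBasis D N (basisOf D ν) L →
      (∀ j < D, ∀ i < j, 0 ≤ basisOf D ν i j ∧ basisOf D ν i j < basisOf D ν j j) → Q ν) :
    Total V reduceBasis μ Q (reduceSteps Z) := by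
  refine Total.mono (Q := fun ν => IsBasis D N (basisOf D ν) L ∧
    ∀ j < D, ∀ i < j, 0 ≤ basisOf D ν i j ∧ basisOf D ν i j < basisOf D ν j j) ?_ le_rfl
    fun ν hν h' => hQ ν hν h'.1 h'.2
  refine Total.forLoop (l := 0) (h := D) (fun i ν => IsBasis D N (basisOf D ν) L ∧
    ∀ j < D, ∀ a < i, a < j → 0 ≤ basisOf D ν a j ∧ basisOf D ν a j < basisOf D ν j j)
    (by simp) (by omega) (by omega) (by omega) ?_ (by decide) ?_ ?_ ?_
  · intro ν hν
    simp [hν vD (by decide), hD]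
  · exact ⟨hI, fun j _ a ha => by omega⟩
  · rintro i ν - hiD hν hi ⟨hIν, hred⟩
    have hDν : ν vD 0 = D := by rw [hν vD (by decide), hD]
    have hNν : ν vMod 0 = N := by rw [hν vMod (by decide), hN]
    refine Total.forLoop (l := i + 1) (h := D) (fun k ρ => IsBasis D N (basisOf D ρ) L ∧
      (∀ j < D, ∀ a < i, a < j →
        0 ≤ basisOf D ρ a j ∧ basisOf D ρ a j < basisOf D ρ j j) ∧
      ∀ j < k, i < j → 0 ≤ basisOf D ρ i j ∧ basisOf D ρ i j < basisOf D ρ j j)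
      (by simp [hi]) (by omega) (by omega) (by omega) ?_ (by decide) ?_ ?_ ?_
    · intro ρ hρ
      simp [hρ vD (by decide), hDν]
    · exact ⟨hIν, hred, fun j hj hij => by omega⟩
    · rintro k ρ hik hk hρ hkρ ⟨hIρ, hred1, hred2⟩
      have hDρ : ρ vD 0 = D := by rw [hρ vD (by decide), hDν]
      have hNρ : ρ vMod 0 = N := by rw [hρ vMod (by decide), hNν]
      have hiρ : ρ vi 0 = i := by rw [hρ vi (by decide), hi]
      have hpos := hIρ.tri.pos k hk
      have hbk := hIρ.bound k hk k hk
      have hbi := hIρ.bound i hiD k hk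
      have hNpos : 0 < N := by omega
      have hq : (.read aW (var vi * var vD + var vj) /
          .read aW (var vj * var vD + var vj) : Expr).value ρ =
          basisOf D ρ i k / basisOf D ρ k k := by
        simp [hkρ, hiρ, hDρ, basisOf]
      refine Total.seq (Total.set ?_ fun hag => ?_)
      · rw [hq]
        refine (Int.natAbs_ediv_le_natAbs _ _).trans ?_
        omega
      rw [hq] at hag ⊢
      set q := basisOf D ρ i k / basisOf D ρ k k with hqdef
      refine Total.fill (l := k) (h := D) (o' := i * D)
        (fun t => (basisOf D ρ i t - q * basisOf D ρ k t) % N) (by simp [hkρ]) hk.le (by omega) hZ ?_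
        (by decide) (by decide) (by decide) ?_ ?_ ?_
      · intro σ hσ
        simp [hσ vD (by decide), hDρ]
      · intro t σ hkt ht hσ htσ hun
        refine Total.skip ⟨?_, ?_⟩
        · simp [hσ vi (by decide), hσ vD (by decide), hiρ, hDρ]
        · have e1 : σ aW ((i * D + t : ℕ) : ℤ) = basisOf D ρ i t := by
            rw [hun _ (Or.inr (by push_cast; omega))]
            simp [basisOf]
          have e2 : σ aW ((k * D + t : ℕ) : ℤ) = basisOf D ρ k t := by
            -- Row i is overwritten in place while row k is read. The two rows are distinct, so row
            -- k keeps its contents.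
            have hd := row_disjoint (a := k) (i := i) (j := t) (D := D) (by omega) ht k
            rw [hun _ ?_]
            · simp [basisOf]
            · rcases hd with h1 | h1
              · exact Or.inl h1
              · exact Or.inr (by omega)
          push_cast at e1 e2
          simp [htσ, hσ vi (by decide), hσ vD (by decide), hσ vj (by decide), hσ vQ (by decide),
            hσ vMod (by decide), hiρ, hDρ, hkρ, hNρ, e1, e2]
      · intro t _ ht
        have h1 := Int.emod_nonneg (basisOf D ρ i t - q * basisOf D ρ k t) hNpos.ne'
        have h2 := Int.emod_lt_of_pos (basisOf D ρ i t - q * basisOf D ρ k t) hNpos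
        omega
      · intro σ hσ hf hg
        have hother : ∀ a < D, a ≠ i → ∀ t < D, basisOf D σ a t = basisOf D ρ a t := by
          intro a _ hai t ht
          rw [basisOf, hg _ (row_disjoint hai ht k)]
          simp [basisOf]
        have hlt : ∀ t < k, basisOf D σ i t = basisOf D ρ i t := by
          intro t ht
          rw [basisOf, hg _ (Or.inl (by push_cast; omega))]
          simp [basisOf]
        obtain ⟨h1, h2⟩ := hIρ.reduce (W' := basisOf D σ) (i := i) (j := k) (by omega) hk hother hlt
          (fun t hkt ht => by
            rw [basisOf, Nat.cast_add, Nat.cast_mul]; exact hf t hkt ht)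
        have hwr : basisOf D (σ.write vj 0 ((k + 1 : ℕ) : ℤ)) = basisOf D σ := by
          funext a b; simp [basisOf]
        rw [hwr]
        refine ⟨h1, fun j hj a ha haj => ?_, fun j hj hij => ?_⟩
        · have := hred1 j hj a ha haj
          rw [hother a (by omega) (by omega) j hj]
          by_cases hji : j = i
          · rw [hji] at this ⊢
            rwa [hlt i (by omega)]
          · rwa [hother j hj hji j hj]
        · rw [hother j (by omega) (by omega) j (by omega)]
          rcases (by omega : j < k ∨ j = k) with hjk | rfl
          · rw [hlt j hjk]
            exact hred2 j hjk hij
          · rw [h2]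
            exact ⟨Int.emod_nonneg _ hpos.ne', Int.emod_lt_of_pos _ hpos⟩
    · rintro ρ hρ - ⟨h1, h2, h3⟩
      have hwr : basisOf D (ρ.write vi 0 ((i + 1 : ℕ) : ℤ)) = basisOf D ρ := by
        funext a b; simp [basisOf]
      rw [hwr]
      refine ⟨h1, fun j hj a ha haj => ?_⟩
      rcases (by omega : a < i ∨ a = i) with hai | rfl
      · exact h2 j hj a hai haj
      · exact h3 j hj haj
  · rintro ν hν - ⟨h1, h2⟩
    exact ⟨h1, fun j hj i hij => h2 j hj i (by omega) hij⟩

end RandomAccess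

/-! ### Correctness of the labels -/

namespace RandomAccess

open Finset DecompositionInput RandomAccess.Program RandomAccess.Expr

/-- The labels that respect a set are those that do not leave it. -/
def Respects {r : ℕ} (U : Fin r → Fin r) (T : Set (Fin r)) : Prop := ∀ t, t ∈ T ↔ U t ∈ T

/-- Replace the label of `i` by that of `j`. -/
def relabel {r : ℕ} (U : Fin r → Fin r) (i j : Fin r) (t : Fin r) : Fin r :=
  if U t = U i then U j else U t

theorem relabel_idem {r : ℕ} {U : Fin r → Fin r} (hU : ∀ t, U (U t) = U t) (i j t : Fin r) :
    relabel U i j (relabel U i j t) = relabel U i j t := by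
  by_cases h : U t = U i
  · simp [relabel, h, hU]
  · simp [relabel, h, hU]

/-- Merging two classes imposes exactly one further condition, that i and j are on the same side.
Idempotence of the labels makes the representative stand for its whole class. -/
theorem respects_relabel_iff {r : ℕ} {U : Fin r → Fin r} (hU : ∀ t, U (U t) = U t)
    (i j : Fin r) (T : Set (Fin r)) :
    Respects (relabel U i j) T ↔ Respects U T ∧ (i ∈ T ↔ j ∈ T) := by
  constructor
  · intro h
    have hi : i ∈ T ↔ U j ∈ T := by simpa [relabel] using h i
    have hj : j ∈ T ↔ U j ∈ T := by simpa [relabel] using h j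
    refine ⟨fun t => ?_, hi.trans hj.symm⟩
    have e : relabel U i j (U t) = relabel U i j t := by simp [relabel, hU]
    rw [h t, h (U t), e]
  · rintro ⟨h, hij⟩ t
    by_cases ht : U t = U i
    · simp only [relabel, ht, if_true]
      rw [h t, ht, ← h i, hij, h j]
    · simp only [relabel, ht, if_false]
      exact h t

theorem respects_iff {r : ℕ} {U : Fin r → Fin r} (hU : ∀ t, U (U t) = U t) (T : Set (Fin r)) :
    Respects U T ↔ ∀ i j, U i = U j → (i ∈ T ↔ j ∈ T) := by
  constructor
  · intro h i j e
    rw [h i, h j, e]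
  · exact fun h t => h t (U t) (hU t).symm

/-- The label in a cell belongs to a set. -/
def Marked {r : ℕ} (T : Set (Fin r)) (z : ℤ) : Prop := ∃ l ∈ T, z = ((l : Fin r) : ℕ)

theorem marked_natCast {r : ℕ} {T : Set (Fin r)} (l : Fin r) : Marked T ((l : ℕ) : ℤ) ↔ l ∈ T := by
  constructor
  · rintro ⟨l', h, e⟩
    have : l = l' := Fin.ext (by omega)
    exact this ▸ h
  · exact fun h => ⟨l, h, rfl⟩

variable {V Z n C r : ℕ} {col : ℕ → ℕ → ℤ} {kind : ℕ → ℤ} {μ : Memory} {Q : Memory → Prop}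

/-- The steps of a round of `mergeLabels`. -/
def mergeSteps (Z : ℕ) : ℕ := (1 + (1 + (Z * (1 + 3) + 2))) + 1

/-- A union–find without trees: each non-zero entry merges the classes of its two indices by a pass
over all labels, and the invariant states which sets respect the classes formed so far. -/
theorem total_mergeLabels (h : Loaded n C r col kind μ) (hD : μ vD 0 = (n + C : ℕ))
    (hkind : ∀ c < C, kind c = -1 ∨ ∃ l : Fin r, kind c = (l : ℕ))
    (hlink : ∀ a < C, ∀ c < C, basisOf (n + C) μ (n + a) (n + c) ≠ 0 →
      (0 ≤ kind a ↔ 0 ≤ kind c))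
    (hU : μ aU (-1) = 0) (hr : r ≤ Z) (hC : C * C ≤ Z) (hZV : Z ≤ V)
    (hQ : ∀ ν, AgreeOff mergeLabels.writes μ ν → ∀ U : Fin r → Fin r,
      (∀ t : Fin r, ν aU (t : ℕ) = (U t : ℕ)) → (∀ t, U (U t) = U t) →
      (∀ T : Set (Fin r), Respects U T ↔ ∀ a < C, ∀ c < C,
        basisOf (n + C) μ (n + a) (n + c) ≠ 0 → (Marked T (kind a) ↔ Marked T (kind c))) → Q ν) :
    Total V mergeLabels μ Q ((Z * (1 + 3) + 2) + (Z * (mergeSteps Z + 2) + 2)) := by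
  refine Total.mono (Q := fun ν => ∃ U : Fin r → Fin r,
      (∀ t : Fin r, ν aU (t : ℕ) = (U t : ℕ)) ∧ (∀ t, U (U t) = U t) ∧
      (∀ T : Set (Fin r), Respects U T ↔ ∀ a < C, ∀ c < C,
        basisOf (n + C) μ (n + a) (n + c) ≠ 0 → (Marked T (kind a) ↔ Marked T (kind c))))
    ?_ le_rfl fun ν hν ⟨U, h1, h2, h3⟩ => hQ ν hν U h1 h2 h3
  refine Total.seq (Total.fill (l := 0) (h := r) (o' := 0) (fun t => (t : ℤ)) (by simp) (by omega)
    (by omega) hr ?_ (by decide) (by decide) (by decide) ?_ ?_ ?_)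
  · intro ν hν
    simp [hν vR (by decide), h.r_eq]
  · intro k ν _ _ _ hk _
    exact Total.skip ⟨by simp, by simp [hk]⟩
  · intro k _ _
    simp only [Int.natAbs_natCast]
    omega
  intro μ₁ hμ₁ hf hg _
  have h₁ := h.agree hμ₁ (by decide)
  refine Total.forLoop (l := 0) (h := C * C) (fun m ν => ν aU (-1) = 0 ∧ ∃ U : Fin r → Fin r,
      (∀ t : Fin r, ν aU (t : ℕ) = (U t : ℕ)) ∧ (∀ t, U (U t) = U t) ∧
      (∀ T : Set (Fin r), Respects U T ↔ ∀ x < m,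
        basisOf (n + C) μ (n + x / C) (n + x % C) ≠ 0 →
          (Marked T (kind (x / C)) ↔ Marked T (kind (x % C)))))
    (by simp) (by omega) (by omega) (by omega) ?_ (by decide) ?_ ?_ ?_
  · intro ν hν
    simp [hν vC (by decide), h₁.C_eq]
  · refine ⟨by rw [write_of_array_ne (by decide), hg _ (by omega), hU], id, fun t => ?_,
      fun t => rfl, fun T => by simp [Respects]⟩
    have := hf t (by omega) t.2
    rw [zero_add] at this
    rw [write_of_array_ne (by decide), this, id]
  · rintro m ν - hm hν hvi ⟨hU0, U, hUν, hUU, hUT⟩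
    have hL := h₁.agree hν (by decide)
    have hC0 : 0 < C := Nat.pos_of_ne_zero (by rintro rfl; simp at hm)
    have ha : m / C < C := Nat.div_lt_of_lt_mul hm
    have hc : m % C < C := Nat.mod_lt m hC0
    have hDν : ν vD 0 = (n + C : ℕ) := by rw [hν vD (by decide), hμ₁ vD (by decide), hD]
    have hWν : ν aW = μ aW := by rw [hν aW (by decide), hμ₁ aW (by decide)]
    have hcond : (Expr.read aW ((var vN + var vi / var vC) * var vD + var vN + var vi % var vC)).value
        ν = basisOf (n + C) μ (n + m / C) (n + m % C) := by
      simp only [value_read, value_add, value_mul, value_div, value_mod, value_var, hL.n_eq, hvi,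
        hL.C_eq, hDν, hWν, basisOf]
      congr 1
      push_cast
      ring
    have hka : (Expr.read aKind (var vi / var vC)).value ν = kind (m / C) := by
      simp only [value_read, value_div, value_var, hvi, hL.C_eq]
      exact_mod_cast hL.kind_eq (m / C)
    have hkc : (Expr.read aKind (var vi % var vC)).value ν = kind (m % C) := by
      simp only [value_read, value_mod, value_var, hvi, hL.C_eq]
      exact_mod_cast hL.kind_eq (m % C)
    refine Total.branch ?_ ?_
    · intro hne
      rw [hcond] at hne
      have hl := hlink _ ha _ hc hne
      obtain ⟨x, y, U', hx, hy, hxV, hyV, hU'U', hU', hUT'⟩ : ∃ (x y : ℤ) (U' : Fin r → Fin r),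
          ν aU (kind (m / C)) = x ∧ ν aU (kind (m % C)) = y ∧ x.natAbs ≤ V ∧ y.natAbs ≤ V ∧
          (∀ t, U' (U' t) = U' t) ∧
          (∀ t, ((U' t : ℕ) : ℤ) = if ((U t : ℕ) : ℤ) = x then y else (U t : ℕ)) ∧
          ∀ T : Set (Fin r), Respects U' T ↔ Respects U T ∧
            (Marked T (kind (m / C)) ↔ Marked T (kind (m % C))) := by
        -- By `hlink` the two marks are both -1 or both indices of members. In the first case the
        -- program reads cell -1 of the label array, which always holds 0, and replaces the label 0
        -- by 0, which changes nothing.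
        rcases hkind _ ha with h1 | ⟨i, h1⟩
        · rcases hkind _ hc with h2 | ⟨j, h2⟩
          · refine ⟨0, 0, U, by rw [h1, hU0], by rw [h2, hU0], by simp, by simp, hUU, fun t => ?_,
              fun T => by simp [h1, h2]⟩
            split_ifs with h3
            · exact h3
            · rfl
          · omega
        · rcases hkind _ hc with h2 | ⟨j, h2⟩
          · omega
          · refine ⟨(U i : ℕ), (U j : ℕ), relabel U i j, by rw [h1, hUν], by rw [h2, hUν],
              by have := (U i).2; simp only [Int.natAbs_natCast]; omega,
              by have := (U j).2; simp only [Int.natAbs_natCast]; omega,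
              relabel_idem hUU i j, fun t => ?_, fun T => ?_⟩
            · simp only [relabel, Nat.cast_inj, Fin.val_inj]
              split_ifs <;> rfl
            · rw [respects_relabel_iff hUU, h1, h2, marked_natCast, marked_natCast]
      have hxe : (Expr.read aU (.read aKind (var vi / var vC))).value ν = x := by
        rw [value_read, hka, hx]
      refine Total.seq (Total.set (by rw [hxe]; exact hxV) fun hag₁ => ?_)
      rw [hxe] at hag₁ ⊢
      have hye : (Expr.read aU (.read aKind (var vi % var vC))).value (ν.write vX 0 x) = y := by
        have hL' := hL.agree hag₁ (by decide)
        rw [value_read, show (Expr.read aKind (var vi % var vC)).value (ν.write vX 0 x) =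
          (Expr.read aKind (var vi % var vC)).value ν from rfl, hkc,
          write_of_array_ne (by decide), hy]
      refine Total.seq (Total.set (by rw [hye]; exact hyV) fun hag₂ => ?_)
      rw [hye] at hag₂ ⊢
      refine Total.fill (l := 0) (h := r) (o' := 0)
        (fun t => if ht : t < r then ((U' ⟨t, ht⟩ : ℕ) : ℤ) else 0) (by simp) (by omega) (by omega)
        hr ?_ (by decide) (by decide) (by decide) ?_ ?_ ?_
      · intro ρ hρ
        simp [hρ vR (by decide), hL.r_eq]
      · intro k ρ _ hk hρ hkρ hg'
        refine Total.skip ⟨by simp, ?_⟩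
        have e1 : ρ aU k = (U ⟨k, hk⟩ : ℕ) := by
          rw [hg' _ (Or.inr (by omega)), write_of_array_ne (by decide),
            write_of_array_ne (by decide)]
          exact hUν ⟨k, hk⟩
        have e2 : ρ vX 0 = x := by simp [hρ vX (by decide)]
        have e3 : ρ vY 0 = y := by simp [hρ vY (by decide)]
        -- The conditional replacement is written as arithmetic: the label plus the indicator of
        -- equality times the difference.
        simp only [value_add, value_read, value_var, value_mul, value_sub, value_eq, hkρ, e1, e2,
          e3, hk, dite_true, hU']
        split_ifs <;> ring
      · intro k _ hk
        have := (U' ⟨k, hk⟩).2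
        simp only [hk, dite_true, Int.natAbs_natCast]
        omega
      · intro ρ hρ hf' hg'
        refine ⟨?_, U', fun t => ?_, hU'U', fun T => ?_⟩
        · rw [write_of_array_ne (by decide), hg' _ (Or.inl (by omega)),
            write_of_array_ne (by decide), write_of_array_ne (by decide), hU0]
        · have := hf' t (by omega) t.2
          rw [zero_add] at this
          rw [write_of_array_ne (by decide), this]
          simp
        · rw [hUT', hUT, Nat.forall_lt_succ_right]
          simp [hne]
    · intro heq
      rw [hcond] at heq
      refine Total.mono (s := 1) (Total.skip ?_) (by omega) fun _ _ h => h
      refine ⟨by rw [write_of_array_ne (by decide), hU0], U, fun t => by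
        rw [write_of_array_ne (by decide), hUν], hUU, fun T => ?_⟩
      rw [hUT, Nat.forall_lt_succ_right]
      simp [heq]
  · rintro ν - - ⟨-, U, h1, h2, h3⟩
    refine ⟨U, h1, h2, fun T => ?_⟩
    rw [h3]
    constructor
    · intro h4 a ha c hc hne
      have := h4 (a * C + c) (mul_add_lt ha hc)
      rw [(mul_add_div_mod hc).1, (mul_add_div_mod hc).2] at this
      exact this hne
    · intro h4 x hx
      have hC0 : 0 < C := Nat.pos_of_ne_zero (by rintro rfl; simp at hx)
      exact h4 _ (Nat.div_lt_of_lt_mul hx) _ (Nat.mod_lt x hC0)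

/-- The steps of `writeOutput`. -/
def outputSteps (Z : ℕ) : ℕ := 1 + ((Z * (1 + 1 + 1 + 2) + 2) + (1 + (Z * (1 + 3) + 2)))

/-- The fixed points of the idempotent label map represent the classes, and a class is numbered by
the count of smaller representatives. -/
theorem total_writeOutput (hR : μ vR 0 = r) {U : Fin r → Fin r}
    (hU : ∀ t : Fin r, μ aU (t : ℕ) = (U t : ℕ)) (hUU : ∀ t, U (U t) = U t) (hr : r ≤ Z) (hZV : Z ≤ V)
    (hQ : ∀ ν, AgreeOff writeOutput.writes μ ν → ∀ (s : ℕ) (u : Fin r → Fin s),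
      Function.Surjective u → (∀ i j, u i = u j ↔ U i = U j) → HoldsOutput ν (encodeMap u) → Q ν) :
    Total V writeOutput μ Q (outputSteps Z) := by
  classical
  let p : ℕ → Prop := fun t => μ aU t = t
  have hp : ∀ t : Fin r, p t ↔ U t = t := fun t => by
    simp only [p, hU, Nat.cast_inj, Fin.val_inj]
  have hcr : ∀ t : Fin r, p t → Nat.count p t < Nat.count p r := fun t ht =>
    Nat.count_strict_mono ht t.2
  have hle : ∀ k, Nat.count p k ≤ k := fun k => Nat.count_le p
  let u : Fin r → Fin (Nat.count p r) := fun t =>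
    ⟨Nat.count p (U t), hcr _ ((hp _).mpr (hUU t))⟩
  refine Total.mono (Q := fun ν => HoldsOutput ν (encodeMap u)) ?_ le_rfl
    fun ν hν h' => hQ ν hν _ u ?_ ?_ h'
  · refine Total.seq (Total.set (by simp) fun _ => ?_)
    refine Total.seq (Total.forLoop (l := 0) (h := r) (fun k ν => ν vCount 0 = Nat.count p k ∧
      ∀ t < k, p t → ν aId t = Nat.count p t) (by simp) (by omega) (by omega) (by omega) ?_
      (by decide) (by simp) ?_ ?_)
    · intro ν hν
      simp [hν vR (by decide), hR]
    · rintro k ν - hk hν hkν ⟨hc, hid⟩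
      have hUν : ν aU = μ aU := by rw [hν aU (by decide)]; rfl
      have hcond : (Expr.eq (.read aU (var vt)) (var vt)).value ν = if p k then 1 else 0 := by
        simp [hkν, hUν, p]
      have := hle k
      refine Total.branch ?_ ?_
      · intro hne
        rw [hcond] at hne
        have hpk : p k := by
          by_contra hcon
          exact hne (if_neg hcon)
        refine Total.seq (Total.assign (by simp only [value_var, hc, Int.natAbs_natCast]; omega)
          fun _ => ?_)
        refine Total.set ?_ ⟨?_, ?_⟩
        · simp only [value_add, value_var, value_one, write_of_array_ne (show vCount ≠ aId by decide),
            hc]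
          omega
        · simp [hc, Nat.count_succ, hpk]
        · intro t ht hpt
          rw [write_of_array_ne (by decide), write_of_array_ne (by decide)]
          simp only [value_var, hkν, hc]
          rcases Nat.lt_succ_iff_lt_or_eq.mp ht with h1 | rfl
          · rw [write_of_index_ne (by omega), hid t h1 hpt]
          · rw [write_same]
      · intro heq
        rw [hcond] at heq
        have hpk : ¬p k := by
          intro hcon
          rw [if_pos hcon] at heq
          exact one_ne_zero heq
        refine Total.mono (s := 1) (Total.skip ?_) (by omega) fun _ _ h => h
        refine ⟨?_, ?_⟩
        · simp [hc, Nat.count_succ, hpk]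
        · intro t ht hpt
          rw [write_of_array_ne (by decide)]
          rcases Nat.lt_succ_iff_lt_or_eq.mp ht with h1 | rfl
          · exact hid t h1 hpt
          · exact absurd hpt hpk
    · rintro ν hν - ⟨hc, hid⟩ _
      have hUν : ν aU = μ aU := by rw [hν aU (by decide)]; rfl
      have hRν : ν vR 0 = r := by rw [hν vR (by decide)]; exact hR
      have := hle r
      refine Total.seq (Total.set (by simp only [value_var, hc, Int.natAbs_natCast]; omega)
        fun _ => ?_)
      simp only [value_var, hc]
      refine Total.fill (l := 0) (h := r) (o' := 1)
        (fun t => if ht : t < r then ((u ⟨t, ht⟩ : ℕ) : ℤ) else 0) (by simp) (by omega) (by omega)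
        hr ?_ (by decide) (by decide) (by decide) ?_ ?_ ?_
      · intro ρ hρ
        simp [hρ vR (by decide), hRν]
      · intro k ρ _ hk hρ hkρ _
        refine Total.skip ⟨by simp, ?_⟩
        have e1 : ρ aU k = (U ⟨k, hk⟩ : ℕ) := by
          rw [hρ aU (by decide), write_of_array_ne (by decide), hUν]
          exact hU ⟨k, hk⟩
        have e2 : ρ aId (U ⟨k, hk⟩ : ℕ) = Nat.count p (U ⟨k, hk⟩) := by
          rw [hρ aId (by decide), write_of_array_ne (by decide)]
          exact hid _ (U ⟨k, hk⟩).2 ((hp _).mpr (hUU _))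
        simp only [value_read, value_var, hkρ, e1, e2, hk, dite_true, u]
      · intro k _ hk
        have := (u ⟨k, hk⟩).2
        simp only [hk, dite_true, Int.natAbs_natCast]
        omega
      · intro ρ hρ hf' hg' i
        obtain ⟨i, hi⟩ := i
        rcases i with _ | i
        · have := hg' 0 (Or.inl (by omega))
          simp only [Nat.cast_zero]
          rw [this]
          simp [encodeMap]
        · have hi' : i < r := by simpa [encodeMap] using hi
          have := hf' i (by omega) hi'
          rw [add_comm] at this
          rw [Nat.cast_succ, this]
          simp [encodeMap, hi']
  -- A preimage of k is the representative with exactly k smaller ones.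
  · rintro ⟨k, hk⟩
    have h1 : p (Nat.nth p k) := Nat.nth_mem _ fun hf => by
      exact hk.trans_le (Nat.count_le_card hf r)
    have h2 : Nat.nth p k < r := Nat.nth_lt_of_lt_count hk
    refine ⟨⟨Nat.nth p k, h2⟩, Fin.ext ?_⟩
    have h3 := (hp ⟨_, h2⟩).mp h1
    simp only [u, h3]
    exact Nat.count_nth fun hf => hk.trans_le (Nat.count_le_card hf r)
  · intro i j
    simp only [u, Fin.mk.injEq]
    constructor
    · intro e
      exact Fin.ext (Nat.count_injective ((hp _).mpr (hUU i)) ((hp _).mpr (hUU j)) e)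
    · intro e
      rw [e]

end RandomAccess

/-! ### Correctness of the parser -/

namespace DecompositionInput

open Finset

theorem matrixWord_eq {a b : ℕ} (G : Matrix (Fin a) (Fin b) ℤ) :
    matrixWord G = List.ofFn fun x : Fin (a * b) => G x.divNat x.modNat := by
  rw [List.ofFn_mul, matrixWord]
  congr 2
  funext i
  congr 1
  funext j
  have h := RandomAccess.mul_add_div_mod (i := i) j.2
  congr 1
  · exact Fin.ext h.1.symm
  · exact Fin.ext h.2.symm

theorem length_matrixWord {a b : ℕ} (G : Matrix (Fin a) (Fin b) ℤ) :
    (matrixWord G).length = a * b := by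
  rw [matrixWord_eq, List.length_ofFn]

theorem getElem_matrixWord {a b : ℕ} (G : Matrix (Fin a) (Fin b) ℤ) (i : Fin a) (j : Fin b)
    (h : i * b + j < (matrixWord G).length) : (matrixWord G)[(i * b + j : ℕ)] = G i j := by
  have h' := RandomAccess.mul_add_div_mod (i := i) j.2
  simp only [matrixWord_eq, List.getElem_ofFn]
  congr 1
  · exact Fin.ext h'.1
  · exact Fin.ext h'.2

/-- The columns of a matrix, marked by `z`. -/
def markedColumns {n k : ℕ} (z : ℤ) (G : Matrix (Fin n) (Fin k) ℤ) : List (ℤ × (Fin n → ℤ)) :=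
  List.ofFn fun j => (z, fun i => G i j)

theorem length_markedColumns {n k : ℕ} (z : ℤ) (G : Matrix (Fin n) (Fin k) ℤ) :
    (markedColumns z G).length = k := List.length_ofFn

theorem mem_markedColumns {n k : ℕ} {z : ℤ} {G : Matrix (Fin n) (Fin k) ℤ}
    {p : ℤ × (Fin n → ℤ)} : p ∈ markedColumns z G ↔ p.1 = z ∧ p.2 ∈ Set.range G.col := by
  simp only [markedColumns, List.mem_ofFn, Set.mem_range]
  constructor
  · rintro ⟨j, rfl⟩
    exact ⟨rfl, j, rfl⟩
  · rintro ⟨rfl, j, hj⟩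
    exact ⟨j, Prod.ext rfl hj⟩

variable (X : DecompositionInput)

/-- The columns of the generator matrices of the family. -/
def familyColumns : List (List (ℤ × (Fin X.n → ℤ))) :=
  List.ofFn fun l : Fin X.r => markedColumns ((l : ℕ) : ℤ) (X.generators l)

/-- All columns of the input. -/
def allColumns : List (ℤ × (Fin X.n → ℤ)) :=
  markedColumns (-1) X.relations ++ X.familyColumns.flatten ++
    markedColumns (-1) X.subgroupGenerators

variable {X} in
theorem mem_allColumns {p : ℤ × (Fin X.n → ℤ)} : p ∈ X.allColumns ↔
    (p.1 = -1 ∧ (p.2 ∈ Set.range X.relations.col ∨ p.2 ∈ Set.range X.subgroupGenerators.col)) ∨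
      ∃ l : Fin X.r, p.1 = (l : ℕ) ∧ p.2 ∈ Set.range (X.generators l).col := by
  simp only [allColumns, familyColumns, List.mem_append, mem_markedColumns, List.mem_flatten,
    List.mem_ofFn, exists_exists_eq_and]
  rw [or_right_comm, ← and_or_left]

variable {X} {col : ℕ → ℕ → ℤ} {kind : ℕ → ℤ}

theorem image_columnVector_filter (q : ℤ → Prop) [DecidablePred q]
    (h : ∀ (c : ℕ) (hc : c < X.allColumns.length),
      X.allColumns[c] = (kind c, columnVector X.n col c)) :
    (columnVector X.n col '' ((range X.allColumns.length).filter fun c => q (kind c) : Finset ℕ)) =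
      {v | ∃ z, q z ∧ (z, v) ∈ X.allColumns} := by
  ext v
  simp only [coe_filter, mem_range, Set.mem_image, Set.mem_ofPred_eq]
  constructor
  · rintro ⟨c, ⟨hc, hq⟩, rfl⟩
    exact ⟨kind c, hq, h c hc ▸ List.getElem_mem hc⟩
  · rintro ⟨z, hq, hz⟩
    obtain ⟨c, hc, e⟩ := List.mem_iff_getElem.mp hz
    rw [h c hc, Prod.mk.injEq] at e
    exact ⟨c, ⟨hc, e.1 ▸ hq⟩, e.2⟩

theorem isColumns_allColumns (h : ∀ (c : ℕ) (hc : c < X.allColumns.length),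
    X.allColumns[c] = (kind c, columnVector X.n col c)) :
    X.IsColumns X.allColumns.length col kind := by
  have hlt : ∀ (c : ℕ) (hc : c < X.allColumns.length) (hn : c < X.n),
      X.allColumns[c] = (-1, X.relations.col ⟨c, hn⟩) := by
    intro c hc hn
    have h1 : c < (markedColumns (-1) X.relations).length := by rwa [length_markedColumns]
    simp only [allColumns, List.append_assoc]
    rw [List.getElem_append_left h1]
    simp only [markedColumns, List.getElem_ofFn]
    rfl
  refine ⟨fun c hc => ?_, fun l => ?_, fun c hc hn => ?_, ?_, ?_⟩
  · have h1 := List.getElem_mem hc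
    rw [h c hc, mem_allColumns] at h1
    rcases h1 with ⟨h2, -⟩ | ⟨l, h2, -⟩
    · exact Or.inl h2
    · exact Or.inr ⟨l, h2⟩
  · rw [image_columnVector_filter (fun z => z = (l : ℕ)) h, Matrix.range_mulVecLin]
    congr 1
    ext v
    simp only [Set.mem_ofPred_eq, exists_eq_left, mem_allColumns]
    constructor
    · rintro (⟨h1, -⟩ | ⟨l', h1, h2⟩)
      · omega
      · have : l = l' := Fin.ext (by omega)
        exact this ▸ h2
    · exact fun h1 => Or.inr ⟨l, rfl, h1⟩
  · have := (h c hc).symm.trans (hlt c hc hn)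
    exact (Prod.mk.injEq _ _ _ _ ▸ this).1
  · rw [Matrix.range_mulVecLin]
    congr 1
    ext v
    have hn : X.n ≤ X.allColumns.length := by
      simp only [allColumns, List.length_append, length_markedColumns]
      omega
    simp only [coe_filter, mem_range, Set.mem_image, Set.mem_ofPred_eq, Set.mem_range]
    constructor
    · rintro ⟨c, ⟨hc, hcn⟩, rfl⟩
      have := (h c hc).symm.trans (hlt c hc hcn)
      exact ⟨⟨c, hcn⟩, (Prod.mk.injEq _ _ _ _ ▸ this).2.symm⟩
    · rintro ⟨c, rfl⟩
      have hc := c.2.trans_le hn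
      have := (h c hc).symm.trans (hlt c hc c.2)
      exact ⟨c, ⟨hc, c.2⟩, (Prod.mk.injEq _ _ _ _ ▸ this).2⟩
  · rw [image_columnVector_filter (fun z => z < 0) h, Matrix.range_mulVecLin,
      Matrix.range_mulVecLin, ← Submodule.span_union]
    congr 1
    ext v
    simp only [Set.mem_ofPred_eq, mem_allColumns, Set.mem_union]
    constructor
    · rintro ⟨z, hz, ⟨-, h1⟩ | ⟨l, h1, -⟩⟩
      · exact h1
      · omega
    · exact fun h1 => ⟨-1, by norm_num, Or.inl ⟨rfl, h1⟩⟩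

/-- For n = 0 every submodule of ℤⁿ is zero, so an empty list of columns describes all the spans. -/
theorem isColumns_zero (hn : X.n = 0) (kind : ℕ → ℤ) : X.IsColumns 0 col kind := by
  have : IsEmpty (Fin X.n) := by rw [hn]; infer_instance
  have : Subsingleton (Submodule ℤ (Fin X.n → ℤ)) :=
    (Submodule.subsingleton_iff ℤ).mpr inferInstance
  exact ⟨fun c hc => absurd hc c.not_lt_zero, fun l => Subsingleton.elim _ _,
    fun c hc => absurd hc c.not_lt_zero, Subsingleton.elim _ _, Subsingleton.elim _ _⟩

end DecompositionInput

/-! ### Reading the encoded input -/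

namespace RandomAccess

open Finset DecompositionInput RandomAccess.Program RandomAccess.Expr

theorem initial_of_drop_eq_append {w l l' : List ℤ} {p i : ℕ} (h : w.drop p = l ++ l')
    (hi : i < l.length) : initial w 0 (p + i : ℕ) = l[i] := by
  have h1 : (w.drop p)[i]? = some l[i] := by
    rw [h, List.getElem?_append_left hi, List.getElem?_eq_getElem hi]
  rw [List.getElem?_drop] at h1
  simp only [initial, true_and, Int.natCast_nonneg, if_true, Int.toNat_natCast,
    List.getD_eq_getElem?_getD, h1, Option.getD_some]

theorem initial_of_drop_eq_cons {w l : List ℤ} {p : ℕ} {z : ℤ} (h : w.drop p = z :: l) :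
    initial w 0 (p : ℕ) = z :=
  initial_of_drop_eq_append (l := [z]) (i := 0) h (by simp)

theorem drop_add_of_drop_eq_append {w l l' : List ℤ} {p : ℕ} (h : w.drop p = l ++ l') :
    w.drop (p + l.length) = l' := by
  rw [← List.drop_drop, h, List.drop_left]

theorem add_length_le_of_drop_eq_append {w l l' : List ℤ} {p : ℕ} (h : w.drop p = l ++ l')
    (hp : p ≤ w.length) : p + l.length ≤ w.length := by
  have := congrArg List.length h
  simp only [List.length_drop, List.length_append] at this
  omega

/-- The columns in the list are registered in the memory. -/
structure Registered (n : ℕ) (cols : List (ℤ × (Fin n → ℤ))) (μ : Memory) : Prop where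
  length_eq : μ vC 0 = cols.length
  getElem_eq : ∀ (c : ℕ) (hc : c < cols.length), cols[c] =
    (μ aKind c, columnVector n (fun c i => μ 0 (μ aBase c + i * μ aStr c)) c)

variable {V Z : ℕ} {μ : Memory} {Q : Memory → Prop}

theorem Registered.agree {n : ℕ} {cols : List (ℤ × (Fin n → ℤ))} {ν : Memory}
    (h : Registered n cols μ) {l : List ℕ} (hag : AgreeOff l μ ν)
    (hl : ∀ a ∈ [0, vC, aBase, aStr, aKind], a ∉ l) : Registered n cols ν := by
  have h0 := hag 0 (hl 0 (by decide))
  have h1 := hag vC (hl vC (by decide))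
  have h2 := hag aBase (hl aBase (by decide))
  have h3 := hag aStr (hl aStr (by decide))
  have h4 := hag aKind (hl aKind (by decide))
  exact ⟨h1 ▸ h.length_eq, by rw [h0, h2, h3, h4]; exact h.getElem_eq⟩

/-- The state of the parser: the columns in the list are registered, and the input from the
current position on is `l`. -/
structure Parsing (n : ℕ) (w : List ℤ) (cols : List (ℤ × (Fin n → ℤ))) (l : List ℤ) (μ : Memory) :
    Prop where
  input_eq : μ 0 = initial w 0
  n_eq : μ vN 0 = n
  registered : Registered n cols μ
  exists_pos : ∃ p : ℕ, μ vPos 0 = p ∧ cols.length ≤ p ∧ p ≤ w.length ∧ w.drop p = l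

theorem Parsing.agree {n : ℕ} {w : List ℤ} {cols : List (ℤ × (Fin n → ℤ))} {l : List ℤ}
    {ν : Memory} (h : Parsing n w cols l μ) {s : List ℕ} (hag : AgreeOff s μ ν)
    (hl : ∀ a ∈ [0, vN, vPos, vC, aBase, aStr, aKind], a ∉ s) : Parsing n w cols l ν := by
  have h0 := hag 0 (hl 0 (by decide))
  have h1 := hag vN (hl vN (by decide))
  have h2 := hag vPos (hl vPos (by decide))
  refine ⟨h0 ▸ h.input_eq, h1 ▸ h.n_eq, h.registered.agree hag fun a ha => hl a ?_,
    h2 ▸ h.exists_pos⟩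
  simp only [List.mem_cons, List.not_mem_nil, or_false] at ha ⊢
  tauto

theorem Parsing.read {n : ℕ} {w : List ℤ} {cols : List (ℤ × (Fin n → ℤ))} {l : List ℤ} {z : ℤ}
    (h : Parsing n w cols (z :: l) μ) : (Expr.read 0 (var vPos)).value μ = z := by
  obtain ⟨p, hp, -, -, hw⟩ := h.exists_pos
  rw [value_read, value_var, hp, h.input_eq, initial_of_drop_eq_cons hw]

theorem Parsing.advance {n : ℕ} {w : List ℤ} {cols : List (ℤ × (Fin n → ℤ))} {l : List ℤ} {z : ℤ}
    (h : Parsing n w cols (z :: l) μ) (hV : w.length ≤ V)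
    (hQ : Parsing n w cols l (μ.write vPos 0 ((var vPos + 1).value μ)) →
      Q (μ.write vPos 0 ((var vPos + 1).value μ))) : Total V (set vPos (var vPos + 1)) μ Q 1 := by
  obtain ⟨p, hp, hc, hpw, hw⟩ := h.exists_pos
  have h1 := add_length_le_of_drop_eq_append (l := [z]) hw hpw
  have h2 := drop_add_of_drop_eq_append (l := [z]) hw
  simp only [List.length_singleton] at h1 h2
  have e : (var vPos + 1).value μ = ((p + 1 : ℕ) : ℤ) := by simp [hp]
  refine Total.set (by rw [e]; omega) (hQ ?_)
  have hag := agreeOff_write μ vPos 0 ((var vPos + 1).value μ)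
  refine ⟨by rw [hag 0 (by decide), h.input_eq], by rw [hag vN (by decide), h.n_eq],
    h.registered.agree hag (by decide), p + 1, by rw [e, write_same], by omega, h1, h2⟩

/-- The steps of `loadBlock`. -/
def blockSteps (Z : ℕ) : ℕ := (Z * ((1 + (1 + (1 + 1))) + 2) + 2) + 1

/-- Matrices are stored row by row, so a column is given by the position of its first entry and the
row length as stride; nothing is copied. As n > 0, the number of columns is at most the number of
entries, hence bounded by the length of the input. -/
theorem total_loadBlock {n k : ℕ} {w : List ℤ} {cols : List (ℤ × (Fin n → ℤ))} {l : List ℤ}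
    {G : Matrix (Fin n) (Fin k) ℤ} {z : ℤ} (h : Parsing n w cols (matrixWord G ++ l) μ)
    (hn : 0 < n) (hk : μ vK 0 = k) (hz : μ vLab 0 = z) (hzV : z.natAbs ≤ V) (hZ : w.length ≤ Z)
    (hZV : Z ≤ V)
    (hQ : ∀ ν, AgreeOff loadBlock.writes μ ν → Parsing n w (cols ++ markedColumns z G) l ν → Q ν) :
    Total V loadBlock μ Q (blockSteps Z) := by
  refine Total.mono (Q := Parsing n w (cols ++ markedColumns z G) l) ?_ le_rfl hQ
  obtain ⟨p, hp, hc, hpw, hw⟩ := h.exists_pos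
  have h1 := add_length_le_of_drop_eq_append hw hpw
  have h2 := drop_add_of_drop_eq_append hw
  rw [length_matrixWord] at h1 h2
  have hkn : k ≤ n * k := Nat.le_mul_of_pos_left k hn
  have hlen : ∀ c ≤ k, ((markedColumns z G).take c).length = c := fun c hc => by
    rw [List.length_take, length_markedColumns, min_eq_left hc]
  refine Total.seq (Total.forLoop (l := 0) (h := k) (fun c ν =>
    Registered n (cols ++ (markedColumns z G).take c) ν) (by simp) (by omega) (by omega) (by omega)
    ?_ (by decide) ?_ ?_ ?_)
  · intro ν hν
    simp [hν vK (by decide), hk]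
  · rw [List.take_zero, List.append_nil]
    exact h.registered.agree (agreeOff_write _ _ _ _) (by decide)
  · intro c ν _ hck hν hcν hR
    have hKν : ν vK 0 = k := by rw [hν vK (by decide), hk]
    have hLν : ν vLab 0 = z := by rw [hν vLab (by decide), hz]
    have hPν : ν vPos 0 = p := by rw [hν vPos (by decide), hp]
    have h0ν : ν 0 = initial w 0 := by rw [hν 0 (by decide), h.input_eq]
    have hCν : ν vC 0 = ((cols.length + c : ℕ) : ℤ) := by
      rw [hR.length_eq, List.length_append, hlen c hck.le]
    have hget := hR.getElem_eq
    refine Total.seq (Total.assign ?_ fun _ => Total.seq (Total.assign ?_ fun _ =>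
      Total.seq (Total.assign ?_ fun _ => Total.set ?_ ?_)))
    · simp only [value_add, value_var, hPν, hcν]
      omega
    · simp [hKν]
      omega
    · simpa [hLν] using hzV
    · simp [hCν]
      omega
    · have hk' : c < (markedColumns z G).length := by rwa [length_markedColumns]
      refine ⟨by simp [hCν, hlen, hck, add_assoc], ?_⟩
      intro c' hc'
      rw [List.take_succ_eq_append_getElem hk', ← List.append_assoc] at hc'
      simp only [List.take_succ_eq_append_getElem hk', ← List.append_assoc]
      simp only [List.length_append, hlen c hck.le, List.length_singleton] at hc'
      -- Earlier columns are unaffected, since only the cell at the current end of the tables is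
      -- written; the remaining case is the new column.
      rcases Nat.lt_succ_iff_lt_or_eq.mp hc' with h3 | rfl
      · have h3' : c' < (cols ++ (markedColumns z G).take c).length := by
          rwa [List.length_append, hlen c hck.le]
        have hne : (c' : ℤ) ≠ ((cols.length + c : ℕ) : ℤ) := by omega
        rw [List.getElem_append_left h3', hget c' h3']
        push_cast at hne
        refine Prod.ext ?_ (funext fun i => ?_)
        · simp [Memory.write, hCν, hne]
        · simp [columnVector, Memory.write, hCν, hne]
      · rw [List.getElem_append_right (by rw [List.length_append, hlen c hck.le])]
        simp only [List.getElem_singleton, markedColumns, List.getElem_ofFn]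
        refine Prod.ext ?_ (funext fun i => ?_)
        · simp [Memory.write, hCν, hLν]
        · have h4 : i * k + c < (matrixWord G).length := by
            rw [length_matrixWord]
            exact mul_add_lt i.2 hck
          have h5 := initial_of_drop_eq_append hw h4
          rw [getElem_matrixWord G i ⟨c, hck⟩] at h5
          refine h5.symm.trans ?_
          simp only [columnVector]
          simp [Memory.write, hPν, hcν, hKν, hCν, h0ν]
          congr 1
          ring
  · intro ν hν hcν hR
    rw [List.take_of_length_le (by rw [length_markedColumns])] at hR
    have e : (var vPos + var vN * var vK).value ν = ((p + n * k : ℕ) : ℤ) := by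
      simp [hν vPos (by decide), hν vN (by decide), hν vK (by decide), hp, h.n_eq, hk]
    refine fun _ => Total.set (by rw [e]; omega) ?_
    have hag := agreeOff_write ν vPos 0 ((var vPos + var vN * var vK).value ν)
    refine ⟨by rw [hag 0 (by decide), hν 0 (by decide), h.input_eq],
      by rw [hag vN (by decide), hν vN (by decide), h.n_eq], hR.agree hag (by decide),
      p + n * k, by rw [e, write_same], ?_, h1, h2⟩
    rw [List.length_append, length_markedColumns]
    omega

/-- The steps of `loadNext`. -/
def nextSteps (Z : ℕ) : ℕ := 1 + (1 + (1 + blockSteps Z))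

theorem total_loadNext {n k : ℕ} {w : List ℤ} {cols : List (ℤ × (Fin n → ℤ))} {l : List ℤ}
    {G : Matrix (Fin n) (Fin k) ℤ} {z : ℤ} {lab : Expr}
    (h : Parsing n w cols ((k : ℤ) :: matrixWord G ++ l) μ) (hn : 0 < n)
    (hlab : ∀ ν, AgreeOff [vK, vPos] μ ν → lab.value ν = z) (hzV : z.natAbs ≤ V)
    (hkV : k ≤ V) (hZ : w.length ≤ Z) (hZV : Z ≤ V)
    (hQ : ∀ ν, AgreeOff (loadNext lab).writes μ ν → Parsing n w (cols ++ markedColumns z G) l ν →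
      Q ν) :
    Total V (loadNext lab) μ Q (nextSteps Z) := by
  refine Total.mono (Q := Parsing n w (cols ++ markedColumns z G) l) ?_ le_rfl hQ
  have hk : (Expr.read 0 (var vPos)).value μ = k := Parsing.read h
  refine Total.seq (Total.set (by rw [hk]; omega) fun hag => ?_)
  rw [hk] at hag ⊢
  have h₁ := h.agree hag (by decide)
  refine Total.seq (h₁.advance (by omega) fun h₂ hag₂ => ?_)
  have hag' := (hag.mono (l' := [vK, vPos]) (by decide)).trans
    (hag₂.mono (l' := [vK, vPos]) (by decide))
  have hl := hlab _ hag'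
  refine Total.seq (Total.set (by rw [hl]; exact hzV) fun hag₃ => ?_)
  replace hag₃ : AgreeOff [vLab] _ _ := hag₃
  refine total_loadBlock (h₂.agree hag₃ (by decide)) hn ?_ ?_ hzV hZ hZV fun ν _ h => h
  · rw [hag₃ vK (by decide), hag₂ vK (by decide), write_same]
  · rw [hl, write_same]

/-- The words of the members of the family. -/
def familyWords (X : DecompositionInput) : List (List ℤ) :=
  List.ofFn fun l => (X.k l : ℤ) :: matrixWord (X.generators l)

theorem encode_eq (X : DecompositionInput) : X.encode = (X.n : ℤ) :: (matrixWord X.relations ++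
    ((X.r : ℤ) :: ((familyWords X).flatten ++ ((X.m : ℤ) :: matrixWord X.subgroupGenerators)))) := by
  simp [encode, familyWords]

theorem le_length_flatten {l : List (List ℤ)} (h : ∀ x ∈ l, x ≠ []) :
    l.length ≤ l.flatten.length := by
  induction l with
  | nil => simp
  | cons x l ih =>
    have h1 := ih fun y hy => h y (List.mem_cons_of_mem _ hy)
    have h2 := List.length_pos_of_ne_nil (h x List.mem_cons_self)
    simp only [List.length_cons, List.flatten_cons, List.length_append]
    omega

/-- Each member contributes at least the entry k_i to the word, even if its matrix is empty. -/
theorem card_family_le_length_encode (X : DecompositionInput) : X.r ≤ X.encode.length := by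
  have h1 : (familyWords X).length = X.r := List.length_ofFn
  have h2 : (familyWords X).length ≤ (familyWords X).flatten.length :=
    le_length_flatten fun x hx => by
      obtain ⟨l, rfl⟩ := List.mem_ofFn.mp hx
      simp
  rw [encode_eq]
  simp only [List.length_cons, List.length_append]
  omega

theorem rank_le_length_encode (X : DecompositionInput) : X.n ≤ X.encode.length := by
  have h1 := Nat.le_mul_self X.n
  rw [encode_eq]
  simp only [List.length_cons, List.length_append, length_matrixWord]
  omega

/-- The steps of `parse`. -/
def parseSteps (Z : ℕ) : ℕ :=
  1 + (1 + ((1 + (1 + (blockSteps Z + (1 + (1 + ((Z * (nextSteps Z + 2) + 2) +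
    nextSteps Z)))))) + 1))

theorem total_parse (X : DecompositionInput) (hB : Bounded V (initial X.encode))
    (hZ : X.encode.length ≤ Z) (hZV : Z ≤ V)
    (hQ : ∀ ν, AgreeOff parse.writes (initial X.encode) ν → ∀ C col kind,
      Loaded X.n C X.r col kind ν → X.IsColumns C col kind → C ≤ X.encode.length →
      (∀ c i, ∃ j, col c i = initial X.encode 0 j) → Q ν) :
    Total V parse (initial X.encode) Q (parseSteps Z) := by
  refine Total.mono (Q := fun ν => ∃ C col kind, Loaded X.n C X.r col kind ν ∧
    X.IsColumns C col kind ∧ C ≤ X.encode.length ∧ ∀ c i, ∃ j, col c i = initial X.encode 0 j)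
    ?_ le_rfl fun ν hν ⟨C, col, kind, h1, h2, h3, h4⟩ => hQ ν hν C col kind h1 h2 h3 h4
  have hw := encode_eq X
  have hr := card_family_le_length_encode X
  have hn := rank_le_length_encode X
  have hlen : 1 ≤ X.encode.length := by rw [hw]; simp
  generalize hμ : initial X.encode = μ at hB ⊢
  have h0 : μ 0 = initial X.encode 0 := by rw [hμ]
  have hvar : ∀ a, a ≠ 0 → ∀ i, μ a i = 0 := fun a ha i => by simp [← hμ, initial, ha]
  have e1 : (Expr.read 0 0).value μ = X.n := by
    rw [value_read, h0, hw]
    exact initial_of_drop_eq_cons (p := 0) rfl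
  refine Total.seq (Total.set (by rw [e1]; omega) fun hag₁ => ?_)
  rw [e1] at hag₁ ⊢
  refine Total.seq (Total.set (by rw [value_one, Int.natAbs_one]; omega) fun hag₂ => ?_)
  rw [value_one] at hag₂ ⊢
  generalize hμ₂ : (μ.write vN 0 X.n).write vPos 0 1 = μ₂ at hag₂ ⊢
  have hn₂ : μ₂ vN 0 = X.n := by simp [← hμ₂]
  have h0₂ : μ₂ 0 = initial X.encode 0 := by rw [hag₂ 0 (by decide), hag₁ 0 (by decide), h0]
  have hC₂ : μ₂ vC 0 = 0 := by
    rw [hag₂ vC (by decide), hag₁ vC (by decide), hvar vC (by decide)]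
  refine Total.branch ?_ ?_
  · intro hne
    have hn0 : 0 < X.n := by
      rw [value_var, hn₂] at hne
      omega
    have hP : Parsing X.n X.encode [] (matrixWord X.relations ++ ((X.r : ℤ) ::
        ((familyWords X).flatten ++ ((X.m : ℤ) :: matrixWord X.subgroupGenerators)))) μ₂ :=
      ⟨h0₂, hn₂, ⟨by simp [hC₂], fun c hc => absurd hc (by simp)⟩, 1, by simp [← hμ₂], by simp,
        hlen, by rw [hw]; rfl⟩
    refine Total.seq (Total.set (by simp [hn₂]; omega) fun hag₃ => ?_)
    rw [value_var, hn₂] at hag₃ ⊢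
    refine Total.seq (Total.set (by simp; omega) fun hag₄ => ?_)
    refine Total.seq (total_loadBlock (k := X.n) (z := -1) ((hP.agree hag₃ (by decide)).agree hag₄
      (by decide)) hn0 ?_ ?_ (by simp; omega) hZ hZV ?_)
    · simp
    · simp
    intro μ₅ _ hP₅ _
    have e₅ := hP₅.read
    refine Total.seq (Total.set (by rw [e₅]; omega) fun hag₆ => ?_)
    rw [e₅] at hag₆ ⊢
    refine Total.seq ((hP₅.agree hag₆ (by decide)).advance (by omega) fun hP₇ hag₇ => ?_)
    generalize (Memory.write _ vPos 0 _) = μ₇ at hP₇ hag₇ ⊢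
    have hR₇ : μ₇ vR 0 = X.r := by rw [hag₇ vR (by decide), write_same]
    have hlw : (familyWords X).length = X.r := List.length_ofFn
    have hlc : X.familyColumns.length = X.r := List.length_ofFn
    refine Total.seq (Total.forLoop (l := 0) (h := X.r) (fun l ν => Parsing X.n X.encode
      (markedColumns (-1) X.relations ++ (X.familyColumns.take l).flatten)
      (((familyWords X).drop l).flatten ++ ((X.m : ℤ) :: matrixWord X.subgroupGenerators)) ν)
      (by simp) (by omega) (by omega) (by omega) ?_ (by decide) ?_ ?_ ?_)
    · intro ν hν
      simp [hν vR (by decide), hR₇]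
    · simp only [List.take_zero, List.drop_zero, List.flatten_nil, List.append_nil]
      rw [List.nil_append] at hP₇
      exact hP₇.agree (agreeOff_write _ _ _ _) (by decide)
    · intro l ν _ hl hν hlν hPν
      have hl1 : l < (familyWords X).length := by omega
      have hl2 : l < X.familyColumns.length := by omega
      have hPl := hPν
      rw [List.drop_eq_getElem_cons hl1, List.flatten_cons, List.append_assoc] at hPl
      simp only [familyWords, List.getElem_ofFn] at hPl
      refine total_loadNext (k := X.k ⟨l, hl⟩) (z := (l : ℤ)) (G := X.generators ⟨l, hl⟩)
        (n := X.n) hPl hn0 ?_ ?_ ?_ hZ hZV ?_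
      · intro ρ hρ
        rw [value_var, hρ vl (by decide), hlν]
      · rw [Int.natAbs_natCast]
        omega
      -- The number of columns is itself an entry of the input and is bounded as such.
      · have h1 := hPl.read
        rw [value_read, hPν.input_eq, ← h0] at h1
        have h2 := hB 0 ((var vPos).value ν)
        rw [h1] at h2
        simpa using h2
      · intro ρ hρ hPρ
        rw [List.take_succ_eq_append_getElem hl2, List.flatten_append, ← List.append_assoc]
        simp only [familyColumns, List.getElem_ofFn, List.flatten_singleton]
        exact hPρ.agree (agreeOff_write _ _ _ _) (by decide)
    · intro ν hν _ hPν _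
      rw [List.take_of_length_le hlc.le, List.drop_of_length_le hlw.le, List.flatten_nil,
        List.nil_append] at hPν
      have hRν : ν vR 0 = X.r := by rw [hν vR (by decide), hR₇]
      refine total_loadNext (k := X.m) (z := -1) (G := X.subgroupGenerators) (l := [])
        (by rwa [List.append_nil]) hn0 (fun ρ hρ => by simp) (by simp; omega) ?_ hZ hZV ?_
      · have h1 := hPν.read
        rw [value_read, hPν.input_eq, ← h0] at h1
        have h2 := hB 0 ((var vPos).value ν)
        rw [h1] at h2
        simpa using h2
      · intro ρ hρ hPρ
        obtain ⟨p, -, hp1, hp2, -⟩ := hPρ.exists_pos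
        refine ⟨X.allColumns.length, fun c i => ρ 0 (ρ aBase c + i * ρ aStr c),
          fun c => ρ aKind c, ⟨hPρ.n_eq, hPρ.registered.length_eq, ?_, fun _ _ => rfl,
            fun _ => rfl⟩, isColumns_allColumns hPρ.registered.getElem_eq, hp1.trans hp2,
          fun c i => ⟨_, by rw [hPρ.input_eq, h0]⟩⟩
        rw [hρ vR (by decide), hRν]
  -- For n = 0 the matrices have no entries, so the numbers k_i and m, written in binary, may be
  -- exponential in the length of the input and must not be used as loop limits. Only r is read,
  -- directly after n.
  · intro heq
    have hn0 : X.n = 0 := by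
      rw [value_var, hn₂] at heq
      exact_mod_cast heq
    have e₃ : (Expr.read 0 1).value μ₂ = X.r := by
      rw [value_read, h0₂]
      refine initial_of_drop_eq_cons (p := 1) (l := (familyWords X).flatten ++
        ((X.m : ℤ) :: matrixWord X.subgroupGenerators)) ?_
      rw [hw]
      have : matrixWord X.relations = [] := by
        rw [← List.length_eq_zero_iff, length_matrixWord, hn0]
      rw [this]
      rfl
    refine Total.mono (s := 1) (Total.set (by rw [e₃]; omega) ?_) (by omega) fun _ _ h => h
    rw [e₃]
    have hag₃ := agreeOff_write μ₂ vR 0 X.r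
    refine ⟨0, _, _, ⟨by rw [hag₃ vN (by decide), hn₂], ?_, write_same _ _ _, fun _ _ => rfl,
      fun _ => rfl⟩, isColumns_zero hn0 _, Nat.zero_le _,
      fun c i => ⟨_, by rw [hag₃ 0 (by decide), h0₂, h0]⟩⟩
    rw [hag₃ vC (by decide), hC₂]
    rfl

end RandomAccess

/-! ### The algorithm runs in polynomial time -/

namespace ModuleDecomposition

theorem splits_univ {R : Type*} [Ring R] {M : Type*} [AddCommGroup M] [Module R M] {I : Type*}
    {𝒜 : I → Submodule R M} (h : IsDecomposition 𝒜) (B : Submodule R M) :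
    Splits 𝒜 B Set.univ := by
  intro b hb
  refine ⟨b, ?_, 0, zero_mem _, by simp, hb⟩
  have : part 𝒜 Set.univ = ⊤ := by
    rw [← (isDecomposition_iff.mp h).2]
    simp [part]
  rw [this]
  exact Submodule.mem_top

end ModuleDecomposition

namespace FaddeevLeVerrier

theorem lastNonzero_ne_zero (n : ℕ) (A : ℕ → ℕ → ℤ) : lastNonzero n A n ≠ 0 := by
  obtain ⟨k, -, h1, h2, -⟩ := exists_lastNonzero n A n
  rw [h2]
  exact h1

theorem natAbs_lastNonzero_le {n β : ℕ} {A : ℕ → ℕ → ℤ} (hβ : 2 ≤ β) (hn : n ≤ β)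
    (hA : ∀ i < n, ∀ j < n, (A i j).natAbs ≤ β) : (lastNonzero n A n).natAbs ≤ β ^ (6 * n) := by
  obtain ⟨k, hk, -, h2, -⟩ := exists_lastNonzero n A n
  rw [h2]
  exact (natAbs_step_le hβ hn hA k).2.trans (Nat.pow_le_pow_right (by omega) (by omega))

end FaddeevLeVerrier

namespace RandomAccess

open Finset DecompositionInput ModuleDecomposition FaddeevLeVerrier RandomAccess.Program
  RandomAccess.Expr

theorem length_le_wordLength (w : List ℤ) : w.length ≤ wordLength w := by
  induction w with
  | nil => simp
  | cons z w ih =>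
    simp only [wordLength, List.map_cons, List.sum_cons, List.length_cons, bitLength] at ih ⊢
    omega

theorem bounded_initial (w : List ℤ) : Bounded (2 ^ wordLength w) (initial w) := by
  intro a i
  unfold initial
  split_ifs
  · rw [List.getD_eq_getElem?_getD]
    rcases h : w[i.toNat]? with _ | z
    · simp
    · have h1 : bitLength z ≤ wordLength w :=
        List.single_le_sum (fun _ _ => Nat.zero_le _) _
          (List.mem_map_of_mem (List.mem_of_getElem? h))
      unfold bitLength at h1
      calc z.natAbs ≤ 2 ^ z.natAbs.size := (Nat.lt_size_self _).le
        _ ≤ _ := Nat.pow_le_pow_right (by omega) (by omega)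
  · simp

/-- The sum has at most L² squares of numbers below 2^L, so it is at most 2^(4L); the factor 16
leaves room for the linear terms. -/
theorem size_le {n C r L : ℕ} {col : ℕ → ℕ → ℤ} (hn : n ≤ L) (hC : C ≤ L) (hr : r ≤ L)
    (hcol : ∀ c i, (col c i).natAbs ≤ 2 ^ L) : size n C r col ≤ 2 ^ (4 * (L + 1)) := by
  have hL : L ≤ 2 ^ L := (Nat.lt_two_pow_self).le
  have h1 : sumSquares n C col ≤ 2 ^ (4 * L) := by
    calc sumSquares n C col ≤ ∑ c ∈ range C, ∑ i ∈ range n, (2 ^ L * 2 ^ L : ℤ) := by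
          refine sum_le_sum fun c _ => sum_le_sum fun i _ => ?_
          rw [← Int.natAbs_mul_self']
          have := hcol c i
          exact_mod_cast Nat.mul_le_mul this this
      _ = ((C * n * (2 ^ L * 2 ^ L) : ℕ) : ℤ) := by simp [mul_assoc]
      _ ≤ ((2 ^ L * 2 ^ L * (2 ^ L * 2 ^ L) : ℕ) : ℤ) := by
          exact_mod_cast Nat.mul_le_mul_right _ (Nat.mul_le_mul (hC.trans hL) (hn.trans hL))
      _ = 2 ^ (4 * L) := by push_cast; ring
  have h2 : (2 : ℤ) ^ (4 * (L + 1)) = 16 * 2 ^ (4 * L) := by ring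
  have h3 : L ≤ 2 ^ (4 * L) := hL.trans (Nat.pow_le_pow_right (by omega) (by omega))
  have h4 : (1 : ℤ) ≤ 2 ^ (4 * L) := one_le_pow₀ (by norm_num)
  have h5 : (L : ℤ) ≤ 2 ^ (4 * L) := by exact_mod_cast h3
  unfold size
  rw [h2]
  omega

/-- A bound for the numbers of rounds of the loops on an input of length `L`. -/
def loopBound (L : ℕ) : ℕ := 128 * (L + 1) ^ 2 + 1

/-- A bound for the numbers that occur on an input of length `L`. -/
def valueBound (L : ℕ) : ℕ := 2 ^ (128 * (L + 1) ^ 2)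

/-- The constant 128 in `valueBound` is the product of the 4 from `size_le` and the 32 = 12 + 20
from the exponents of t² and of β in the modulus. -/
theorem pow_le_valueBound {β L m : ℕ} (hβ : β ≤ 2 ^ (4 * (L + 1))) (hβ1 : 1 ≤ β)
    (hm : m ≤ 32 * (L + 1)) : β ^ m ≤ valueBound L := by
  calc β ^ m ≤ β ^ (32 * (L + 1)) := Nat.pow_le_pow_right hβ1 hm
    _ ≤ (2 ^ (4 * (L + 1))) ^ (32 * (L + 1)) := Nat.pow_le_pow_left hβ _
    _ = valueBound L := by rw [valueBound, ← pow_mul]; ring_nf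

theorem loopBound_le_valueBound (L : ℕ) : loopBound L ≤ valueBound L := Nat.lt_two_pow_self

/-- The bit length of all values doubles as the bound for all loops, in particular for the rounds of
the Euclidean algorithm. -/
theorem size_valueBound (L : ℕ) : (valueBound L).size = loopBound L := Nat.size_pow

/-- The steps of the algorithm. -/
def mainSteps (Z : ℕ) : ℕ :=
  parseSteps Z + ((Z * 3 + 3 + 1) + ((Z * (Z * 3 + 3 + 3) + 2) + (leverrierSteps Z +
    ((1 + (Z * (1 + 2) + 2)) + ((1 + (Z * (1 + 3) + 2)) +
      ((Z * ((Z * (1 + 3) + 2) + insertSteps Z + 2) + 2) + (reduceSteps Z +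
        (((Z * (1 + 3) + 2) + (Z * (mergeSteps Z + 2) + 2)) + outputSteps Z))))))))

theorem total_mainProgram.{w} (X : DecompositionInput) (hdec : IsDecomposition X.family) :
    Total (valueBound (wordLength X.encode)) mainProgram (initial X.encode)
      (fun ν => ∃ (s : ℕ) (u : Fin X.r → Fin s), HoldsOutput ν (encodeMap u) ∧
        IsUniversalRestricting.{w} X.family X.subgroup u)
      (mainSteps (loopBound (wordLength X.encode))) := by
  have hlen := length_le_wordLength X.encode
  have hn := (rank_le_length_encode X).trans hlen
  have hr := (card_family_le_length_encode X).trans hlen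
  have hB := bounded_initial X.encode
  have h0 : ∀ a, a ≠ 0 → ∀ i, initial X.encode a i = 0 := fun a ha i => by simp [initial, ha]
  generalize hL : wordLength X.encode = L at *
  have hZV := loopBound_le_valueBound L
  -- The first term covers the (n + C)² entries of the basis, the second one the loop that
  -- multiplies up the modulus.
  have hZ : 4 * (L * L) + 20 * (L + 1) ≤ loopBound L := by
    unfold loopBound
    nlinarith
  have hLL := Nat.le_mul_self L
  have hV2 : 2 ^ L ≤ valueBound L := Nat.pow_le_pow_right (by omega) (by nlinarith)
  refine Total.seq (total_parse X (fun a i => (hB a i).trans hV2) (by omega) hZV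
    fun μ₁ hμ₁ C col kind hL₁ hX hC hcol _ => ?_)
  have hC' : C ≤ L := hC.trans hlen
  have hcol' : ∀ c i, (col c i).natAbs ≤ 2 ^ L := fun c i => by
    obtain ⟨j, hj⟩ := hcol c i
    rw [hj]
    exact hB 0 j
  have hprod : ∀ {a b : ℕ}, a ≤ L → b ≤ L → a * b ≤ L * L := fun ha hb => Nat.mul_le_mul ha hb
  have hnn := hprod hn hn
  have hCn := hprod hC' hn
  have hCC := hprod hC' hC'
  have hD : (X.n + C) * (X.n + C) ≤ loopBound L := by
    have : (X.n + C) * (X.n + C) = X.n * X.n + 2 * (C * X.n) + C * C := by ring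
    omega
  have hs0 := sumSquares_nonneg X.n C col
  obtain ⟨β, hβ⟩ : ∃ β : ℕ, size X.n C X.r col = β :=
    Int.eq_ofNat_of_zero_le (by unfold size; omega)
  have hβL : β ≤ 2 ^ (4 * (L + 1)) := by
    have := size_le hn hC' hr hcol'
    rw [hβ] at this
    exact_mod_cast this
  have hβ2 : 2 ≤ β := by unfold size at hβ; omega
  have hnβ : X.n ≤ β := by unfold size at hβ; omega
  have hCβ : C ≤ β := by unfold size at hβ; omega
  have hsβ : sumSquares X.n C col ≤ β := by unfold size at hβ; omega
  have hpow : ∀ {m : ℕ}, m ≤ 32 * (L + 1) → β ^ m ≤ valueBound L := fun hm =>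
    pow_le_valueBound hβL (by omega) hm
  have hβV : β ≤ valueBound L := by simpa using hpow (m := 1) (by omega)
  refine Total.seq (total_computeBeta hL₁ (by omega) hZV (by omega) fun μ₂ hμ₂ hβ₂ _ => ?_)
  have hL₂ := hL₁.agree hμ₂ (by decide)
  refine Total.seq (total_computeGram hL₂ (by omega) (by omega) hZV (by omega)
    fun μ₃ hμ₃ hgram _ => ?_)
  have hL₃ := hL₂.agree hμ₃ (by decide)
  have hw : ∀ c, negWeight kind c = 0 ∨ negWeight kind c = 1 := fun c => by
    unfold negWeight; split_ifs <;> simp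
  have hgβ : ∀ i < X.n, ∀ j < X.n, (gram C col (negWeight kind) i j).natAbs ≤ β :=
    fun i hi j hj => by
      have := natAbs_gram_le (col := col) hw (le_refl C) hi hj
      omega
  refine Total.seq (total_leverrierProgram hL₃.n_eq hgram (fun x => ?_) (by omega) hZV hβ2 hnβ hgβ
    (hpow (by omega)) fun μ₄ hμ₄ hT _ => ?_)
  · rw [hμ₃ aM (by decide), hμ₂ aM (by decide), hμ₁ aM (by decide), h0 aM (by decide)]
  have hL₄ := hL₃.agree hμ₄ (by decide)
  have ht0 := lastNonzero_ne_zero X.n (gram C col (negWeight kind))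
  have htβ := natAbs_lastNonzero_le hβ2 hnβ hgβ
  have hNV : (modulus X.n C col kind β).natAbs ≤ valueBound L := by
    rw [modulus, Int.natAbs_mul, Int.natAbs_mul, Int.natAbs_pow, Int.natAbs_natCast]
    calc _ ≤ β ^ (6 * X.n) * β ^ (6 * X.n) * β ^ (20 * (X.n + 1)) :=
          Nat.mul_le_mul_right _ (Nat.mul_le_mul htβ htβ)
      _ = β ^ (6 * X.n + 6 * X.n + 20 * (X.n + 1)) := by rw [pow_add, pow_add]
      _ ≤ _ := hpow (by omega)
  -- The coefficient t may be negative; the modulus contains its square and is therefore positive.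
  have hN1 : 1 < modulus X.n C col kind β := by
    have h1 : 0 < lastNonzero X.n (gram C col (negWeight kind)) X.n *
        lastNonzero X.n (gram C col (negWeight kind)) X.n := mul_self_pos.mpr ht0
    have h2 : (1 : ℤ) < (β : ℤ) ^ (20 * (X.n + 1)) :=
      one_lt_pow₀ (by exact_mod_cast hβ2) (by omega)
    unfold modulus
    nlinarith
  have hNZ : (modulus X.n C col kind β).natAbs.size ≤ loopBound L := by
    rw [← size_valueBound]
    exact Nat.size_le_size hNV
  refine Total.seq (total_computeModulus hL₄.n_eq hT (β := β) ?_ (by omega) (by omega) hZV ?_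
    fun μ₅ hμ₅ hN _ => ?_)
  · rw [hμ₄ vBeta (by decide), hμ₃ vBeta (by decide), hβ₂, hβ]
  · rwa [modulus, Int.natAbs_mul, Int.natAbs_pow, Int.natAbs_natCast] at hNV
  rw [← modulus] at hN
  have hL₅ := hL₄.agree hμ₅ (by decide)
  generalize hNe : modulus X.n C col kind β = N at hNV hN1 hNZ hN
  have hDZ : X.n + C ≤ loopBound L := (Nat.le_mul_self _).trans hD
  refine Total.seq (total_initBasis hL₅ hN hN1 hD hZV hNV fun μ₆ hμ₆ hD₆ hI₆ _ => ?_)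
  have hL₆ := hL₅.agree hμ₆ (by decide)
  have hN₆ : μ₆ vMod 0 = N := by rw [hμ₆ vMod (by decide), hN]
  refine Total.seq (total_insertColumns hL₆ hD₆ hN₆ hN1 hI₆ hDZ hZV hNV hNZ
    fun μ₇ hμ₇ hI₇ _ => ?_)
  have hL₇ := hL₆.agree hμ₇ (by decide)
  have hN₇ : μ₇ vMod 0 = N := by rw [hμ₇ vMod (by decide), hN₆]
  have hD₇ : μ₇ vD 0 = (X.n + C : ℕ) := by rw [hμ₇ vD (by decide), hD₆]
  refine Total.seq (total_reduceBasis hD₇ hN₇ hI₇ hDZ hZV hNV fun μ₈ hμ₈ hI₈ hred _ => ?_)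
  have hL₈ := hL₇.agree hμ₈ (by decide)
  have hD₈ : μ₈ vD 0 = (X.n + C : ℕ) := by rw [hμ₈ vD (by decide), hD₇]
  have hsplit := splits_iff hX hdec hβ2 hnβ hCβ hsβ hI₈.tri hred (by rw [hI₈.span_eq, hNe])
  -- B splits along the full index set, so no non-zero entry links a coordinate of the family with a
  -- column marked -1.
  have hlink : ∀ a < C, ∀ c < C, basisOf (X.n + C) μ₈ (X.n + a) (X.n + c) ≠ 0 →
      (0 ≤ kind a ↔ 0 ≤ kind c) := by
    intro a ha c hc hne
    have h1 := (hsplit Set.univ).mp (splits_univ hdec _) a ha c hc hne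
    have h2 : ∀ c < C, (0 ≤ kind c ↔ ∃ l ∈ (Set.univ : Set (Fin X.r)), kind c = (l : ℕ)) := by
      intro c hc
      rcases hX.kind_eq c hc with h | ⟨l, h⟩
      · simp only [Set.mem_univ, true_and, h]
        constructor
        · omega
        · rintro ⟨l, hl⟩
          omega
      · simp only [Set.mem_univ, true_and, h]
        exact ⟨fun _ => ⟨l, rfl⟩, fun _ => Int.natCast_nonneg _⟩
    rw [h2 a ha, h2 c hc, h1]
  refine Total.seq (total_mergeLabels hL₈ hD₈ hX.kind_eq hlink ?_ (by omega) (by omega) hZV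
    fun μ₉ hμ₉ U hU hUU hUT _ => ?_)
  · rw [hμ₈ aU (by decide), hμ₇ aU (by decide), hμ₆ aU (by decide), hμ₅ aU (by decide),
      hμ₄ aU (by decide), hμ₃ aU (by decide), hμ₂ aU (by decide), hμ₁ aU (by decide),
      h0 aU (by decide)]
  have hR₉ : μ₉ vR 0 = X.r := by rw [hμ₉ vR (by decide), hL₈.r_eq]
  refine total_writeOutput hR₉ hU hUU (by omega) hZV fun ν _ s u hus hu hout =>
    ⟨s, u, hout, isUniversalRestricting_of_splits hdec hus fun T => ?_⟩
  refine (hsplit T).trans ((hUT T).symm.trans ?_)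
  rw [respects_iff hUU]
  simp only [hu]

/-! ### Polynomial growth of the step count -/

/-- A function on the natural numbers is polynomial if it is the evaluation of a polynomial with
natural coefficients. -/
def IsPolynomial (f : ℕ → ℕ) : Prop := ∃ q : Polynomial ℕ, ∀ x, f x = q.eval x

theorem IsPolynomial.id : IsPolynomial fun x => x := ⟨Polynomial.X, by simp⟩

theorem IsPolynomial.const (c : ℕ) : IsPolynomial fun _ => c := ⟨Polynomial.C c, by simp⟩

theorem IsPolynomial.add {f g : ℕ → ℕ} (hf : IsPolynomial f) (hg : IsPolynomial g) :
    IsPolynomial fun x => f x + g x := by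
  obtain ⟨p, hp⟩ := hf
  obtain ⟨q, hq⟩ := hg
  exact ⟨p + q, by simp [hp, hq]⟩

theorem IsPolynomial.mul {f g : ℕ → ℕ} (hf : IsPolynomial f) (hg : IsPolynomial g) :
    IsPolynomial fun x => f x * g x := by
  obtain ⟨p, hp⟩ := hf
  obtain ⟨q, hq⟩ := hg
  exact ⟨p * q, by simp [hp, hq]⟩

theorem IsPolynomial.comp {f g : ℕ → ℕ} (hf : IsPolynomial f) (hg : IsPolynomial g) :
    IsPolynomial fun x => f (g x) := by
  obtain ⟨p, hp⟩ := hf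
  obtain ⟨q, hq⟩ := hg
  exact ⟨p.comp q, by simp [hp, hq]⟩

theorem isPolynomial_loopBound : IsPolynomial loopBound :=
  ⟨128 * (Polynomial.X + 1) ^ 2 + 1, by simp [loopBound]⟩

theorem isPolynomial_mainSteps : IsPolynomial mainSteps := by
  unfold mainSteps parseSteps nextSteps blockSteps leverrierSteps insertSteps euclidSteps
    reduceSteps mergeSteps outputSteps
  repeat' first
    | exact IsPolynomial.id
    | exact IsPolynomial.const _
    | refine IsPolynomial.add ?_ ?_
    | refine IsPolynomial.mul ?_ ?_

end RandomAccess


/-- The time is at most the number of steps, a polynomial in `loopBound`, times the cost of one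
step, a polynomial in the bit length of `valueBound`, which is `loopBound` again; and `loopBound` is
quadratic in the length of the input. -/
theorem mainTheorem12 :
    ∃ (P : RandomAccess.Program) (p : Polynomial ℕ), ∀ X : DecompositionInput,
      ModuleDecomposition.IsDecomposition X.family →
        ∃ (s : ℕ) (u : Fin X.r → Fin s) (μ : RandomAccess.Memory) (t : ℕ),
          RandomAccess.Runs P (RandomAccess.initial X.encode) μ t ∧
          t ≤ p.eval (RandomAccess.wordLength X.encode) ∧
          RandomAccess.HoldsOutput μ (DecompositionInput.encodeMap u) ∧
          ModuleDecomposition.IsUniversalRestricting.{v} X.family X.subgroup u := by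
  obtain ⟨q, hq⟩ := RandomAccess.isPolynomial_mainSteps.comp RandomAccess.isPolynomial_loopBound
  obtain ⟨q', hq'⟩ := RandomAccess.isPolynomial_loopBound
  refine ⟨RandomAccess.mainProgram, q * (Polynomial.C RandomAccess.mainProgram.weight *
    (Polynomial.C RandomAccess.mainProgram.weight * q' + 1)), fun X hdec => ?_⟩
  obtain ⟨μ, k, hexec, hk, -, s, u, hout, huniv⟩ := RandomAccess.total_mainProgram.{v} X hdec
  have hB := RandomAccess.bounded_initial X.encode
  have hV2 : 2 ≤ RandomAccess.valueBound (RandomAccess.wordLength X.encode) :=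
    Nat.le_self_pow (by positivity) 2
  have hVL : 2 ^ RandomAccess.wordLength X.encode ≤
      RandomAccess.valueBound (RandomAccess.wordLength X.encode) :=
    Nat.pow_le_pow_right (by omega) (by nlinarith)
  obtain ⟨-, t, hrun, ht⟩ := hexec.runs hV2 (fun a i => (hB a i).trans hVL) le_rfl
  refine ⟨s, u, μ, t, hrun, ht.trans ?_, hout, huniv⟩
  rw [RandomAccess.size_valueBound]
  refine (Nat.mul_le_mul_right _ hk).trans (le_of_eq ?_)
  simp [hq, ← hq', RandomAccess.unitCost]
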